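/- **Setting.** Let $b>0$, $\mathrm d>0$, $\alpha_0>0$, $c,\alpha_1,\alpha_2\in\mathbb R$, $p\ge -2$ be real constants, and let $f,g,h$ be functions of five complex variables, analytic near the origin, real at real points, whose Taylor series at $0$ start at total degree at least $3$. For small $\delta>0$ and real $\sigma$ put $\alpha=\alpha_0+\alpha_1\delta\sigma+\alpha_2\delta^2$ and consider the family $$\dot x=x(\sigma-\mathrm d z)+\left(\tfrac{\alpha}{\delta}+cz\right)y+\delta^pf,\quad \dot y=-\left(\tfrac{\alpha}{\delta}+cz\right)x+y(\sigma-\mathrm d z)+\delta^pg,\quad \dot z=-1+b(x^2+y^2)+z^2+\delta^ph,$$ with $f,g,h$ evaluated at $(\delta x,\delta y,\delta z,\delta,\delta\sigma)$. Put $R_0(u)=\frac{\mathrm d+1}{2b}\cosh^{-2}(\mathrm d u)$, $Z_0(u)=\tanh(\mathrm d u)$, and $$\mathcal F(0)(u,\theta)=2\sigma R_0(u)+\delta^p\sqrt{2R_0(u)}\,\big(\cos\theta\, f+\sin\theta\, g\big)+\delta^p\tfrac{\mathrm d+1}{b}Z_0(u)\,h,$$ where $f,g,h$ are evaluated at $\big(\delta\sqrt{2R_0(u)}\cos\theta,\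 \delta\sqrt{2R_0(u)}\sin\theta,\ \delta Z_0(u),\ \delta,\ \delta\sigma\big)$. This is the value at $r=0$ of the operator $\mathcal F$ for which the surface $\{x^2+y^2=2(R_0(u)+r(u,\theta)),\ z=Z_0(u)\}$ is invariant exactly when $(-\alpha/\delta-cZ_0)\partial_\theta r+\partial_ur-2Z_0r=\mathcal F(r)$. With $\eta^{\mp}(w)=\alpha w\mp\delta\big(cw\mp\frac c{\mathrm d}\log(1+e^{\pm2\mathrm dw})\big)$ the dominant parts of the unstable (u, upper signs) and stable (s, lower signs) manifolds are $$r_{10}^{\mathrm u,\mathrm s}(u,\theta)=\cosh^{2/\mathrm d}(\mathrm du)\int_{\mp\infty}^u\frac{\mathcal F(0)\big(w,\theta-\delta^{-1}(\eta^\mp(w)-\eta^\mp(u))\big)}{\cosh^{2/\mathrm d}(\mathrm dw)}\,dw ,$$ and the Melnikov function is $M=r_{10}^{\mathrm u}-r_{10}^{\mathrm s}$. Writing $G^{[l]}=\frac1{2\pi}\int_0^{2\pi}G(\theta)e^{-il\theta}d\theta$, its Fourier coefficients in $\theta$ are $\cosh^{2/\mathrm d}(\mathrm du)\,e^{il(\alpha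 u/\delta+(c/\mathrm d)\log\cosh(\mathrm du))}\,\Upsilon_0^{[l]}$, where $$\Upsilon_0^{[l]}=\int_{-\infty}^{+\infty}\frac{e^{-il(\alpha w/\delta+(c/\mathrm d)\log\cosh(\mathrm dw))}\,\mathcal F(0)^{[l]}(w)}{\cosh^{2/\mathrm d}(\mathrm dw)}\,dw,\qquad l\in\mathbb Z .$$ Let $s=\sqrt{(\mathrm d+1)/b}$, $\kappa=\frac2{\mathrm d}+i\frac c{\mathrm d}$, and $$m(w,\theta)=s\,w^{1+\kappa}\Big(\cos\theta\, f(\mathbf w)+\sin\theta\, g(\mathbf w)-i\,s\,h(\mathbf w)\Big),\qquad \mathbf w=(s\,w\cos\theta,\ s\,w\sin\theta,\ -iw,\ 0,\ 0).$$ The Borel transform of $m(w,\theta)=\sum_{n\ge0}m_n(\theta)w^{n+1+\kappa}$ is $\hat m(\zeta,\theta)=\sum_{n\ge0}m_n(\theta)\frac{\zeta^{n+\kappa}}{\Gamma(n+1+\kappa)}$; let $\hat m^{[1]}(\zeta)$ be its first Fourier coefficient in $\theta$, and put $$\mathcal C=\mathcal C_1-i\,\mathcal C_2=\frac{4\pi}{\mathrm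 d}\,\hat m^{[1]}\!\left(\frac\alpha{\mathrm d}\right),\qquad \mathcal C_1,\mathcal C_2\in\mathbb R .$$ **Theorem.** For every $\sigma^*>0$ there are constants $\delta^*>0$ and $K>0$ such that for all $0<\delta\le\delta^*$ and all real $\sigma$ with $|\sigma|\le\sigma^*\delta^{p+3}$ the following hold, where every $\mathcal O(\delta)$ is bounded in modulus by $K\delta$: 1. $\displaystyle \Upsilon_0^{[1]}=\overline{\Upsilon_0^{[-1]}}=\delta^{\,p-\frac2{\mathrm d}-i\frac c{\mathrm d}}\,e^{-\frac{\alpha\pi}{2\mathrm d\delta}}\Big(\frac{\mathcal C}2+\mathcal O(\delta)\Big).$ 2. For all $l\in\mathbb Z$ with $|l|\ge2$: $\displaystyle \big|\Upsilon_0^{[l]}\big|\le K\,\delta^{\,p-\frac2{\mathrm d}}\,e^{-\frac{\alpha\pi}{2\mathrm d\delta}\frac{3|l|}4}.$ 3. For all real $u$ and $\theta$, with $\vartheta(u,\delta)=\delta^{-1}\alpha u+\frac c{\mathrm d}\big[\log\cosh(\mathrm du)-\log\delta\big]$, $$M(u,\theta)=\cosh^{\frac2{\mathrm d}}(\mathrm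 du)\Big[\Upsilon_0^{[0]}+\delta^{\,p-\frac2{\mathrm d}}e^{-\frac{\alpha\pi}{2\mathrm d\delta}}\Big(\mathcal C_1\cos(\theta+\vartheta(u,\delta))+\mathcal C_2\sin(\theta+\vartheta(u,\delta))+\mathcal O(\delta)\Big)\Big],$$ with a real $\mathcal O(\delta)$ term. -/

import Mathlib

open Filter Topology Asymptotics MeasureTheory

noncomputable section

/-- The data of the three-dimensional family
`x' = x (σ - d z) + (α / δ + c z) y + δ ^ p * f (δ x, δ y, δ z, δ, δ σ)`,
`y' = -(α / δ + c z) x + y (σ - d z) + δ ^ p * g (δ x, δ y, δ z, δ, δ σ)`,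
`z' = -1 + b (x ^ 2 + y ^ 2) + z ^ 2 + δ ^ p * h (δ x, δ y, δ z, δ, δ σ)`,
where `α = α₀ + α₁ δ σ + α₂ δ ^ 2` and `δ`, `σ` are the parameters of the family. -/
structure HopfZeroFamily where
  b : ℝ
  c : ℝ
  d : ℝ
  α₀ : ℝ
  α₁ : ℝ
  α₂ : ℝ
  p : ℝ
  f : ℂ × ℂ × ℂ × ℂ × ℂ → ℂ
  g : ℂ × ℂ × ℂ × ℂ × ℂ → ℂ
  h : ℂ × ℂ × ℂ × ℂ × ℂ → ℂ

/-- A perturbation term: a real analytic function near the origin of `ℂ ^ 5` (analytic, and real at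
real points), all of whose Taylor terms have total degree at least three. -/
def IsPerturbationTerm (φ : ℂ × ℂ × ℂ × ℂ × ℂ → ℂ) : Prop :=
  AnalyticAt ℂ φ 0 ∧
  (∀ᶠ v : ℝ × ℝ × ℝ × ℝ × ℝ in 𝓝 0,
    (φ ((v.1 : ℂ), (v.2.1 : ℂ), (v.2.2.1 : ℂ), (v.2.2.2.1 : ℂ), (v.2.2.2.2 : ℂ))).im = 0) ∧
  φ =O[𝓝 0] fun v => ‖v‖ ^ 3

/-- The `l`-th Fourier coefficient `(2π)⁻¹ ∫_0^{2π} G(θ) e^{-ilθ} dθ` of a `2π`-periodic function. -/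
def circleCoeff (l : ℤ) (G : ℝ → ℂ) : ℂ :=
  fourierCoeffOn Real.two_pi_pos G l

/-- The Borel transform `∑ n, φ_n ζ ^ (n + κ) / Γ(n + 1 + κ)` of the function
`w ^ (1 + κ) * φ w = ∑ n, φ_n w ^ (n + 1 + κ)`, where `φ` is analytic at `0` with Taylor
coefficients `φ_n`. -/
def borelTransform (κ : ℂ) (φ : ℂ → ℂ) (ζ : ℂ) : ℂ :=
  ∑' n : ℕ, (iteratedDeriv n φ 0 / (n.factorial : ℂ)) *
    (ζ ^ ((n : ℂ) + κ) / Complex.Gamma ((n : ℂ) + 1 + κ))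

namespace HopfZeroFamily

/-- The frequency `α(δ², δσ)`. -/
def α (S : HopfZeroFamily) (δ σ : ℝ) : ℝ := S.α₀ + S.α₁ * (δ * σ) + S.α₂ * δ ^ 2

/-! The unperturbed two-dimensional heteroclinic connection, in the coordinates
`x = √(2r) cos θ`, `y = √(2r) sin θ`, `z`. -/

def R₀ (S : HopfZeroFamily) (t : ℝ) : ℝ :=
  (S.d + 1) / (2 * S.b) * (1 / Real.cosh (S.d * t) ^ 2)

def Z₀ (S : HopfZeroFamily) (t : ℝ) : ℝ := Real.tanh (S.d * t)

/-- The point `(δx, δy, δz, δ, δσ)` with `x = √(2r) cos θ`, `y = √(2r) sin θ`. -/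
def argPoint (r θ z δ σ : ℝ) : ℂ × ℂ × ℂ × ℂ × ℂ :=
  (((δ * (√(2 * r) * Real.cos θ) : ℝ) : ℂ), ((δ * (√(2 * r) * Real.sin θ) : ℝ) : ℂ),
    ((δ * z : ℝ) : ℂ), (δ : ℂ), ((δ * σ : ℝ) : ℂ))

/-! The components of the perturbation in the coordinates `(r, θ, z)`. -/

def polarF (S : HopfZeroFamily) (r θ z δ σ : ℝ) : ℂ :=
  (√(2 * r) : ℂ) * (Real.cos θ * S.f (argPoint r θ z δ σ) + Real.sin θ * S.g (argPoint r θ z δ σ))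

def polarG (S : HopfZeroFamily) (r θ z δ σ : ℝ) : ℂ :=
  (1 / √(2 * r) : ℂ) *
    (-Real.sin θ * S.f (argPoint r θ z δ σ) + Real.cos θ * S.g (argPoint r θ z δ σ))

def polarH (S : HopfZeroFamily) (r θ z δ σ : ℝ) : ℂ := S.h (argPoint r θ z δ σ)

/-! The same components along the surface `r = R₀(u) + ρ(u, θ)`, `z = Z₀(u)`. -/

def barF (S : HopfZeroFamily) (δ σ : ℝ) (ρ : ℝ → ℝ → ℝ) (u θ : ℝ) : ℂ :=
  S.polarF (S.R₀ u + ρ u θ) θ (S.Z₀ u) δ σ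

def barG (S : HopfZeroFamily) (δ σ : ℝ) (ρ : ℝ → ℝ → ℝ) (u θ : ℝ) : ℂ :=
  S.polarG (S.R₀ u + ρ u θ) θ (S.Z₀ u) δ σ

def barH (S : HopfZeroFamily) (δ σ : ℝ) (ρ : ℝ → ℝ → ℝ) (u θ : ℝ) : ℂ :=
  S.polarH (S.R₀ u + ρ u θ) θ (S.Z₀ u) δ σ

/-- The operator `𝓕`: the graph `r = R₀(u) + ρ(u, θ)` over `z = Z₀(u)` is invariant when
`(-α/δ - c Z₀) ∂_θ ρ + ∂_u ρ - 2 Z₀ ρ = 𝓕(ρ)`. -/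
def opF (S : HopfZeroFamily) (δ σ : ℝ) (ρ : ℝ → ℝ → ℝ) (u θ : ℝ) : ℂ :=
  2 * σ * (S.R₀ u + ρ u θ) + (δ ^ S.p : ℝ) * S.barF δ σ ρ u θ
    + (δ ^ S.p : ℝ) * ((S.d + 1) / S.b) * S.Z₀ u * S.barH δ σ ρ u θ
    - (δ ^ S.p : ℝ) * S.barG δ σ ρ u θ * deriv (fun t => ρ u t) θ
    - (2 * S.b * ρ u θ + (δ ^ S.p : ℝ) * S.barH δ σ ρ u θ) / (S.d * (1 - S.Z₀ u ^ 2))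
      * deriv (fun t => ρ t θ) u

/-- `η⁻`, used for the unstable manifold. -/
def ηU (S : HopfZeroFamily) (δ σ w : ℝ) : ℝ :=
  S.α δ σ * w - δ * (S.c * w - S.c / S.d * Real.log (1 + Real.exp (2 * S.d * w)))

/-- `η⁺`, used for the stable manifold. -/
def ηS (S : HopfZeroFamily) (δ σ w : ℝ) : ℝ :=
  S.α δ σ * w + δ * (S.c * w + S.c / S.d * Real.log (1 + Real.exp (-2 * S.d * w)))

/-- Dominant part of the unstable manifold:
`cosh^{2/d}(du) ∫_{-∞}^u 𝓕(0)(w, θ - (η⁻(w) - η⁻(u))/δ) / cosh^{2/d}(dw) dw`. -/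
def rU (S : HopfZeroFamily) (δ σ u θ : ℝ) : ℂ :=
  (Real.cosh (S.d * u) ^ (2 / S.d) : ℝ) *
    ∫ w in Set.Iic u, S.opF δ σ 0 w (θ - δ⁻¹ * (S.ηU δ σ w - S.ηU δ σ u))
      / (Real.cosh (S.d * w) ^ (2 / S.d) : ℝ)

/-- Dominant part of the stable manifold:
`cosh^{2/d}(du) ∫_{+∞}^u 𝓕(0)(w, θ - (η⁺(w) - η⁺(u))/δ) / cosh^{2/d}(dw) dw`. -/
def rS (S : HopfZeroFamily) (δ σ u θ : ℝ) : ℂ :=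
  (Real.cosh (S.d * u) ^ (2 / S.d) : ℝ) *
    -∫ w in Set.Ioi u, S.opF δ σ 0 w (θ - δ⁻¹ * (S.ηS δ σ w - S.ηS δ σ u))
      / (Real.cosh (S.d * w) ^ (2 / S.d) : ℝ)

/-- The Melnikov function. -/
def melnikov (S : HopfZeroFamily) (δ σ u θ : ℝ) : ℂ := S.rU δ σ u θ - S.rS δ σ u θ

/-- The constants `Υ₀^{[l]}`, for which
`M(u, θ) = cosh^{2/d}(du) ∑ l, Υ₀^{[l]} e^{il(θ + αu/δ + (c/d) log cosh(du))}`. -/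
def upsilon (S : HopfZeroFamily) (δ σ : ℝ) (l : ℤ) : ℂ :=
  ∫ w : ℝ, Complex.exp (-Complex.I * l *
        ((δ⁻¹ * S.α δ σ * w + S.c / S.d * Real.log (Real.cosh (S.d * w)) : ℝ) : ℂ))
      * circleCoeff l (fun θ => S.opF δ σ 0 w θ)
      / (Real.cosh (S.d * w) ^ (2 / S.d) : ℝ)

/-- The point `(√((d+1)/b) w cos θ, √((d+1)/b) w sin θ, -iw, 0, 0)`. -/
def wPoint (S : HopfZeroFamily) (w : ℂ) (θ : ℝ) : ℂ × ℂ × ℂ × ℂ × ℂ :=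
  ((√((S.d + 1) / S.b) : ℂ) * w * Real.cos θ, (√((S.d + 1) / S.b) : ℂ) * w * Real.sin θ,
    -Complex.I * w, 0, 0)

def Ftilde (S : HopfZeroFamily) (w : ℂ) (θ : ℝ) : ℂ :=
  Real.cos θ * S.f (S.wPoint w θ) + Real.sin θ * S.g (S.wPoint w θ)

/-- The exponent `2/d + i c/d`. -/
def κ (S : HopfZeroFamily) : ℂ := 2 / S.d + Complex.I * (S.c / S.d)

/-- The factor of `m(w, θ)`, analytic at `w = 0`, that multiplies `w ^ (1 + 2/d + i c/d)`. -/
def mReg (S : HopfZeroFamily) (w : ℂ) (θ : ℝ) : ℂ :=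
  (√((S.d + 1) / S.b) : ℂ) *
    (S.Ftilde w θ - Complex.I * (√((S.d + 1) / S.b) : ℂ) * S.h (S.wPoint w θ))

/-- The Borel transform in `w` of `m(w, θ) = w ^ (1 + 2/d + i c/d) * mReg w θ`. -/
def mHat (S : HopfZeroFamily) (ζ : ℂ) (θ : ℝ) : ℂ :=
  borelTransform S.κ (fun w => S.mReg w θ) ζ

/-- `𝒞 = (4π/d) m̂^{[1]}(α/d)`, with `m̂^{[1]}` the first Fourier coefficient of `m̂` in `θ`. -/
def bigC (S : HopfZeroFamily) (δ σ : ℝ) : ℂ :=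
  (4 * Real.pi / S.d : ℝ) * circleCoeff 1 (fun θ => S.mHat ((S.α δ σ / S.d : ℝ) : ℂ) θ)

def C₁ (S : HopfZeroFamily) (δ σ : ℝ) : ℝ := (S.bigC δ σ).re

def C₂ (S : HopfZeroFamily) (δ σ : ℝ) : ℝ := -(S.bigC δ σ).im

/-- The phase `ϑ(u, δ)`. -/
def phase (S : HopfZeroFamily) (δ σ u : ℝ) : ℝ :=
  δ⁻¹ * S.α δ σ * u + S.c / S.d * (Real.log (Real.cosh (S.d * u)) - Real.log δ)

end HopfZeroFamily

end

/-! For `l ≠ 0` the harmonic `Υ₀^{[l]}` is an oscillatory integral over the real line. The term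
`2σR₀` does not depend on `θ` and drops out. For `l > 0` the integrand continues analytically
towards the zero `w = -iπ/(2d)` of `cosh (dw)`; negative `l` follow by conjugation, because `f, g,
h` are real at real points. In the variable `z = π/2 - i d w` the function `cosh (dw)` becomes `sin
z`, the real line becomes `Re z = π/2`, and the singularity sits at `z = 0`. With `A = απ/(2dδ)` the
integrand is `e^{-lA} e^{lαz/(dδ)} (sin z)^{-2/d - ilc/d}` times `δ⁻¹ q(δ/sin z, δ cot z, δ, δσ)`,
up to constants, where `q` is analytic and vanishes to fourth order. By Cauchy's theorem
(`stripKernel_shift`) the line can be moved to any `Re z = x₀ > 0` on which the argument of `q`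
stays in its ball of analyticity.

For `|l| ≥ 2` the line `x₀ = π/16` suffices. The exponential costs `e^{|l|A/8}`, the imaginary part
of the exponent costs at most as much again once `8|c|δ ≤ α`, and `e^{-3|l|A/4}` remains.

For `l = 1` the line is `x₀ = Cδ` with `C` fixed, so the exponential stays bounded. Replacing `sin
z` by `z`, `cot z` by `1/z` and the last two arguments by `0` has relative error `O(|z|)` near `0`
(`exists_norm_sin_cpow_sub_le`). After `z = δζ` the leading part is an inverse Laplace integral of
`ζ^{-(κ+1)} φ(1/ζ)`, with `w φ(w) = q(w, w, 0, 0)`. Hankel's formula, applied to each Taylor term,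
turns it into `2π` times the Borel transform at `α/d` (`integral_vertical_line_borelTransform`),
which is where `𝒞` comes from.

For the Melnikov function, `η⁻` and `η⁺` equal `δ` times one common phase up to one common constant,
so the two half-line integrals join into an integral over `ℝ` (`melnikov_eq`). Hence `M` is
`cosh^{2/d}(du)` times a periodic profile whose Fourier coefficients are the `Υ₀^{[l]}`. The
harmonics `±1` are conjugate and produce `𝒞₁ cos + 𝒞₂ sin`; the others form a geometric tail of
relative size `e^{-A/2} = O(δ)`. -/

/-! ### Contour shifts and Laplace inversion on vertical lines -/

theorem norm_ofReal_sub_I_mul_sq (x t : ℝ) : ‖(x : ℂ) - Complex.I * t‖ ^ 2 = x ^ 2 + t ^ 2 := by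
  rw [← Complex.normSq_eq_norm_sq, Complex.normSq_apply]
  simp
  ring

/-- Cauchy's theorem between two vertical lines. -/
theorem integral_vertical_line_eq {F : ℂ → ℂ} {a b : ℝ} (hab : a ≤ b)
    (hF : ∀ z : ℂ, a ≤ z.re → z.re ≤ b → DifferentiableAt ℂ F z) {g : ℝ → ℝ}
    (hg : Integrable g) (hg0 : Tendsto g (cocompact ℝ) (𝓝 0))
    (hbd : ∀ x t : ℝ, a ≤ x → x ≤ b → ‖F (x - Complex.I * t)‖ ≤ g t) :
    ∫ t : ℝ, F (a - Complex.I * t) = ∫ t : ℝ, F (b - Complex.I * t) := by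
  have hline : ∀ x : ℝ, a ≤ x → x ≤ b → Integrable fun t : ℝ => F (x - Complex.I * t) := by
    intro x hax hxb
    refine hg.mono' (Continuous.aestronglyMeasurable ?_) (Eventually.of_forall fun t => hbd x t hax hxb)
    rw [continuous_iff_continuousAt]
    intro t
    exact ContinuousAt.comp (f := fun t : ℝ => (x : ℂ) - Complex.I * t)
      (hF _ (by simpa using hax) (by simpa using hxb)).continuousAt (by fun_prop)
  have hcoc : Tendsto g atTop (𝓝 0) := hg0.mono_left atTop_le_cocompact
  have hcoc' : Tendsto g atBot (𝓝 0) := hg0.mono_left atBot_le_cocompact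
  have hrect : ∀ T : ℝ, 0 ≤ T → (∫ t in (-T)..T, F (b - Complex.I * t))
      - (∫ t in (-T)..T, F (a - Complex.I * t)) = Complex.I *
        ((∫ x in a..b, F (x - Complex.I * ((T : ℝ) : ℂ)))
          - ∫ x in a..b, F (x - Complex.I * ((-T : ℝ) : ℂ))) := by
    intro T hT
    have h := Complex.integral_boundary_rect_eq_zero_of_differentiableOn F
      (Complex.mk a (-T)) (Complex.mk b T) (by
        intro z hz
        rw [Complex.mem_reProdIm, Set.uIcc_of_le hab] at hz
        exact (hF z hz.1.1 hz.1.2).differentiableWithinAt)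
    -- The lines are parametrised downwards, as `x - it`, because `z = π/2 - i d w` runs that way.
    -- The symmetric interval lets `y = -t` match the rectangle formula without a sign.
    have hflip : ∀ c : ℝ, ∫ y in (-T)..T, F (c + y * Complex.I)
        = ∫ t in (-T)..T, F (c - Complex.I * t) := by
      intro c
      have := intervalIntegral.integral_comp_neg (a := -T) (b := T)
        (fun y : ℝ => F (c + y * Complex.I))
      rw [neg_neg] at this
      rw [← this]
      congr 1
      ext t
      congr 1
      push_cast
      ring
    simp only [hflip] at h
    have e1 : ∀ x : ℝ, F (x - Complex.I * ((T : ℝ) : ℂ)) = F (x + ((-T : ℝ) : ℂ) * Complex.I) := by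
      intro x; congr 1; push_cast; ring
    have e2 : ∀ x : ℝ, F (x - Complex.I * ((-T : ℝ) : ℂ)) = F (x + (T : ℂ) * Complex.I) := by
      intro x; congr 1; push_cast; ring
    simp only [e1, e2]
    simp only [smul_eq_mul] at h
    linear_combination (-Complex.I) * h + ((∫ t in (-T)..T, F (b - Complex.I * t))
      - (∫ t in (-T)..T, F (a - Complex.I * t))) * Complex.I_sq
  have hlim : Tendsto (fun T : ℝ => (∫ t in (-T)..T, F (b - Complex.I * t))
      - (∫ t in (-T)..T, F (a - Complex.I * t))) atTop
      (𝓝 ((∫ t : ℝ, F (b - Complex.I * t)) - ∫ t : ℝ, F (a - Complex.I * t))) :=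
    (intervalIntegral_tendsto_integral (hline b hab le_rfl) tendsto_neg_atTop_atBot tendsto_id).sub
      (intervalIntegral_tendsto_integral (hline a le_rfl hab) tendsto_neg_atTop_atBot tendsto_id)
  have hzero : Tendsto (fun T : ℝ => (∫ t in (-T)..T, F (b - Complex.I * t))
      - (∫ t in (-T)..T, F (a - Complex.I * t))) atTop (𝓝 0) := by
    have hbound : Tendsto (fun T : ℝ => g T * |b - a| + g (-T) * |b - a|) atTop (𝓝 0) := by
      have := (hcoc.mul_const |b - a|).add ((hcoc'.comp tendsto_neg_atTop_atBot).mul_const |b - a|)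
      simpa using this
    refine squeeze_zero_norm' ?_ hbound
    filter_upwards [eventually_ge_atTop 0] with T hT
    rw [hrect T hT, norm_mul, Complex.norm_I, one_mul]
    refine (norm_sub_le _ _).trans (add_le_add ?_ ?_)
    · refine intervalIntegral.norm_integral_le_of_norm_le_const fun x hx => ?_
      rw [Set.uIoc_of_le hab] at hx
      exact hbd x T hx.1.le hx.2
    · refine intervalIntegral.norm_integral_le_of_norm_le_const fun x hx => ?_
      rw [Set.uIoc_of_le hab] at hx
      exact hbd x (-T) hx.1.le hx.2
  exact (sub_eq_zero.mp (tendsto_nhds_unique hlim hzero)).symm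

/-- The Laplace transform of `t ^ (a - 1)` on the right half-plane. -/
theorem integral_cpow_mul_cexp_neg_mul_Ioi {a r : ℂ} (ha : 0 < a.re) (hr : 0 < r.re) :
    ∫ t : ℝ in Set.Ioi 0, (t : ℂ) ^ (a - 1) * Complex.exp (-(r * t)) =
      r ^ (-a) * Complex.Gamma a := by
  have hopen : IsOpen {z : ℂ | 0 < z.re} := isOpen_lt continuous_const Complex.continuous_re
  have hconv : Convex ℝ {z : ℂ | 0 < z.re} := convex_halfSpace_re_gt 0
  have hnorm : ∀ (b z : ℂ) (t : ℝ), t ∈ Set.Ioi (0 : ℝ) →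
      ‖(t : ℂ) ^ (b - 1) * Complex.exp (-(z * t))‖ = t ^ (b.re - 1) * Real.exp (-(z.re * t)) := by
    intro b z t ht
    rw [norm_mul, Complex.norm_cpow_eq_rpow_re_of_pos ht, Complex.norm_exp]
    simp
  have hreal : ∀ (b : ℂ) (x : ℝ), 0 < b.re → 0 < x →
      IntegrableOn (fun t : ℝ => t ^ (b.re - 1) * Real.exp (-(x * t))) (Set.Ioi 0) := by
    intro b x hb hx
    have := integrableOn_rpow_mul_exp_neg_mul_rpow (p := 1) (s := b.re - 1) (b := x) (by linarith)
      one_pos hx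
    simpa using this
  have hmeas : ∀ (b z : ℂ), AEStronglyMeasurable
      (fun t : ℝ => (t : ℂ) ^ (b - 1) * Complex.exp (-(z * t)))
      (volume.restrict (Set.Ioi 0)) := by
    intro b z
    refine ContinuousOn.aestronglyMeasurable (fun t ht => ?_) measurableSet_Ioi
    refine ContinuousAt.continuousWithinAt ?_
    refine ContinuousAt.mul ?_ (by fun_prop)
    exact ContinuousAt.cpow (by fun_prop) (by fun_prop) (Or.inl (by simpa using ht))
  have hdiff : DifferentiableOn ℂ (fun z : ℂ => ∫ t : ℝ in Set.Ioi 0,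
      (t : ℂ) ^ (a - 1) * Complex.exp (-(z * t))) {z : ℂ | 0 < z.re} := by
    intro z hz
    have hz' : 0 < z.re := hz
    refine DifferentiableAt.differentiableWithinAt ?_
    -- Differentiation under the integral: the half-plane `Re w > Re z / 2` is a neighbourhood of
    -- `z` on which the derivative has a fixed integrable majorant.
    have key := hasDerivAt_integral_of_dominated_loc_of_deriv_le
      (μ := volume.restrict (Set.Ioi (0 : ℝ)))
      (F := fun (z : ℂ) (t : ℝ) => (t : ℂ) ^ (a - 1) * Complex.exp (-(z * t)))
      (F' := fun (z : ℂ) (t : ℝ) => -((t : ℂ) ^ (a + 1 - 1) * Complex.exp (-(z * t))))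
      (x₀ := z) (s := {w : ℂ | z.re / 2 < w.re})
      (bound := fun t : ℝ => t ^ ((a + 1).re - 1) * Real.exp (-(z.re / 2 * t)))
      ((isOpen_lt continuous_const Complex.continuous_re).mem_nhds (by
        show z.re / 2 < z.re; linarith))
      (Eventually.of_forall fun w => hmeas a w)
      (by
        refine (hreal a z.re ha hz').mono' (hmeas a z) ?_
        filter_upwards [ae_restrict_mem measurableSet_Ioi] with t ht using (hnorm a z t ht).le)
      (hmeas (a + 1) z).neg
      (by
        filter_upwards [ae_restrict_mem measurableSet_Ioi] with t ht w hw
        have hw' : z.re / 2 < w.re := hw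
        have ht' : 0 < t := ht
        rw [norm_neg, hnorm (a + 1) w t ht]
        gcongr)
      (hreal (a + 1) (z.re / 2) (by simp; linarith) (by linarith))
      (by
        filter_upwards [ae_restrict_mem measurableSet_Ioi] with t ht w hw
        have ht' : (t : ℂ) ≠ 0 := by simpa using (ne_of_gt ht)
        have h1 : HasDerivAt (fun w : ℂ => Complex.exp (-(w * t)))
            (Complex.exp (-(w * t)) * (-(1 * t))) w :=
          (((hasDerivAt_id w).mul_const (t : ℂ)).neg).cexp
        have h2 := h1.const_mul ((t : ℂ) ^ (a - 1))
        refine h2.congr_deriv ?_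
        have : (t : ℂ) ^ (a + 1 - 1) = (t : ℂ) ^ (a - 1) * t := by
          rw [show a + 1 - 1 = (a - 1) + 1 by ring, Complex.cpow_add _ _ ht', Complex.cpow_one]
        rw [this]; ring)
    exact key.2.differentiableAt
  have hdiff' : DifferentiableOn ℂ (fun z : ℂ => z ^ (-a) * Complex.Gamma a)
      {z : ℂ | 0 < z.re} := by
    intro z hz
    refine DifferentiableAt.differentiableWithinAt ?_
    refine DifferentiableAt.mul_const ?_ _
    exact (differentiableAt_id).cpow_const (Or.inl hz)
  -- Identity theorem: both sides are analytic in `r` on the half-plane and agree at real `r > 1`,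
  -- which accumulate at `1`.
  refine (hdiff.analyticOnNhd hopen).eqOn_of_preconnected_of_frequently_eq
    (hdiff'.analyticOnNhd hopen) hconv.isPreconnected (z₀ := 1) (by simp) ?_ hr
  have hreq : ∀ x : ℝ, 0 < x → (∫ t : ℝ in Set.Ioi 0,
      (t : ℂ) ^ (a - 1) * Complex.exp (-((x : ℂ) * t))) = (x : ℂ) ^ (-a) * Complex.Gamma a := by
    intro x hx
    rw [Complex.integral_cpow_mul_exp_neg_mul_Ioi ha hx, one_div, Complex.inv_cpow,
      Complex.cpow_neg]
    rw [Complex.arg_ofReal_of_nonneg hx.le]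
    exact Real.pi_pos.ne
  have hmap : Tendsto (fun x : ℝ => (x : ℂ)) (𝓝[>] 1) (𝓝[≠] 1) := by
    refine tendsto_nhdsWithin_iff.mpr ⟨?_, ?_⟩
    · exact (Complex.continuous_ofReal.tendsto' 1 1 (by simp)).mono_left nhdsWithin_le_nhds
    · filter_upwards [self_mem_nhdsWithin] with x hx
      simpa using (ne_of_gt hx)
  refine hmap.frequently (Eventually.frequently ?_)
  filter_upwards [self_mem_nhdsWithin] with x hx
  exact hreq x (lt_trans one_pos hx)

/-- On the line `|C - it|² = C² + t² ≥ min(1, C²)(1 + t²)`, and the argument is at most `π/2`, so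
the imaginary part of the exponent costs only a constant factor. -/
theorem integrable_vertical_line_cpow {a : ℂ} (ha : 1 < a.re) {C : ℝ} (hC : 0 < C) :
    Integrable fun t : ℝ => ((C : ℂ) - Complex.I * t) ^ (-a) := by
  have hne : ∀ t : ℝ, (C : ℂ) - Complex.I * t ≠ 0 := fun t h => by
    have := congrArg Complex.re h
    simp at this
    exact hC.ne' this
  have h1 : Integrable fun t : ℝ => (1 + ‖t‖ ^ 2) ^ (-a.re / 2) :=
    integrable_rpow_neg_one_add_norm_sq (by simpa using ha)
  refine (h1.const_mul ((min 1 (C ^ 2)) ^ (-a.re / 2) * Real.exp (Real.pi / 2 * |a.im|))).mono'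
    (Continuous.aestronglyMeasurable ?_) (Eventually.of_forall fun t => ?_)
  · refine Continuous.cpow (by fun_prop) continuous_const fun t => ?_
    left
    simpa using hC
  · rw [Complex.norm_cpow_of_ne_zero (hne t)]
    have hre : (-a).re = -a.re := rfl
    have h2 : ‖(C : ℂ) - Complex.I * t‖ ^ (-a).re
        ≤ min 1 (C ^ 2) ^ (-a.re / 2) * (1 + ‖t‖ ^ 2) ^ (-a.re / 2) := by
      rw [← Real.mul_rpow (by positivity) (by positivity), hre]
      have : ‖(C : ℂ) - Complex.I * t‖ ^ (-a.re)
          = (‖(C : ℂ) - Complex.I * t‖ ^ 2) ^ (-a.re / 2) := by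
        rw [← Real.rpow_natCast, ← Real.rpow_mul (norm_nonneg _)]
        congr 1
        push_cast
        ring
      rw [this, norm_ofReal_sub_I_mul_sq]
      refine Real.rpow_le_rpow_of_nonpos ?_ ?_ (by linarith)
      · have : 0 < min 1 (C ^ 2) := lt_min one_pos (by positivity)
        positivity
      · rw [mul_add]
        refine add_le_add (by simp) ?_
        rw [Real.norm_eq_abs, sq_abs]
        exact (mul_le_mul_of_nonneg_right (min_le_left _ _) (sq_nonneg t)).trans (by simp)
    have harg : |Complex.arg ((C : ℂ) - Complex.I * t)| ≤ Real.pi / 2 :=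
      Complex.abs_arg_le_pi_div_two_iff.mpr (by simpa using hC.le)
    rw [div_eq_mul_inv, ← Real.exp_neg]
    calc _ ≤ (min 1 (C ^ 2) ^ (-a.re / 2) * (1 + ‖t‖ ^ 2) ^ (-a.re / 2))
          * Real.exp (Real.pi / 2 * |a.im|) := by
          refine mul_le_mul h2 (Real.exp_le_exp.mpr ?_) (Real.exp_nonneg _) (by positivity)
          refine (le_abs_self _).trans ?_
          rw [abs_neg, abs_mul, Complex.neg_im, abs_neg]
          exact mul_le_mul_of_nonneg_right harg (abs_nonneg _)
      _ = _ := by ring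

/-- Laplace inversion for powers: Hankel's formula on a vertical line. -/
theorem integral_vertical_line_cexp_mul_cpow {a : ℂ} (ha : 1 < a.re) {C ζ : ℝ} (hC : 0 < C)
    (hζ : 0 < ζ) :
    ∫ t : ℝ, Complex.exp (ζ * (C - Complex.I * t)) * ((C : ℂ) - Complex.I * t) ^ (-a) =
      2 * Real.pi * ((ζ : ℂ) ^ (a - 1) / Complex.Gamma a) := by
  -- The Fourier transform of the one-sided function `t^{a-1} e^{-Ct}` is `Γ(a) (C + 2πiw)^{-a}`;
  -- Fourier inversion at the continuity point `ζ > 0` is the claim.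
  set f : ℝ → ℂ := (Set.Ioi (0 : ℝ)).indicator
    (fun t : ℝ => (t : ℂ) ^ (a - 1) * Complex.exp (-((C : ℂ) * t))) with hfdef
  have ha0 : 0 < a.re := by linarith
  have hG : Complex.Gamma a ≠ 0 := Complex.Gamma_ne_zero_of_re_pos ha0
  have hF : ∀ w : ℝ, FourierTransform.fourier f w =
      ((C : ℂ) - Complex.I * ((-(2 * Real.pi)) * w : ℝ)) ^ (-a) * Complex.Gamma a := by
    intro w
    rw [Real.fourier_real_eq_integral_exp_smul, ← integral_cpow_mul_cexp_neg_mul_Ioi ha0,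
      ← integral_indicator measurableSet_Ioi]
    · congr 1
      ext v
      by_cases hv : v ∈ Set.Ioi (0 : ℝ)
      · simp only [hfdef, Set.indicator_of_mem hv, smul_eq_mul]
        rw [mul_left_comm, ← Complex.exp_add]
        congr 2
        push_cast
        ring
      · simp only [hfdef, Set.indicator_of_notMem hv, smul_zero]
    · simpa using hC
  have hfi : Integrable f := by
    rw [hfdef, integrable_indicator_iff measurableSet_Ioi]
    -- A non-integrable function has integral `0` by convention, whereas the value found, `C^{-a}
    -- Γ(a)`, is nonzero.
    by_contra hcon
    have h0 := integral_undef hcon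
    rw [integral_cpow_mul_cexp_neg_mul_Ioi ha0 (by simpa using hC)] at h0
    have : (C : ℂ) ^ (-a) ≠ 0 := by
      rw [Complex.cpow_def_of_ne_zero (by simpa using hC.ne')]
      exact Complex.exp_ne_zero _
    exact mul_ne_zero this hG h0
  have hFi : Integrable (FourierTransform.fourier f) := by
    have h1 := (integrable_vertical_line_cpow ha hC).comp_mul_left'
      (R := -(2 * Real.pi)) (by simp [Real.pi_ne_zero])
    refine (h1.mul_const (Complex.Gamma a)).congr (Eventually.of_forall fun w => ?_)
    simp only [hF]
  have hcont : ContinuousAt f ζ := by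
    have : f =ᶠ[𝓝 ζ] fun t : ℝ => (t : ℂ) ^ (a - 1) * Complex.exp (-((C : ℂ) * t)) := by
      filter_upwards [Ioi_mem_nhds hζ] with t ht
      exact Set.indicator_of_mem ht _
    refine ContinuousAt.congr ?_ this.symm
    refine ContinuousAt.mul ?_ (by fun_prop)
    exact ContinuousAt.cpow (by fun_prop) (by fun_prop) (Or.inl (by simpa using hζ))
  have hinv := hfi.fourierInv_fourier_eq hFi hcont
  rw [Real.fourierInv_eq'] at hinv
  have hfz : f ζ = (ζ : ℂ) ^ (a - 1) * Complex.exp (-((C : ℂ) * ζ)) :=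
    Set.indicator_of_mem (Set.mem_Ioi.mpr hζ) _
  rw [hfz] at hinv
  have hscale := Measure.integral_comp_mul_left
    (fun t : ℝ => Complex.exp (-(Complex.I * t * ζ)) * ((C : ℂ) - Complex.I * t) ^ (-a))
    (-(2 * Real.pi))
  have e1 : (∫ v : ℝ, Complex.exp (((2 * Real.pi * inner ℝ v ζ : ℝ) : ℂ) * Complex.I)
      • FourierTransform.fourier f v) = (∫ x : ℝ, Complex.exp (-(Complex.I * ((-(2 * Real.pi) * x : ℝ) : ℂ) * ζ))
        * ((C : ℂ) - Complex.I * ((-(2 * Real.pi) * x : ℝ) : ℂ)) ^ (-a)) * Complex.Gamma a := by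
    rw [← integral_mul_const]
    congr 1
    ext v
    rw [hF, smul_eq_mul, ← mul_assoc]
    congr 3
    simp
    ring
  rw [e1, hscale] at hinv
  have habs : |(-(2 * Real.pi))⁻¹| = (2 * Real.pi)⁻¹ := by
    rw [abs_inv, abs_neg, abs_of_pos Real.two_pi_pos]
  rw [habs, Complex.real_smul] at hinv
  have e2 : (∫ t : ℝ, Complex.exp (ζ * (C - Complex.I * t)) * ((C : ℂ) - Complex.I * t) ^ (-a))
      = Complex.exp (C * ζ) * ∫ t : ℝ, Complex.exp (-(Complex.I * t * ζ))
        * ((C : ℂ) - Complex.I * t) ^ (-a) := by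
    rw [← integral_const_mul]
    congr 1
    ext t
    rw [← mul_assoc, ← Complex.exp_add]
    congr 2
    ring
  rw [e2]
  set J := ∫ t : ℝ, Complex.exp (-(Complex.I * t * ζ)) * ((C : ℂ) - Complex.I * t) ^ (-a)
  have hpi : (Real.pi : ℂ) ≠ 0 := by exact_mod_cast Real.pi_ne_zero
  have hJ : J * Complex.Gamma a = 2 * Real.pi * ((ζ : ℂ) ^ (a - 1) * Complex.exp (-(C * ζ))) := by
    rw [← hinv]
    push_cast
    field_simp
  have hexp : Complex.exp (C * ζ) * Complex.exp (-(C * ζ)) = 1 := by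
    rw [← Complex.exp_add]; simp
  field_simp
  linear_combination Complex.exp (C * ζ) * hJ + 2 * Real.pi * (ζ : ℂ) ^ (a - 1) * hexp

/-! ### Lipschitz bounds for complex powers and for functions vanishing to finite order -/

theorem norm_cpow_le_rpow_mul_exp {z a : ℂ} (hz : 0 < z.re) :
    ‖z ^ a‖ ≤ ‖z‖ ^ a.re * Real.exp (Real.pi / 2 * |a.im|) := by
  have hz0 : z ≠ 0 := fun h => by simp [h] at hz
  have harg : |z.arg| ≤ Real.pi / 2 := Complex.abs_arg_le_pi_div_two_iff.mpr hz.le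
  rw [Complex.norm_cpow_of_ne_zero hz0, div_eq_mul_inv, ← Real.exp_neg]
  gcongr
  refine (neg_le_abs _).trans ?_
  rw [abs_mul]
  gcongr

/-- Mean value inequality on the convex set where the half-plane meets the disc of radius `‖v‖/2`
about `v`. There `‖z‖ ≥ ‖v‖/2`, which controls the derivative `a z^{a-1}` because `Re a - 1 ≤ 0`. -/
theorem norm_cpow_sub_cpow_le {u v a : ℂ} (hu : 0 < u.re) (hv : 0 < v.re) (ha : a.re ≤ 1)
    (huv : ‖u - v‖ ≤ ‖v‖ / 2) :
    ‖u ^ a - v ^ a‖ ≤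
      ‖a‖ * Real.exp (Real.pi / 2 * |a.im|) * (‖v‖ / 2) ^ (a.re - 1) * ‖u - v‖ := by
  have hv0 : 0 < ‖v‖ := norm_pos_iff.mpr fun h => by simp [h] at hv
  have hconv : Convex ℝ ({z : ℂ | 0 < z.re} ∩ Metric.closedBall v (‖v‖ / 2)) :=
    (convex_halfSpace_re_gt 0).inter (convex_closedBall _ _)
  have hder : ∀ z ∈ {z : ℂ | 0 < z.re} ∩ Metric.closedBall v (‖v‖ / 2),
      HasDerivWithinAt (fun z : ℂ => z ^ a) (a * z ^ (a - 1))
        ({z : ℂ | 0 < z.re} ∩ Metric.closedBall v (‖v‖ / 2)) z := by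
    intro z hz
    have h1 : HasDerivAt (fun z : ℂ => z ^ a) (a * z ^ (a - 1) * 1) z :=
      (hasDerivAt_id z).cpow_const (Or.inl hz.1)
    rw [mul_one] at h1
    exact h1.hasDerivWithinAt
  refine hconv.norm_image_sub_le_of_norm_hasDerivWithin_le hder ?_
    ⟨hv, Metric.mem_closedBall_self (by positivity)⟩ ⟨hu, by simpa [dist_eq_norm] using huv⟩
  intro z hz
  have hz1 : 0 < z.re := hz.1
  have hz2 : ‖v‖ / 2 ≤ ‖z‖ := by
    have h1 : ‖z - v‖ ≤ ‖v‖ / 2 := by simpa [dist_eq_norm] using hz.2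
    have h2 : ‖v‖ ≤ ‖z‖ + ‖z - v‖ := by
      simpa using norm_sub_le z (z - v)
    linarith
  rw [norm_mul, mul_assoc]
  refine mul_le_mul_of_nonneg_left ?_ (norm_nonneg _)
  refine (norm_cpow_le_rpow_mul_exp hz1).trans ?_
  rw [mul_comm]
  simp only [Complex.sub_im, Complex.one_im, sub_zero, Complex.sub_re, Complex.one_re]
  refine mul_le_mul_of_nonneg_left ?_ (Real.exp_nonneg _)
  exact Real.rpow_le_rpow_of_nonpos (by positivity) hz2 (by linarith)

/-- Cauchy's estimate turns a vanishing order into a Lipschitz bound. -/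
theorem norm_sub_le_of_norm_le_pow {E : Type*} [NormedAddCommGroup E] [NormedSpace ℂ E]
    {q : E → ℂ} {r K M : ℝ} {n : ℕ} (hq : DifferentiableOn ℂ q (Metric.ball 0 r))
    (hK0 : 0 ≤ K) (hK : ∀ v ∈ Metric.ball (0 : E) r, ‖q v‖ ≤ K * ‖v‖ ^ (n + 1))
    (hM : 0 < M) (hMr : 2 * M ≤ r) {a b : E} (ha : ‖a‖ ≤ M) (hb : ‖b‖ ≤ M) :
    ‖q a - q b‖ ≤ 2 ^ (n + 2) * K * M ^ n * ‖a - b‖ := by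
  have hconv : Convex ℝ (Metric.closedBall (0 : E) M) := convex_closedBall _ _
  have hsub : ∀ c ∈ Metric.closedBall (0 : E) M, Metric.ball c M ⊆ Metric.ball 0 r := by
    intro c hc v hv
    have h1 : ‖c‖ ≤ M := by simpa using hc
    have h2 : ‖v - c‖ < M := by simpa [dist_eq_norm] using hv
    have h3 : ‖v‖ ≤ ‖v - c‖ + ‖c‖ := by simpa using norm_add_le (v - c) c
    simp only [Metric.mem_ball, dist_zero_right]
    linarith
  have hbound : ∀ c ∈ Metric.closedBall (0 : E) M, ∀ v ∈ Metric.ball c M,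
      ‖q v‖ ≤ K * (2 * M) ^ (n + 1) := by
    intro c hc v hv
    refine (hK v (hsub c hc hv)).trans ?_
    have h1 : ‖c‖ ≤ M := by simpa using hc
    have h2 : ‖v - c‖ < M := by simpa [dist_eq_norm] using hv
    have h3 : ‖v‖ ≤ ‖v - c‖ + ‖c‖ := by simpa using norm_add_le (v - c) c
    gcongr
    linarith
  refine hconv.norm_image_sub_le_of_norm_fderiv_le (𝕜 := ℂ) (fun c hc => ?_) (fun c hc => ?_)
    (by simpa using hb) (by simpa using ha)
  · exact (hq.differentiableAt ((Metric.isOpen_ball).mem_nhds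
      (hsub c hc (Metric.mem_ball_self hM))))
  -- On the ball of radius `M` about `c` the oscillation of `q` is at most `2K(2M)^{n+1}`. Dividing
  -- by the radius gives `2^{n+2} K M^n`.
  · have h := Complex.norm_fderiv_le_div_of_mapsTo_ball (f := q) (c := c) (R₁ := M)
      (R₂ := 2 * (K * (2 * M) ^ (n + 1))) (hq.mono (hsub c hc)) (fun v hv => by
        rw [Metric.mem_closedBall, dist_eq_norm]
        refine (norm_sub_le _ _).trans ?_
        have h1 := hbound c hc v hv
        have h2 := hbound c hc c (Metric.mem_ball_self hM)
        linarith) hM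
    refine h.trans (le_of_eq ?_)
    field_simp
    ring

/-! ### Sine and cotangent in the strip `0 < Re z ≤ π/2` -/

theorem norm_sin_sq (z : ℂ) :
    ‖Complex.sin z‖ ^ 2 = Real.sin z.re ^ 2 + Real.sinh z.im ^ 2 := by
  rw [← Complex.normSq_eq_norm_sq, Complex.normSq_apply]
  have h := Complex.sin_eq z
  rw [← Complex.ofReal_sin, ← Complex.ofReal_cosh, ← Complex.ofReal_cos, ← Complex.ofReal_sinh] at h
  have hre : (Complex.sin z).re = Real.sin z.re * Real.cosh z.im := by
    rw [h]; simp [-Complex.ofReal_sin, -Complex.ofReal_cos,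
    -Complex.ofReal_sinh, -Complex.ofReal_cosh]
  have him : (Complex.sin z).im = Real.cos z.re * Real.sinh z.im := by
    rw [h]; simp [-Complex.ofReal_sin, -Complex.ofReal_cos,
    -Complex.ofReal_sinh, -Complex.ofReal_cosh]
  rw [hre, him]
  have h1 := Real.cosh_sq z.im
  have h2 := Real.sin_sq_add_cos_sq z.re
  linear_combination Real.sin z.re ^ 2 * h1 + Real.sinh z.im ^ 2 * h2

theorem sin_re_eq (z : ℂ) : (Complex.sin z).re = Real.sin z.re * Real.cosh z.im := by
  have h := Complex.sin_eq z
  rw [← Complex.ofReal_sin, ← Complex.ofReal_cosh, ← Complex.ofReal_cos, ← Complex.ofReal_sinh] at h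
  rw [h]; simp [-Complex.ofReal_sin, -Complex.ofReal_cos,
    -Complex.ofReal_sinh, -Complex.ofReal_cosh]

theorem sin_re_pos {z : ℂ} (h0 : 0 < z.re) (h1 : z.re ≤ Real.pi / 2) : 0 < (Complex.sin z).re := by
  rw [sin_re_eq]
  exact mul_pos (Real.sin_pos_of_pos_of_lt_pi h0 (by linarith [Real.pi_pos])) (Real.cosh_pos _)

theorem sin_mul_cosh_le_norm_sin (z : ℂ) :
    Real.sin z.re * Real.cosh z.im ≤ ‖Complex.sin z‖ := by
  rw [← sin_re_eq]
  exact Complex.re_le_norm _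

/-- Since `|sin z|² = sin² x + sinh² y`, Jordan's inequality for `sin x` and `|sinh y| ≥ |y|`
combine. -/
theorem two_div_pi_mul_norm_le_norm_sin {z : ℂ} (h0 : 0 < z.re) (h1 : z.re ≤ Real.pi / 2) :
    2 / Real.pi * ‖z‖ ≤ ‖Complex.sin z‖ := by
  have hpi := Real.pi_pos
  refine le_of_sq_le_sq ?_ (norm_nonneg _)
  rw [norm_sin_sq, mul_pow, ← Complex.normSq_eq_norm_sq, Complex.normSq_apply]
  have h2 : (2 / Real.pi * z.re) ^ 2 ≤ Real.sin z.re ^ 2 :=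
    pow_le_pow_left₀ (by positivity) (Real.mul_le_sin h0.le h1) 2
  have h3 : z.im ^ 2 ≤ Real.sinh z.im ^ 2 := by
    rw [← sq_abs z.im, ← sq_abs (Real.sinh z.im), Real.abs_sinh]
    exact pow_le_pow_left₀ (abs_nonneg _) (Real.self_le_sinh_iff.mpr (abs_nonneg _)) 2
  have h4 : (2 / Real.pi) ^ 2 ≤ 1 := by
    have : 2 / Real.pi ≤ 1 := by rw [div_le_one hpi]; linarith [Real.two_le_pi]
    exact pow_le_one₀ (by positivity) this
  nlinarith [mul_nonneg (sub_nonneg.mpr h4) (sq_nonneg z.im)]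

theorem norm_cos_le_one_add_norm_sin (z : ℂ) : ‖Complex.cos z‖ ≤ 1 + ‖Complex.sin z‖ := by
  refine le_of_sq_le_sq ?_ (by positivity)
  have h : Complex.cos z ^ 2 = 1 - Complex.sin z ^ 2 := by
    linear_combination Complex.sin_sq_add_cos_sq z
  rw [← norm_pow, h]
  refine (norm_sub_le _ _).trans ?_
  rw [norm_pow, norm_one]
  nlinarith [norm_nonneg (Complex.sin z)]

/-- Away from `0`, `|sin z|` is bounded below, which absorbs the `1` in `cosh² y = 1 + sinh² y`.
Thus negative powers of `sin z` decay exponentially up to the edge `Re z = 0`, uniformly. -/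
theorem cosh_im_le_mul_norm_sin {z : ℂ} (h0 : 0 < z.re) (h1 : z.re ≤ Real.pi / 2)
    (hz : 1 ≤ ‖z‖) : Real.cosh z.im ≤ (1 + Real.pi / 2) * ‖Complex.sin z‖ := by
  have hpi := Real.pi_pos
  have h := two_div_pi_mul_norm_le_norm_sin h0 h1
  have h2 : 2 / Real.pi ≤ ‖Complex.sin z‖ := le_trans (by
    have : 0 < 2 / Real.pi := by positivity
    nlinarith) h
  have h3 : 1 ≤ Real.pi / 2 * ‖Complex.sin z‖ := by
    calc (1 : ℝ) = Real.pi / 2 * (2 / Real.pi) := by field_simp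
      _ ≤ _ := by gcongr
  have h4 := norm_sin_sq z
  have h5 := Real.cosh_sq z.im
  refine le_of_sq_le_sq ?_ (by positivity)
  have h6 : Real.sinh z.im ^ 2 ≤ ‖Complex.sin z‖ ^ 2 := by nlinarith [sq_nonneg (Real.sin z.re)]
  have h7 : 1 ≤ (Real.pi / 2 * ‖Complex.sin z‖) ^ 2 := one_le_pow₀ h3
  nlinarith [mul_nonneg hpi.le (sq_nonneg ‖Complex.sin z‖)]

theorem norm_sin_sub_le {z : ℂ} (hz : ‖z‖ ≤ 1) : ‖Complex.sin z - z‖ ≤ ‖z‖ ^ 3 / 2 := by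
  have h := Complex.sin_bound hz
  have h1 : Complex.sin z - z = (Complex.sin z - (z - z ^ 3 / 6)) - z ^ 3 / 6 := by ring
  rw [h1]
  refine (norm_sub_le _ _).trans ?_
  have h2 : ‖z ^ 3 / 6‖ = ‖z‖ ^ 3 / 6 := by simp
  have h3 : ‖z‖ ^ 5 ≤ ‖z‖ ^ 3 := pow_le_pow_of_le_one (norm_nonneg _) hz (by norm_num)
  have h4 : 0 ≤ ‖z‖ ^ 3 := by positivity
  rw [h2]
  linarith

theorem norm_one_sub_cos_le {z : ℂ} (hz : ‖z‖ ≤ 1) : ‖Complex.cos z - 1‖ ≤ ‖z‖ ^ 2 := by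
  have h := Complex.cos_bound hz
  have h1 : Complex.cos z - 1 = (Complex.cos z - (1 - z ^ 2 / 2)) - z ^ 2 / 2 := by ring
  rw [h1]
  refine (norm_sub_le _ _).trans ?_
  have h2 : ‖z ^ 2 / 2‖ = ‖z‖ ^ 2 / 2 := by simp
  have h3 : ‖z‖ ^ 4 ≤ ‖z‖ ^ 2 := pow_le_pow_of_le_one (norm_nonneg _) hz (by norm_num)
  have h4 : 0 ≤ ‖z‖ ^ 2 := by positivity
  rw [h2]
  linarith

theorem norm_inv_sin_sub_inv_le {z : ℂ} (h0 : 0 < z.re) (h1 : z.re ≤ Real.pi / 2)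
    (hz : ‖z‖ ≤ 1) : ‖(Complex.sin z)⁻¹ - z⁻¹‖ ≤ ‖z‖ := by
  have hz0 : 0 < ‖z‖ := norm_pos_iff.mpr fun h => by simp [h] at h0
  have hs := two_div_pi_mul_norm_le_norm_sin h0 h1
  have hpi := Real.pi_pos
  have hs0 : 0 < ‖Complex.sin z‖ := lt_of_lt_of_le (by positivity) hs
  have e : (Complex.sin z)⁻¹ - z⁻¹ = -(Complex.sin z - z) / (Complex.sin z * z) := by
    have := norm_pos_iff.mp hz0
    have := norm_pos_iff.mp hs0
    field_simp
    ring
  have h12 : (1 : ℝ) / 2 ≤ 2 / Real.pi := by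
    rw [div_le_div_iff₀ two_pos hpi]; linarith [Real.pi_le_four]
  rw [e, norm_div, norm_neg, norm_mul, div_le_iff₀ (by positivity)]
  refine (norm_sin_sub_le hz).trans ?_
  have : 1 / 2 * ‖z‖ ≤ ‖Complex.sin z‖ := le_trans (by gcongr) hs
  nlinarith [mul_pos hz0 hz0]

theorem norm_cot_sub_inv_le {z : ℂ} (h0 : 0 < z.re) (h1 : z.re ≤ Real.pi / 2)
    (hz : ‖z‖ ≤ 1) : ‖Complex.cos z / Complex.sin z - z⁻¹‖ ≤ 3 * ‖z‖ := by
  have hz0 : 0 < ‖z‖ := norm_pos_iff.mpr fun h => by simp [h] at h0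
  have hs := two_div_pi_mul_norm_le_norm_sin h0 h1
  have hpi := Real.pi_pos
  have hs0 : 0 < ‖Complex.sin z‖ := lt_of_lt_of_le (by positivity) hs
  have e : Complex.cos z / Complex.sin z - z⁻¹
      = (Complex.cos z - 1) / Complex.sin z + ((Complex.sin z)⁻¹ - z⁻¹) := by
    have := norm_pos_iff.mp hz0
    have := norm_pos_iff.mp hs0
    field_simp
    ring
  have h12 : (1 : ℝ) / 2 ≤ 2 / Real.pi := by
    rw [div_le_div_iff₀ two_pos hpi]; linarith [Real.pi_le_four]
  have h3 : ‖(Complex.cos z - 1) / Complex.sin z‖ ≤ 2 * ‖z‖ := by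
    rw [norm_div, div_le_iff₀ hs0]
    refine (norm_one_sub_cos_le hz).trans ?_
    have : 1 / 2 * ‖z‖ ≤ ‖Complex.sin z‖ := le_trans (by gcongr) hs
    nlinarith
  rw [e]
  refine (norm_add_le _ _).trans ?_
  have := norm_inv_sin_sub_inv_le h0 h1 hz
  linarith

/-- A relative error of order `|z|` is all that is kept, although `sin z - z` is cubic: discarding
the last two coordinates of `stripPoint` costs a relative `|z|` in any case. -/
theorem norm_sin_cpow_sub_cpow_le {z κ : ℂ} (h0 : 0 < z.re) (h1 : z.re ≤ Real.pi / 2)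
    (hz : ‖z‖ ≤ 1) (hκ : 0 ≤ κ.re) :
    ‖Complex.sin z ^ (-κ) - z ^ (-κ)‖ ≤
      ‖κ‖ * Real.exp (Real.pi / 2 * |κ.im|) * 2 ^ (κ.re + 1) * ‖z‖ ^ (-κ.re) * ‖z‖ := by
  have hz0 : 0 < ‖z‖ := norm_pos_iff.mpr fun h => by simp [h] at h0
  have hs := norm_sin_sub_le hz
  have h3 : ‖z‖ ^ 3 ≤ ‖z‖ ^ 2 := pow_le_pow_of_le_one hz0.le hz (by norm_num)
  have h4 : ‖z‖ ^ 2 ≤ ‖z‖ := by simpa using pow_le_pow_of_le_one hz0.le hz (show 1 ≤ 2 by norm_num)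
  have h := norm_cpow_sub_cpow_le (a := -κ) (sin_re_pos h0 h1) h0 (by simp; linarith)
    (hs.trans (by linarith))
  refine h.trans ?_
  rw [norm_neg, Complex.neg_im, abs_neg, Complex.neg_re]
  have e : (‖z‖ / 2) ^ (-κ.re - 1) = 2 ^ (κ.re + 1) * ‖z‖ ^ (-κ.re) * ‖z‖⁻¹ := by
    rw [Real.div_rpow hz0.le two_pos.le, Real.rpow_sub hz0, Real.rpow_one,
      show -κ.re - 1 = -(κ.re + 1) by ring, Real.rpow_neg two_pos.le]
    field_simp
  rw [e]
  have : ‖Complex.sin z - z‖ ≤ ‖z‖ ^ 2 := by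
    have : 0 ≤ ‖z‖ ^ 3 := by positivity
    linarith
  calc _ ≤ ‖κ‖ * Real.exp (Real.pi / 2 * |κ.im|) *
        (2 ^ (κ.re + 1) * ‖z‖ ^ (-κ.re) * ‖z‖⁻¹) * ‖z‖ ^ 2 := by gcongr
    _ = _ := by field_simp

/-! ### The Borel transform as a contour integral -/

/-- The Borel transform as an inverse Laplace integral. -/
theorem integral_vertical_line_borelTransform {κ : ℂ} (hκ : 0 < κ.re) {φ : ℂ → ℂ} {r B : ℝ}
    (hr : 0 < r) (hφ : DifferentiableOn ℂ φ (Metric.ball 0 r))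
    (hB : ∀ z ∈ Metric.ball (0 : ℂ) r, ‖φ z‖ ≤ B) {C ζ : ℝ} (hC : r⁻¹ < C) (hζ : 0 < ζ) :
    ∫ t : ℝ, Complex.exp (ζ * (C - Complex.I * t)) * ((C : ℂ) - Complex.I * t) ^ (-(κ + 1))
      * φ ((C : ℂ) - Complex.I * t)⁻¹ = 2 * Real.pi * borelTransform κ φ ζ := by
  have hC0 : 0 < C := (inv_pos.mpr hr).trans hC
  have hCr : C⁻¹ < r := inv_lt_of_inv_lt₀ hr hC
  -- With `1/C < r' < r`, Cauchy's estimate on radius `r'` and `|C - it|⁻¹ ≤ 1/C` make the Taylor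
  -- terms decay like `(r'C)⁻ⁿ`, which justifies integrating term by term.
  obtain ⟨r', hr1, hr2⟩ := exists_between hCr
  have hr'0 : 0 < r' := (inv_pos.mpr hC0).trans hr1
  have hline : ∀ t : ℝ, C ≤ ‖(C : ℂ) - Complex.I * t‖ := fun t => by
    have := Complex.re_le_norm ((C : ℂ) - Complex.I * t)
    simpa using this
  have hne : ∀ t : ℝ, (C : ℂ) - Complex.I * t ≠ 0 := fun t =>
    norm_pos_iff.mp (hC0.trans_le (hline t))
  set c : ℕ → ℂ := fun n => iteratedDeriv n φ 0 / (n.factorial : ℂ) with hc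
  have hcb : ∀ n, ‖c n‖ ≤ B / r' ^ n := by
    intro n
    have h := Complex.norm_iteratedDeriv_le_of_forall_mem_sphere_norm_le (f := φ) (c := 0) n hr'0
      (DifferentiableOn.diffContOnCl (hφ.mono (by
        rw [closure_ball _ hr'0.ne']; exact Metric.closedBall_subset_ball hr2)))
      (C := B) (fun z hz => hB z (by
        have : ‖z‖ = r' := by simpa using hz
        simpa [this] using hr2))
    rw [hc]
    simp only [norm_div, Complex.norm_natCast]
    rw [div_le_iff₀ (by positivity)]
    refine h.trans (le_of_eq ?_)
    ring
  set E : ℝ → ℂ := fun t => Complex.exp (ζ * (C - Complex.I * t)) *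
    ((C : ℂ) - Complex.I * t) ^ (-(κ + 1)) with hE
  have hexp : ∀ t : ℝ, ‖Complex.exp (ζ * (C - Complex.I * t))‖ = Real.exp (ζ * C) := by
    intro t
    rw [Complex.norm_exp]
    simp
  have hint : ∀ a : ℂ, 1 < a.re → Integrable fun t : ℝ =>
      Complex.exp (ζ * (C - Complex.I * t)) * ((C : ℂ) - Complex.I * t) ^ (-a) := by
    intro a ha
    refine (integrable_vertical_line_cpow ha hC0).bdd_mul (c := Real.exp (ζ * C))
      (Continuous.aestronglyMeasurable (by fun_prop)) (Eventually.of_forall fun t => (hexp t).le)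
  have hEi : Integrable E := hint _ (by simp; linarith)
  set F : ℕ → ℝ → ℂ := fun n t => c n * (Complex.exp (ζ * (C - Complex.I * t)) *
    ((C : ℂ) - Complex.I * t) ^ (-((n : ℂ) + 1 + κ))) with hF
  have hFE : ∀ n t, F n t = E t * (c n * (((C : ℂ) - Complex.I * t)⁻¹) ^ n) := by
    intro n t
    simp only [hF, hE]
    rw [show -((n : ℂ) + 1 + κ) = -(κ + 1) - n by ring, Complex.cpow_sub _ _ (hne t),
      Complex.cpow_natCast, inv_pow]
    field_simp
  have hre : ∀ n : ℕ, 1 < ((n : ℂ) + 1 + κ).re := by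
    intro n
    have : (0 : ℝ) ≤ n := n.cast_nonneg
    simp
    linarith
  have hFi : ∀ n, Integrable (F n) := fun n => (hint _ (hre n)).const_mul _
  have hFn : ∀ n, ∫ t, ‖F n t‖ ≤ (∫ t, ‖E t‖) * B * ((r' * C)⁻¹) ^ n := by
    intro n
    rw [mul_assoc, ← integral_mul_const]
    refine integral_mono (hFi n).norm (hEi.norm.mul_const _) fun t => ?_
    simp only [hFE, norm_mul, norm_pow, norm_inv]
    refine mul_le_mul_of_nonneg_left ?_ (norm_nonneg _)
    have h2 : ‖(C : ℂ) - Complex.I * t‖⁻¹ ^ n ≤ C⁻¹ ^ n :=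
      pow_le_pow_left₀ (by positivity) (inv_anti₀ hC0 (hline t)) n
    calc _ ≤ B / r' ^ n * C⁻¹ ^ n :=
          mul_le_mul (hcb n) h2 (by positivity) ((norm_nonneg _).trans (hcb n))
      _ = _ := by rw [mul_inv, mul_pow, inv_pow r']; ring
  have hsum : Summable fun n => ∫ t, ‖F n t‖ := by
    refine Summable.of_nonneg_of_le (fun n => integral_nonneg fun t => norm_nonneg _) hFn ?_
    refine (summable_geometric_of_lt_one (by positivity) ?_).mul_left _
    refine inv_lt_one_of_one_lt₀ ?_
    have := mul_lt_mul_of_pos_right hr1 hC0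
    rwa [inv_mul_cancel₀ hC0.ne'] at this
  have h := hasSum_integral_of_summable_integral_norm hFi hsum
  have hpt : ∀ t, ∑' n, F n t = E t * φ ((C : ℂ) - Complex.I * t)⁻¹ := by
    intro t
    have hmem : ((C : ℂ) - Complex.I * t)⁻¹ ∈ Metric.ball (0 : ℂ) r := by
      rw [mem_ball_zero_iff, norm_inv]
      exact (inv_anti₀ hC0 (hline t)).trans_lt hCr
    have hT := Complex.hasSum_taylorSeries_on_ball hφ hmem
    simp only [hFE]
    rw [tsum_mul_left]
    congr 1
    rw [← hT.tsum_eq]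
    congr 1
    ext n
    simp only [hc, sub_zero, smul_eq_mul]
    ring
  simp only [hpt] at h
  rw [show (∫ t : ℝ, Complex.exp (ζ * (C - Complex.I * t)) *
    ((C : ℂ) - Complex.I * t) ^ (-(κ + 1)) * φ ((C : ℂ) - Complex.I * t)⁻¹)
    = ∫ t, E t * φ ((C : ℂ) - Complex.I * t)⁻¹ from rfl, ← h.tsum_eq, borelTransform,
    ← tsum_mul_left]
  congr 1
  ext n
  simp only [hF]
  rw [integral_const_mul, integral_vertical_line_cexp_mul_cpow (hre n) hC0 hζ,
    show (n : ℂ) + 1 + κ - 1 = n + κ by ring]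
  ring

/-! ### Fourier coefficients of superpositions of translates -/

theorem circleCoeff_eq_integral (l : ℤ) (G : ℝ → ℂ) :
    circleCoeff l G = ((2 * Real.pi : ℝ) : ℂ)⁻¹ *
      ∫ θ in (0 : ℝ)..2 * Real.pi, Complex.exp (-Complex.I * l * θ) * G θ := by
  rw [circleCoeff, fourierCoeffOn_eq_integral, sub_zero, one_div, ← Complex.ofReal_inv,
    Complex.real_smul]
  congr 1
  refine intervalIntegral.integral_congr fun θ _ => ?_
  simp only [smul_eq_mul]
  congr 1
  rw [fourier_coe_apply]
  congr 1
  have : (Real.pi : ℂ) ≠ 0 := by exact_mod_cast Real.pi_ne_zero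
  push_cast
  field_simp

theorem norm_cexp_neg_I_mul_int_mul (l : ℤ) (x : ℝ) :
    ‖Complex.exp (-Complex.I * l * x)‖ = 1 := by
  rw [Complex.norm_exp]
  simp

theorem circleCoeff_conj (l : ℤ) (G : ℝ → ℂ) :
    (starRingEnd ℂ) (circleCoeff l G) = circleCoeff (-l) (fun θ => (starRingEnd ℂ) (G θ)) := by
  rw [circleCoeff_eq_integral, circleCoeff_eq_integral, map_mul, map_inv₀, Complex.conj_ofReal]
  congr 1
  rw [intervalIntegral.integral_of_le Real.two_pi_pos.le,
    intervalIntegral.integral_of_le Real.two_pi_pos.le, ← integral_conj]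
  congr 1
  ext θ
  rw [map_mul, ← Complex.exp_conj]
  congr 2
  simp

theorem circleCoeff_add {l : ℤ} {F G : ℝ → ℂ} (hF : Continuous F) (hG : Continuous G) :
    circleCoeff l (fun θ => F θ + G θ) = circleCoeff l F + circleCoeff l G := by
  simp only [circleCoeff_eq_integral, mul_add]
  rw [intervalIntegral.integral_add (Continuous.intervalIntegrable (by fun_prop) _ _)
    (Continuous.intervalIntegrable (by fun_prop) _ _), mul_add]

theorem circleCoeff_const {l : ℤ} (hl : l ≠ 0) (c : ℂ) : circleCoeff l (fun _ => c) = 0 := by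
  rw [circleCoeff_eq_integral, intervalIntegral.integral_mul_const]
  have hc : -Complex.I * (l : ℂ) ≠ 0 := by simp [hl]
  have := integral_exp_mul_complex (a := 0) (b := 2 * Real.pi) hc
  rw [this]
  have e : Complex.exp (-Complex.I * l * ((2 * Real.pi : ℝ) : ℂ)) = 1 := by
    rw [Complex.exp_eq_one_iff]
    exact ⟨-l, by push_cast; ring⟩
  rw [e]
  simp

theorem norm_circleCoeff_le {l : ℤ} {G : ℝ → ℂ} {B : ℝ} (hB : ∀ θ, ‖G θ‖ ≤ B) :
    ‖circleCoeff l G‖ ≤ B := by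
  rw [circleCoeff_eq_integral, norm_mul, norm_inv, Complex.norm_real,
    Real.norm_of_nonneg Real.two_pi_pos.le]
  have h := intervalIntegral.norm_integral_le_of_norm_le_const (a := 0) (b := 2 * Real.pi)
    (f := fun θ : ℝ => Complex.exp (-Complex.I * l * θ) * G θ) (C := B) (fun θ _ => by
      rw [norm_mul, norm_cexp_neg_I_mul_int_mul, one_mul]; exact hB θ)
  rw [sub_zero, abs_of_pos Real.two_pi_pos] at h
  rw [inv_mul_le_iff₀ Real.two_pi_pos]
  linarith

theorem circleCoeff_comp_sub {l : ℤ} {G : ℝ → ℂ} (hG : Function.Periodic G (2 * Real.pi)) (a : ℝ) :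
    circleCoeff l (fun θ => G (θ - a)) = Complex.exp (-Complex.I * l * a) * circleCoeff l G := by
  rw [circleCoeff_eq_integral, circleCoeff_eq_integral, mul_left_comm]
  congr 1
  have hper : Function.Periodic (fun θ : ℝ => Complex.exp (-Complex.I * l * θ) * G θ)
      (2 * Real.pi) := by
    intro θ
    simp only
    rw [hG θ]
    congr 1
    rw [Complex.exp_eq_exp_iff_exists_int]
    exact ⟨-l, by push_cast; ring⟩
  have h1 := intervalIntegral.integral_comp_sub_right (a := 0) (b := 2 * Real.pi)
    (fun θ : ℝ => Complex.exp (-Complex.I * l * θ) * G θ) a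
  have h2 := hper.intervalIntegral_add_eq (0 - a) 0
  rw [zero_add, show 0 - a + 2 * Real.pi = 2 * Real.pi - a by ring] at h2
  rw [← h2, ← h1, ← intervalIntegral.integral_const_mul]
  refine intervalIntegral.integral_congr fun θ _ => ?_
  rw [← mul_assoc, ← Complex.exp_add]
  congr 2
  push_cast
  ring

/-- Fubini on `ℝ × (0, 2π]`: `K` is integrable in `w`, while `G` and the character are bounded. -/
theorem integral_mul_circleCoeff {l : ℤ} {G : ℝ → ℝ → ℂ} {K : ℝ → ℂ} {B : ℝ}
    (hG : Continuous (Function.uncurry G)) (hB : ∀ w θ, ‖G w θ‖ ≤ B) (hK : Integrable K) :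
    ∫ w, K w * circleCoeff l (G w) = circleCoeff l (fun θ => ∫ w, K w * G w θ) := by
  simp only [circleCoeff_eq_integral, intervalIntegral.integral_of_le Real.two_pi_pos.le]
  have hswap := integral_integral_swap (μ := volume)
    (ν := (volume : Measure ℝ).restrict (Set.Ioc 0 (2 * Real.pi)))
    (f := fun w θ : ℝ => K w * (Complex.exp (-Complex.I * l * θ) * G w θ)) (by
      have h1 : Integrable (fun z : ℝ × ℝ => K z.1 * (1 : ℂ))
          (volume.prod (volume.restrict (Set.Ioc 0 (2 * Real.pi)))) :=
        hK.mul_prod (integrable_const _)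
      have h2 := h1.bdd_mul (c := B)
        (f := fun z : ℝ × ℝ => Complex.exp (-Complex.I * l * z.2) * G z.1 z.2)
        (Continuous.aestronglyMeasurable (by
          have : Continuous fun z : ℝ × ℝ => G z.1 z.2 := hG
          fun_prop))
        (Eventually.of_forall fun z => by
          rw [norm_mul, norm_cexp_neg_I_mul_int_mul, one_mul]; exact hB _ _)
      refine h2.congr (Eventually.of_forall fun z => ?_)
      simp only [Function.uncurry]
      ring)
  have e1 : (fun w => K w * (((2 * Real.pi : ℝ) : ℂ)⁻¹ *
      ∫ θ in Set.Ioc 0 (2 * Real.pi), Complex.exp (-Complex.I * l * θ) * G w θ))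
      = fun w => ((2 * Real.pi : ℝ) : ℂ)⁻¹ *
        ∫ θ in Set.Ioc 0 (2 * Real.pi), K w * (Complex.exp (-Complex.I * l * θ) * G w θ) := by
    ext w
    rw [integral_const_mul]
    ring
  rw [e1, integral_const_mul, hswap]
  congr 2
  ext θ
  rw [← integral_const_mul]
  congr 1
  ext w
  ring

theorem continuous_integral_mul_comp_sub {G : ℝ → ℝ → ℂ} {K : ℝ → ℂ} {ψ : ℝ → ℝ} {B : ℝ}
    (hG : Continuous (Function.uncurry G)) (hB : ∀ w θ, ‖G w θ‖ ≤ B) (hK : Integrable K)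
    (hψ : Continuous ψ) : Continuous fun φ : ℝ => ∫ w, K w * G w (φ - ψ w) := by
  have hG' : Continuous fun z : ℝ × ℝ => G z.1 z.2 := hG
  refine continuous_of_dominated (bound := fun w => ‖K w‖ * B) (fun φ => ?_) (fun φ => ?_)
    (hK.norm.mul_const B) (Eventually.of_forall fun w => ?_)
  · refine hK.1.mul (Continuous.aestronglyMeasurable ?_)
    exact hG'.comp (f := fun w => (w, φ - ψ w)) (by fun_prop)
  · refine Eventually.of_forall fun w => ?_
    rw [norm_mul]
    exact mul_le_mul_of_nonneg_left (hB _ _) (norm_nonneg _)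
  · exact continuous_const.mul (hG'.comp (f := fun φ => (w, φ - ψ w)) (by fun_prop))

/-- The Fourier coefficients of a superposition of translates. -/
theorem circleCoeff_integral_mul_comp_sub {l : ℤ} {G : ℝ → ℝ → ℂ} {K : ℝ → ℂ} {ψ : ℝ → ℝ} {B : ℝ}
    (hG : Continuous (Function.uncurry G)) (hB : ∀ w θ, ‖G w θ‖ ≤ B) (hK : Integrable K)
    (hψ : Continuous ψ) (hper : ∀ w, Function.Periodic (G w) (2 * Real.pi)) :
    circleCoeff l (fun φ : ℝ => ∫ w, K w * G w (φ - ψ w)) =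
      ∫ w, K w * (Complex.exp (-Complex.I * l * ψ w) * circleCoeff l (G w)) := by
  have hG' : Continuous fun z : ℝ × ℝ => G z.1 z.2 := hG
  rw [← integral_mul_circleCoeff (G := fun w φ => G w (φ - ψ w)) (B := B)
    (hG'.comp (f := fun z : ℝ × ℝ => (z.1, z.2 - ψ z.1)) (by fun_prop)) (fun _ _ => hB _ _) hK]
  congr 1
  ext w
  rw [circleCoeff_comp_sub (hper w)]

theorem hasSum_circleCoeff_mul_cexp {N : ℝ → ℂ} (hN : Continuous N)
    (hper : Function.Periodic N (2 * Real.pi)) (hs : Summable fun l : ℤ => circleCoeff l N)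
    (φ : ℝ) :
    HasSum (fun l : ℤ => circleCoeff l N * Complex.exp (Complex.I * l * φ)) (N φ) := by
  have : Fact (0 < 2 * Real.pi) := ⟨Real.two_pi_pos⟩
  set f : C(AddCircle (2 * Real.pi), ℂ) := ⟨hper.lift, by
    exact continuous_coinduced_dom.mpr hN⟩ with hf
  have hcoe : ∀ l : ℤ, fourierCoeff f l = circleCoeff l N := by
    intro l
    rw [circleCoeff_eq_integral, fourierCoeff_eq_intervalIntegral _ _ 0, zero_add, one_div,
      ← Complex.ofReal_inv, Complex.real_smul]
    congr 1
    refine intervalIntegral.integral_congr fun θ _ => ?_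
    simp only [smul_eq_mul]
    rw [fourier_coe_apply]
    have : (Real.pi : ℂ) ≠ 0 := by exact_mod_cast Real.pi_ne_zero
    congr 2
    push_cast
    field_simp
  have hsum : Summable (fourierCoeff f) := hs.congr fun l => (hcoe l).symm
  have h := has_pointwise_sum_fourier_series_of_summable hsum (φ : AddCircle (2 * Real.pi))
  have hval : f (φ : AddCircle (2 * Real.pi)) = N φ := rfl
  rw [hval] at h
  convert h using 1
  ext l
  rw [hcoe, smul_eq_mul, fourier_coe_apply]
  have : (Real.pi : ℂ) ≠ 0 := by exact_mod_cast Real.pi_ne_zero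
  congr 2
  push_cast
  field_simp

/-! ### Decay of negative powers of `cosh` -/

theorem integrable_inv_one_add_sq_mul (K : ℝ) : Integrable fun t : ℝ => K * (1 + t ^ 2)⁻¹ :=
  integrable_inv_one_add_sq.const_mul K

theorem tendsto_inv_one_add_sq_mul_cocompact (K : ℝ) :
    Tendsto (fun t : ℝ => K * (1 + t ^ 2)⁻¹) (cocompact ℝ) (𝓝 0) := by
  have h1 : Tendsto (fun t : ℝ => 1 + t ^ 2) (cocompact ℝ) atTop := by
    refine tendsto_atTop_mono (fun t => ?_) (tendsto_norm_cocompact_atTop (E := ℝ))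
    rw [Real.norm_eq_abs]
    nlinarith [sq_abs t, sq_nonneg (|t| - 1)]
  simpa using (tendsto_inv_atTop_zero.comp h1).const_mul K

/-- The form `2 + |y|` is chosen because it dominates `‖z‖` for `z` in the strip with imaginary part
`y`, as `π/2 ≤ 2`. -/
theorem exists_cosh_rpow_neg_le {e m : ℝ} (he : 0 < e) (hm : 0 < m) :
    ∃ K > (0 : ℝ), ∀ y : ℝ, Real.cosh y ^ (-e) ≤ K * (2 + |y|) ^ (-m) := by
  -- `ε ≤ 1` gives `2 + |y| ≤ (2/ε) e^{ε|y|}`, and `εm ≤ e` lets its `m`-th power be absorbed by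
  -- `e^{e|y|}`.
  set ε := min 1 (e / m) with hε
  have hε0 : 0 < ε := lt_min one_pos (by positivity)
  have hε1 : ε ≤ 1 := min_le_left _ _
  have hεm : ε * m ≤ e := by
    have := min_le_right 1 (e / m)
    rwa [← hε, le_div_iff₀ hm] at this
  refine ⟨(2 / ε) ^ m * 2 ^ e, by positivity, fun y => ?_⟩
  have hc := Real.cosh_pos y
  have h1 : 2 + |y| ≤ 2 / ε * Real.exp (ε * |y|) := by
    have := Real.add_one_le_exp (ε * |y|)
    rw [div_mul_eq_mul_div, le_div_iff₀ hε0]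
    nlinarith [abs_nonneg y]
  have h2 : (2 + |y|) ^ m ≤ (2 / ε) ^ m * Real.exp (e * |y|) := by
    calc (2 + |y|) ^ m ≤ (2 / ε * Real.exp (ε * |y|)) ^ m := by gcongr
      _ = (2 / ε) ^ m * Real.exp (ε * m * |y|) := by
        rw [Real.mul_rpow (by positivity) (Real.exp_nonneg _), ← Real.exp_mul]
        congr 2; ring
      _ ≤ _ := by gcongr
  have h3 : Real.exp (e * |y|) ≤ 2 ^ e * Real.cosh y ^ e := by
    rw [← Real.mul_rpow two_pos.le hc.le, mul_comm e, Real.exp_mul]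
    gcongr
    rw [← Real.cosh_abs, Real.cosh_eq]
    linarith [Real.exp_pos (-|y|)]
  have hy : 0 < 2 + |y| := by positivity
  rw [Real.rpow_neg hc.le, Real.rpow_neg hy.le, ← div_eq_mul_inv, le_div_iff₀ (by positivity),
    inv_mul_le_iff₀ (by positivity)]
  calc _ ≤ (2 / ε) ^ m * (2 ^ e * Real.cosh y ^ e) := h2.trans (by gcongr)
    _ = _ := by ring

theorem exists_cosh_rpow_neg_le_inv_one_add_sq {e : ℝ} (he : 0 < e) :
    ∃ K > (0 : ℝ), ∀ y : ℝ, Real.cosh y ^ (-e) ≤ K * (1 + y ^ 2)⁻¹ := by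
  obtain ⟨K, hK, h⟩ := exists_cosh_rpow_neg_le he (m := 2) two_pos
  refine ⟨K, hK, fun y => (h y).trans ?_⟩
  have hy : 0 < 2 + |y| := by positivity
  rw [Real.rpow_neg hy.le, Real.rpow_two]
  gcongr
  nlinarith [sq_abs y, abs_nonneg y]

theorem integrable_cosh_rpow_neg {e : ℝ} (he : 0 < e) :
    Integrable fun y : ℝ => Real.cosh y ^ (-e) := by
  obtain ⟨K, _, h⟩ := exists_cosh_rpow_neg_le_inv_one_add_sq he
  refine (integrable_inv_one_add_sq_mul K).mono' (Continuous.aestronglyMeasurable ?_)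
    (Eventually.of_forall fun y => ?_)
  · exact Real.continuous_cosh.rpow_const fun y => Or.inl (Real.cosh_pos y).ne'
  · rw [Real.norm_of_nonneg (Real.rpow_nonneg (Real.cosh_pos y).le _)]
    exact h y

/-! ### Kernels in the strip and the contour shift -/

/-- A family `q θ` of functions, analytic on a fixed ball, `2π`-periodic and continuous in `θ`,
vanishing to fourth order at the origin, real at the points `(x, iy, u, v)`; and `φ θ` is the
analytic function with `w * φ θ w = q θ (w, w, 0, 0)`. -/
structure IsKernelFamily (q : ℝ → ℂ × ℂ × ℂ × ℂ → ℂ) (φ : ℝ → ℂ → ℂ) (r K : ℝ) : Prop where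
  r_pos : 0 < r
  K_nonneg : 0 ≤ K
  diff : ∀ θ, DifferentiableOn ℂ (q θ) (Metric.ball 0 r)
  bound : ∀ θ, ∀ v ∈ Metric.ball (0 : ℂ × ℂ × ℂ × ℂ) r, ‖q θ v‖ ≤ K * ‖v‖ ^ 4
  cont : ContinuousOn (Function.uncurry q) (Set.univ ×ˢ Metric.ball 0 r)
  periodic : ∀ v, Function.Periodic (fun θ => q θ v) (2 * Real.pi)
  real : ∀ (θ x y u v : ℝ),
    ((x : ℂ), Complex.I * (y : ℂ), (u : ℂ), (v : ℂ)) ∈ Metric.ball (0 : ℂ × ℂ × ℂ × ℂ) r →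
    (q θ ((x : ℂ), Complex.I * (y : ℂ), (u : ℂ), (v : ℂ))).im = 0
  phi_diff : ∀ θ, DifferentiableOn ℂ (φ θ) (Metric.ball 0 r)
  phi_bound : ∀ θ, ∀ w ∈ Metric.ball (0 : ℂ) r, ‖φ θ w‖ ≤ K
  phi_eq : ∀ θ w, w * φ θ w = q θ (w, w, 0, 0)

/-- The inner coordinates `(δ / sin z, δ cot z, δ, τ)`. -/
noncomputable def stripPoint (δ τ : ℝ) (z : ℂ) : ℂ × ℂ × ℂ × ℂ :=
  (δ * (Complex.sin z)⁻¹, δ * (Complex.cos z / Complex.sin z), δ, τ)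

/-- The exponent `2/d + i l c/d`. -/
noncomputable def harmonicExponent (d c : ℝ) (l : ℤ) : ℂ := ((2 / d : ℝ) : ℂ) + Complex.I * (l * c / d : ℝ)

/-- The integrand of the `l`-th Fourier coefficient in the variable `z = π / 2 - i d w`. -/
noncomputable def stripKernel (q : ℝ → ℂ × ℂ × ℂ × ℂ → ℂ) (d c a δ τ : ℝ) (l : ℤ) (θ : ℝ) (z : ℂ) : ℂ :=
  Complex.exp ((l * (a / (d * δ)) : ℝ) * z) * Complex.sin z ^ (-harmonicExponent d c l)
    * ((δ : ℂ)⁻¹ * q θ (stripPoint δ τ z))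

theorem harmonicExponent_re (d c : ℝ) (l : ℤ) : (harmonicExponent d c l).re = 2 / d := by
  rw [harmonicExponent, Complex.add_re, Complex.ofReal_re, Complex.re_mul_ofReal]
  simp

theorem harmonicExponent_im (d c : ℝ) (l : ℤ) : (harmonicExponent d c l).im = l * c / d := by
  rw [harmonicExponent, Complex.add_im, Complex.ofReal_im, Complex.im_mul_ofReal]
  simp

theorem norm_quadruple_le {a b c d : ℂ} {M : ℝ} (ha : ‖a‖ ≤ M) (hb : ‖b‖ ≤ M) (hc : ‖c‖ ≤ M)
    (hd : ‖d‖ ≤ M) : ‖(a, b, c, d)‖ ≤ M := by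
  simp only [Prod.norm_def]
  exact max_le ha (max_le hb (max_le hc hd))

theorem norm_stripPoint_le {δ τ : ℝ} (hδ : 0 < δ) (hτ : |τ| ≤ δ) {z : ℂ}
    (hz : Complex.sin z ≠ 0) : ‖stripPoint δ τ z‖ ≤ δ * (1 + ‖Complex.sin z‖⁻¹) := by
  have hs : 0 < ‖Complex.sin z‖ := norm_pos_iff.mpr hz
  have h1 : δ ≤ δ * (1 + ‖Complex.sin z‖⁻¹) := by
    have : 0 < ‖Complex.sin z‖⁻¹ := inv_pos.mpr hs
    nlinarith
  refine norm_quadruple_le ?_ ?_ ?_ ?_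
  · rw [norm_mul, norm_inv, Complex.norm_real, Real.norm_of_nonneg hδ.le]
    gcongr
    linarith
  · rw [norm_mul, norm_div, Complex.norm_real, Real.norm_of_nonneg hδ.le]
    gcongr
    rw [div_le_iff₀ hs, add_mul, inv_mul_cancel₀ hs.ne', one_mul, add_comm]
    exact norm_cos_le_one_add_norm_sin z
  · rw [Complex.norm_real, Real.norm_of_nonneg hδ.le]
    exact h1
  · rw [Complex.norm_real, Real.norm_eq_abs]
    exact hτ.trans h1

theorem differentiableAt_stripKernel {q : ℝ → ℂ × ℂ × ℂ × ℂ → ℂ} {φ : ℝ → ℂ → ℂ} {r K : ℝ}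
    (hq : IsKernelFamily q φ r K) (d c a : ℝ) {δ τ : ℝ} (l : ℤ) (θ : ℝ)
    {z : ℂ} (h0 : 0 < z.re) (h1 : z.re ≤ Real.pi / 2) (hz : ‖stripPoint δ τ z‖ < r) :
    DifferentiableAt ℂ (stripKernel q d c a δ τ l θ) z := by
  have hs := sin_re_pos h0 h1
  have hs0 : Complex.sin z ≠ 0 := fun h => by simp [h] at hs
  have hsd : DifferentiableAt ℂ Complex.sin z := Complex.differentiableAt_sin
  have hcd : DifferentiableAt ℂ Complex.cos z := Complex.differentiableAt_cos
  refine DifferentiableAt.mul (DifferentiableAt.mul (by fun_prop) ?_) (DifferentiableAt.const_mul ?_ _)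
  · exact hsd.cpow_const (Or.inl hs)
  · have hqd : DifferentiableAt ℂ (q θ) (stripPoint δ τ z) :=
      (hq.diff θ).differentiableAt (Metric.isOpen_ball.mem_nhds (by simpa using hz))
    refine DifferentiableAt.comp (g := q θ) z hqd ?_
    unfold stripPoint
    exact ((hsd.inv hs0).const_mul _).prodMk (((hcd.div hsd hs0).const_mul _).prodMk
      ((differentiableAt_const _).prodMk (differentiableAt_const _)))

/-- To the right of `x₀` one has `|sin z| ≥ sin x₀ · cosh (Im z)`. This keeps `stripPoint` inside
the ball and supplies the decay in `Im z`; the factor `q` is only bounded. The dependence on `l`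
stays explicit for use with the high harmonics. -/
theorem norm_stripKernel_le {q : ℝ → ℂ × ℂ × ℂ × ℂ → ℂ} {φ : ℝ → ℂ → ℂ} {r K : ℝ}
    (hq : IsKernelFamily q φ r K) {d : ℝ} (hd : 0 < d) (c a : ℝ) {δ τ : ℝ} (hδ : 0 < δ)
    (hτ : |τ| ≤ δ) (l : ℤ) (θ : ℝ) {x₀ : ℝ} (hx₀ : 0 < x₀)
    (hr : δ * (1 + (Real.sin x₀)⁻¹) < r) {z : ℂ} (h0 : x₀ ≤ z.re) (h1 : z.re ≤ Real.pi / 2) :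
    ‖stripPoint δ τ z‖ < r ∧ ‖stripKernel q d c a δ τ l θ z‖ ≤
      Real.exp (l * (a / (d * δ)) * z.re) * (Real.sin x₀ ^ (-(2 / d)) *
        Real.exp (Real.pi / 2 * |l * c / d|) * (δ⁻¹ * (K * (δ * (1 + (Real.sin x₀)⁻¹)) ^ 4)))
        * Real.cosh z.im ^ (-(2 / d)) := by
  have hpi := Real.pi_pos
  have hz0 : 0 < z.re := hx₀.trans_le h0
  have hs := sin_re_pos hz0 h1
  have hs0 : Complex.sin z ≠ 0 := fun h => by simp [h] at hs
  have hsx : 0 < Real.sin x₀ := Real.sin_pos_of_pos_of_lt_pi hx₀ (by linarith)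
  have hmono : Real.sin x₀ ≤ Real.sin z.re :=
    Real.sin_le_sin_of_le_of_le_pi_div_two (by linarith) h1 h0
  have hlow : Real.sin x₀ * Real.cosh z.im ≤ ‖Complex.sin z‖ :=
    (mul_le_mul_of_nonneg_right hmono (Real.cosh_pos _).le).trans (sin_mul_cosh_le_norm_sin z)
  have hlow' : Real.sin x₀ ≤ ‖Complex.sin z‖ :=
    le_trans (by nlinarith [Real.one_le_cosh z.im]) hlow
  have hpt : ‖stripPoint δ τ z‖ ≤ δ * (1 + (Real.sin x₀)⁻¹) := by
    refine (norm_stripPoint_le hδ hτ hs0).trans ?_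
    gcongr
  have hpr := hpt.trans_lt hr
  refine ⟨hpr, ?_⟩
  have e1 : ‖Complex.exp ((l * (a / (d * δ)) : ℝ) * z)‖ = Real.exp (l * (a / (d * δ)) * z.re) := by
    rw [Complex.norm_exp, Complex.re_ofReal_mul]
  have e2 : ‖Complex.sin z ^ (-harmonicExponent d c l)‖ ≤ (Real.sin x₀ ^ (-(2 / d)) *
      Real.cosh z.im ^ (-(2 / d))) * Real.exp (Real.pi / 2 * |l * c / d|) := by
    refine (norm_cpow_le_rpow_mul_exp hs).trans ?_
    rw [Complex.neg_re, Complex.neg_im, abs_neg, harmonicExponent_re, harmonicExponent_im,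
      ← Real.mul_rpow hsx.le (Real.cosh_pos _).le]
    refine mul_le_mul_of_nonneg_right ?_ (Real.exp_nonneg _)
    exact Real.rpow_le_rpow_of_nonpos (mul_pos hsx (Real.cosh_pos _)) hlow
      (by have : 0 < 2 / d := by positivity
          linarith)
  have e3 : ‖(δ : ℂ)⁻¹ * q θ (stripPoint δ τ z)‖
      ≤ δ⁻¹ * (K * (δ * (1 + (Real.sin x₀)⁻¹)) ^ 4) := by
    rw [norm_mul, norm_inv, Complex.norm_real, Real.norm_of_nonneg hδ.le]
    gcongr
    refine (hq.bound θ _ (by simpa using hpr)).trans ?_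
    have := hq.K_nonneg
    gcongr
  have hK := hq.K_nonneg
  rw [stripKernel, norm_mul, norm_mul, e1]
  have hcosh := Real.cosh_pos z.im
  calc _ ≤ Real.exp (l * (a / (d * δ)) * z.re) * ((Real.sin x₀ ^ (-(2 / d)) *
      Real.cosh z.im ^ (-(2 / d))) * Real.exp (Real.pi / 2 * |l * c / d|)) *
      (δ⁻¹ * (K * (δ * (1 + (Real.sin x₀)⁻¹)) ^ 4)) := by gcongr
    _ = _ := by ring

/-- Shifting the contour of the `l`-th Fourier coefficient from `Re z = π / 2` to `Re z = x₀`. -/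
theorem stripKernel_shift {q : ℝ → ℂ × ℂ × ℂ × ℂ → ℂ} {φ : ℝ → ℂ → ℂ} {r K : ℝ}
    (hq : IsKernelFamily q φ r K) {d : ℝ} (hd : 0 < d) (c : ℝ) {a δ τ : ℝ} (ha : 0 ≤ a)
    (hδ : 0 < δ) (hτ : |τ| ≤ δ) {l : ℤ} (hl : 0 ≤ l) (θ : ℝ) {x₀ : ℝ} (hx₀ : 0 < x₀)
    (hx1 : x₀ ≤ Real.pi / 2) (hr : δ * (1 + (Real.sin x₀)⁻¹) < r) :
    (Integrable fun t : ℝ => stripKernel q d c a δ τ l θ (x₀ - Complex.I * t)) ∧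
    (∫ t : ℝ, stripKernel q d c a δ τ l θ ((Real.pi / 2 : ℝ) - Complex.I * t)) =
      ∫ t : ℝ, stripKernel q d c a δ τ l θ (x₀ - Complex.I * t) := by
  have hd2 : 0 < 2 / d := by positivity
  have hl' : (0 : ℝ) ≤ l := by exact_mod_cast hl
  obtain ⟨K', hK', hcosh⟩ := exists_cosh_rpow_neg_le_inv_one_add_sq hd2
  have hsx : 0 < Real.sin x₀ :=
    Real.sin_pos_of_pos_of_lt_pi hx₀ (by linarith [Real.pi_pos])
  set B : ℝ := Real.sin x₀ ^ (-(2 / d)) * Real.exp (Real.pi / 2 * |l * c / d|) *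
    (δ⁻¹ * (K * (δ * (1 + (Real.sin x₀)⁻¹)) ^ 4)) with hB
  have hB0 : 0 ≤ B := by
    have := hq.K_nonneg
    positivity
  have hdiff : ∀ z : ℂ, x₀ ≤ z.re → z.re ≤ Real.pi / 2 →
      DifferentiableAt ℂ (stripKernel q d c a δ τ l θ) z := fun z h0 h1 =>
    differentiableAt_stripKernel hq d c a l θ (hx₀.trans_le h0) h1
      (norm_stripKernel_le hq hd c a hδ hτ l θ hx₀ hr h0 h1).1
  have hbd : ∀ x t : ℝ, x₀ ≤ x → x ≤ Real.pi / 2 →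
      ‖stripKernel q d c a δ τ l θ (x - Complex.I * t)‖ ≤
        (Real.exp (l * (a / (d * δ)) * (Real.pi / 2)) * B * K') * (1 + t ^ 2)⁻¹ := by
    intro x t h0 h1
    have h := (norm_stripKernel_le hq hd c a hδ hτ l θ hx₀ hr
      (z := (x : ℂ) - Complex.I * t) (by simpa using h0) (by simpa using h1)).2
    refine h.trans ?_
    have hre : ((x : ℂ) - Complex.I * t).re = x := by simp
    have him : ((x : ℂ) - Complex.I * t).im = -t := by simp
    rw [hre, him, Real.cosh_neg, mul_assoc _ K']
    gcongr
    exact hcosh t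
  refine ⟨?_, ?_⟩
  · refine (integrable_inv_one_add_sq_mul
      (Real.exp (l * (a / (d * δ)) * (Real.pi / 2)) * B * K')).mono'
      (Continuous.aestronglyMeasurable ?_) (Eventually.of_forall fun t => hbd x₀ t le_rfl hx1)
    rw [continuous_iff_continuousAt]
    intro t
    exact ContinuousAt.comp (f := fun t : ℝ => (x₀ : ℂ) - Complex.I * t)
      (hdiff _ (by simp) (by simpa using hx1)).continuousAt (by fun_prop)
  · exact (integral_vertical_line_eq hx1 hdiff (integrable_inv_one_add_sq_mul _)
      (tendsto_inv_one_add_sq_mul_cocompact _) hbd).symm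

theorem norm_integral_stripKernel_le {q : ℝ → ℂ × ℂ × ℂ × ℂ → ℂ} {φ : ℝ → ℂ → ℂ} {r K : ℝ}
    (hq : IsKernelFamily q φ r K) {d : ℝ} (hd : 0 < d) (c : ℝ) {a δ τ : ℝ} (ha : 0 ≤ a)
    (hδ : 0 < δ) (hτ : |τ| ≤ δ) {l : ℤ} (hl : 0 ≤ l) (θ : ℝ) {x₀ : ℝ} (hx₀ : 0 < x₀)
    (hx1 : x₀ ≤ Real.pi / 2) (hr : δ * (1 + (Real.sin x₀)⁻¹) < r) :
    ‖∫ t : ℝ, stripKernel q d c a δ τ l θ ((Real.pi / 2 : ℝ) - Complex.I * t)‖ ≤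
      Real.exp (l * (a / (d * δ)) * x₀) * (Real.sin x₀ ^ (-(2 / d)) *
        Real.exp (Real.pi / 2 * |l * c / d|) * (δ⁻¹ * (K * (δ * (1 + (Real.sin x₀)⁻¹)) ^ 4)))
        * ∫ t : ℝ, Real.cosh t ^ (-(2 / d)) := by
  rw [(stripKernel_shift hq hd c ha hδ hτ hl θ hx₀ hx1 hr).2, ← integral_const_mul]
  refine norm_integral_le_of_norm_le ((integrable_cosh_rpow_neg (by positivity)).const_mul _)
    (Eventually.of_forall fun t => ?_)
  have h := (norm_stripKernel_le hq hd c a hδ hτ l θ hx₀ hr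
    (z := (x₀ : ℂ) - Complex.I * t) (by simp) (by simpa using hx1)).2
  have hre : ((x₀ : ℂ) - Complex.I * t).re = x₀ := by simp
  have him : ((x₀ : ℂ) - Complex.I * t).im = -t := by simp
  rwa [hre, him, Real.cosh_neg] at h

/-! ### The inner approximation near the singularity `z = 0` -/

theorem ofReal_mul_cpow {δ : ℝ} (hδ : 0 < δ) {z : ℂ} (hz : z ≠ 0) (k : ℂ) :
    ((δ : ℂ) * z) ^ k = (δ : ℂ) ^ k * z ^ k := by
  have hδ' : (δ : ℂ) ≠ 0 := by simpa using hδ.ne'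
  rw [Complex.cpow_def_of_ne_zero (mul_ne_zero hδ' hz), Complex.cpow_def_of_ne_zero hδ',
    Complex.cpow_def_of_ne_zero hz, ← Complex.exp_add, Complex.log_ofReal_mul hδ hz,
    ← Complex.ofReal_log hδ.le, add_mul]

/-- The leading part of `stripKernel` with `l = 1` near the singularity `z = 0`. -/
noncomputable def innerKernel (q : ℝ → ℂ × ℂ × ℂ × ℂ → ℂ) (d c a δ : ℝ) (θ : ℝ) (z : ℂ) : ℂ :=
  Complex.exp ((a / (d * δ) : ℝ) * z) * z ^ (-harmonicExponent d c 1)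
    * ((δ : ℂ)⁻¹ * q θ (δ * z⁻¹, δ * z⁻¹, 0, 0))

-- For `|z| ≤ 1` both factors have relative error `O(|z|)` against a main term of size `δ⁴
-- |z|^{-4-2/d}`. For `|z| > 1` nothing is compared: each term is small separately, the first by the
-- exponential decay of the power of `sin z`, the second by its own size. The resulting power `-(3 +
-- 2/d)` is integrable along vertical lines.
set_option maxHeartbeats 1000000 in
theorem exists_norm_sin_cpow_sub_le (K : ℝ) (hK : 0 ≤ K) {d : ℝ} (hd : 0 < d) (c : ℝ) :
    ∃ K₁ > (0 : ℝ), ∀ (q : ℝ → ℂ × ℂ × ℂ × ℂ → ℂ) (φ : ℝ → ℂ → ℂ) (r : ℝ),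
      IsKernelFamily q φ r K → ∀ (δ τ : ℝ) (θ : ℝ) (z : ℂ), 0 < δ → |τ| ≤ δ → 4 * δ < r →
      8 / r * δ ≤ z.re → z.re ≤ Real.pi / 2 →
      ‖Complex.sin z ^ (-harmonicExponent d c 1) * q θ (stripPoint δ τ z)
        - z ^ (-harmonicExponent d c 1) * q θ (δ * z⁻¹, δ * z⁻¹, 0, 0)‖ ≤
        K₁ * δ ^ 4 * ‖z‖ ^ (-(3 + 2 / d)) := by
  have hd2 : 0 < 2 / d := by positivity
  obtain ⟨K', hK', hcosh⟩ := exists_cosh_rpow_neg_le hd2 (m := 3 + 2 / d) (by positivity)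
  set κ := harmonicExponent d c 1 with hκ
  have hκre : κ.re = 2 / d := harmonicExponent_re d c 1
  set X := Real.exp (Real.pi / 2 * |κ.im|) with hX
  have hX0 : 0 < X := Real.exp_pos _
  set K₂ := ‖κ‖ * X * 2 ^ (κ.re + 1) with hK₂
  have hpi := Real.pi_pos
  -- The first two summands belong to `|z| ≤ 1`: the change of the power and the change of `q`, with
  -- `81 = 3⁴` and `8 * 4 * 81 = 2⁵ · 3³ · 3`. The next two belong to `|z| > 1`, one for each term.
  -- The final `1` ensures positivity.
  refine ⟨K₂ * (K * 81) + X * (8 * 4 * K * 81) + X * (1 + Real.pi / 2) ^ (2 / d) * K' * (K * 81)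
    + X * K + 1, by positivity, ?_⟩
  intro q φ r hq δ τ θ z hδ hτ h4 h0 h1
  have hr := hq.r_pos
  have hz0 : 0 < z.re := lt_of_lt_of_le (by positivity) h0
  have hs := sin_re_pos hz0 h1
  have hzn : 0 < ‖z‖ := hz0.trans_le (Complex.re_le_norm z)
  have hzne : z ≠ 0 := norm_pos_iff.mp hzn
  have hs0 : Complex.sin z ≠ 0 := fun h => by simp [h] at hs
  have hsl := two_div_pi_mul_norm_le_norm_sin hz0 h1
  have hsn : 0 < ‖Complex.sin z‖ := norm_pos_iff.mpr hs0
  have hb4 : ‖((δ : ℂ) * z⁻¹, (δ : ℂ) * z⁻¹, (0 : ℂ), (0 : ℂ))‖ ≤ δ * ‖z‖⁻¹ := by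
    have : ‖(δ : ℂ) * z⁻¹‖ ≤ δ * ‖z‖⁻¹ := by
      rw [norm_mul, norm_inv, Complex.norm_real, Real.norm_of_nonneg hδ.le]
    exact norm_quadruple_le this this (by rw [norm_zero]; positivity)
      (by rw [norm_zero]; positivity)
  have hinv : ‖Complex.sin z‖⁻¹ ≤ 2 * ‖z‖⁻¹ := by
    rw [← one_div, ← div_eq_mul_inv, div_le_div_iff₀ hsn hzn]
    have h12 : (1 : ℝ) / 2 ≤ 2 / Real.pi := by
      rw [div_le_div_iff₀ two_pos hpi]; linarith [Real.pi_le_four]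
    nlinarith
  have hpt : ‖stripPoint δ τ z‖ ≤ δ * (1 + 2 * ‖z‖⁻¹) := by
    refine (norm_stripPoint_le hδ hτ hs0).trans ?_
    gcongr
  have hδz : δ * ‖z‖⁻¹ ≤ r / 8 := by
    rw [← div_eq_mul_inv, div_le_div_iff₀ hzn (by norm_num)]
    have : 8 / r * δ ≤ ‖z‖ := h0.trans (Complex.re_le_norm z)
    rw [div_mul_eq_mul_div, div_le_iff₀ hr] at this
    linarith
  have hcz : ‖z ^ (-κ)‖ ≤ ‖z‖ ^ (-(2 / d)) * X := by
    have := norm_cpow_le_rpow_mul_exp (a := -κ) hz0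
    rwa [Complex.neg_re, Complex.neg_im, abs_neg, hκre] at this
  have hpow : ∀ n : ℕ, ‖z‖ ^ (-((n : ℝ) + 2 / d)) = (‖z‖⁻¹) ^ n * ‖z‖ ^ (-(2 / d)) := by
    intro n
    rw [neg_add, Real.rpow_add hzn, Real.rpow_neg hzn.le, Real.rpow_natCast, inv_pow]
  have hpow3 := hpow 3
  push_cast at hpow3
  have hN0 : 0 ≤ ‖z‖ ^ (-(3 + 2 / d)) := by positivity
  rcases le_or_gt ‖z‖ 1 with hz1 | hz1
  -- `M` bounds both arguments of `q`. Since `δ/‖z‖ ≤ r/8`, also `2M ≤ r`, as the Lipschitz estimate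
  -- requires.
  · set M := 3 * (δ * ‖z‖⁻¹) with hM
    have hzi : 1 ≤ ‖z‖⁻¹ := (one_le_inv₀ hzn).mpr hz1
    have hM0 : 0 < M := by positivity
    have haM : ‖stripPoint δ τ z‖ ≤ M := hpt.trans (by rw [hM]; nlinarith)
    have hbM : ‖((δ : ℂ) * z⁻¹, (δ : ℂ) * z⁻¹, (0 : ℂ), (0 : ℂ))‖ ≤ M := hb4.trans (by
      rw [hM]; nlinarith [mul_pos hδ (inv_pos.mpr hzn)])
    have hdiff : ‖stripPoint δ τ z - ((δ : ℂ) * z⁻¹, (δ : ℂ) * z⁻¹, (0 : ℂ), (0 : ℂ))‖ ≤ 3 * δ := by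
      have h3 : δ ≤ 3 * δ := by linarith
      refine norm_quadruple_le ?_ ?_ ?_ ?_
      · show ‖(δ : ℂ) * (Complex.sin z)⁻¹ - δ * z⁻¹‖ ≤ 3 * δ
        rw [← mul_sub, norm_mul, Complex.norm_real, Real.norm_of_nonneg hδ.le]
        have := norm_inv_sin_sub_inv_le hz0 h1 hz1
        nlinarith
      · show ‖(δ : ℂ) * (Complex.cos z / Complex.sin z) - δ * z⁻¹‖ ≤ 3 * δ
        rw [← mul_sub, norm_mul, Complex.norm_real, Real.norm_of_nonneg hδ.le]
        have := norm_cot_sub_inv_le hz0 h1 hz1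
        nlinarith
      · show ‖(δ : ℂ) - 0‖ ≤ 3 * δ
        rw [sub_zero, Complex.norm_real, Real.norm_of_nonneg hδ.le]
        exact h3
      · show ‖(τ : ℂ) - 0‖ ≤ 3 * δ
        rw [sub_zero, Complex.norm_real, Real.norm_eq_abs]
        exact hτ.trans h3
    have hqa : ‖q θ (stripPoint δ τ z)‖ ≤ K * M ^ 4 := by
      refine (hq.bound θ _ ?_).trans (by gcongr)
      rw [mem_ball_zero_iff]
      refine haM.trans_lt ?_
      rw [hM]; linarith
    have hqd := norm_sub_le_of_norm_le_pow (n := 3) (hq.diff θ) hK (hq.bound θ) hM0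
      (by rw [hM]; linarith) haM hbM
    have hsc := norm_sin_cpow_sub_cpow_le (κ := κ) hz0 h1 hz1 (by rw [hκre]; positivity)
    rw [← hX, hκre] at hsc
    rw [hκre] at hK₂
    rw [← hK₂] at hsc
    have hsplit : Complex.sin z ^ (-κ) * q θ (stripPoint δ τ z)
        - z ^ (-κ) * q θ (δ * z⁻¹, δ * z⁻¹, 0, 0)
        = (Complex.sin z ^ (-κ) - z ^ (-κ)) * q θ (stripPoint δ τ z)
          + z ^ (-κ) * (q θ (stripPoint δ τ z) - q θ (δ * z⁻¹, δ * z⁻¹, 0, 0)) := by ring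
    rw [hsplit]
    refine (norm_add_le _ _).trans ?_
    rw [norm_mul, norm_mul]
    have hK₂0 : 0 ≤ K₂ := by rw [hK₂]; positivity
    have t1 : ‖Complex.sin z ^ (-κ) - z ^ (-κ)‖ * ‖q θ (stripPoint δ τ z)‖
        ≤ K₂ * (K * 81) * δ ^ 4 * ‖z‖ ^ (-(3 + 2 / d)) := by
      calc _ ≤ (K₂ * ‖z‖ ^ (-(2 / d)) * ‖z‖) * (K * M ^ 4) := by gcongr
        _ = _ := by
          rw [hpow3, hM]
          field_simp
          ring
    have t2 : ‖z ^ (-κ)‖ * ‖q θ (stripPoint δ τ z) - q θ (δ * z⁻¹, δ * z⁻¹, 0, 0)‖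
        ≤ X * (8 * 4 * K * 81) * δ ^ 4 * ‖z‖ ^ (-(3 + 2 / d)) := by
      calc _ ≤ (‖z‖ ^ (-(2 / d)) * X) * (2 ^ (3 + 2) * K * M ^ 3 * (3 * δ)) := by
            refine mul_le_mul hcz (hqd.trans ?_) (norm_nonneg _) (by positivity)
            gcongr
        _ = _ := by
          rw [hpow3, hM]
          ring
    have t3 : 0 ≤ (X * (1 + Real.pi / 2) ^ (2 / d) * K' * (K * 81) + X * K + 1) * δ ^ 4
        * ‖z‖ ^ (-(3 + 2 / d)) := by positivity
    refine (add_le_add t1 t2).trans (sub_nonneg.mp (t3.trans_eq ?_))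
    ring
  · have hzi : ‖z‖⁻¹ ≤ 1 := inv_le_one_of_one_le₀ hz1.le
    have hzi0 : 0 < ‖z‖⁻¹ := inv_pos.mpr hzn
    have haM : ‖stripPoint δ τ z‖ ≤ 3 * δ := hpt.trans (by nlinarith)
    have hqa : ‖q θ (stripPoint δ τ z)‖ ≤ K * (3 * δ) ^ 4 := by
      refine (hq.bound θ _ ?_).trans (by gcongr)
      rw [mem_ball_zero_iff]
      exact haM.trans_lt (by linarith)
    have hqb : ‖q θ (δ * z⁻¹, δ * z⁻¹, 0, 0)‖ ≤ K * (δ * ‖z‖⁻¹) ^ 4 := by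
      refine (hq.bound θ _ ?_).trans (by gcongr)
      rw [mem_ball_zero_iff]
      exact hb4.trans_lt (by linarith)
    have hy : Real.cosh z.im / (1 + Real.pi / 2) ≤ ‖Complex.sin z‖ := by
      rw [div_le_iff₀ (by positivity), mul_comm]
      exact cosh_im_le_mul_norm_sin hz0 h1 hz1.le
    have hcs : ‖Complex.sin z ^ (-κ)‖
        ≤ (1 + Real.pi / 2) ^ (2 / d) * (K' * ‖z‖ ^ (-(3 + 2 / d))) * X := by
      have h := norm_cpow_le_rpow_mul_exp (a := -κ) hs
      rw [Complex.neg_re, Complex.neg_im, abs_neg, hκre] at h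
      refine h.trans ?_
      refine mul_le_mul_of_nonneg_right ?_ hX0.le
      have hcp := Real.cosh_pos z.im
      calc ‖Complex.sin z‖ ^ (-(2 / d)) ≤ (Real.cosh z.im / (1 + Real.pi / 2)) ^ (-(2 / d)) :=
            Real.rpow_le_rpow_of_nonpos (by positivity) hy (by linarith)
        _ = (1 + Real.pi / 2) ^ (2 / d) * Real.cosh z.im ^ (-(2 / d)) := by
          rw [Real.div_rpow hcp.le (by positivity), Real.rpow_neg (by positivity : 0 ≤ 1 + Real.pi / 2)]
          field_simp
        _ ≤ (1 + Real.pi / 2) ^ (2 / d) * (K' * (2 + |z.im|) ^ (-(3 + 2 / d))) := by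
          gcongr
          exact hcosh _
        _ ≤ _ := by
          gcongr (1 + Real.pi / 2) ^ (2 / d) * (K' * ?_)
          refine Real.rpow_le_rpow_of_nonpos hzn ?_ (by linarith)
          refine (Complex.norm_le_abs_re_add_abs_im z).trans ?_
          rw [abs_of_pos hz0]
          linarith [Real.pi_le_four]
    refine (norm_sub_le _ _).trans ?_
    rw [norm_mul, norm_mul]
    have t1 : ‖Complex.sin z ^ (-κ)‖ * ‖q θ (stripPoint δ τ z)‖ ≤
        X * (1 + Real.pi / 2) ^ (2 / d) * K' * (K * 81) * δ ^ 4 * ‖z‖ ^ (-(3 + 2 / d)) := by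
      calc _ ≤ ((1 + Real.pi / 2) ^ (2 / d) * (K' * ‖z‖ ^ (-(3 + 2 / d))) * X)
            * (K * (3 * δ) ^ 4) := by gcongr
        _ = _ := by ring
    have t2 : ‖z ^ (-κ)‖ * ‖q θ (δ * z⁻¹, δ * z⁻¹, 0, 0)‖ ≤
        X * K * δ ^ 4 * ‖z‖ ^ (-(3 + 2 / d)) := by
      calc _ ≤ (‖z‖ ^ (-(2 / d)) * X) * (K * (δ * ‖z‖⁻¹) ^ 4) := by gcongr
        _ = X * K * δ ^ 4 * (‖z‖⁻¹ ^ 3 * ‖z‖ ^ (-(2 / d))) * ‖z‖⁻¹ := by ring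
        _ ≤ X * K * δ ^ 4 * (‖z‖⁻¹ ^ 3 * ‖z‖ ^ (-(2 / d))) * 1 := by gcongr
        _ = _ := by rw [hpow3]; ring
    have hK₂0 : 0 ≤ K₂ := by rw [hK₂]; positivity
    have t3 : 0 ≤ (K₂ * (K * 81) + X * (8 * 4 * K * 81) + 1) * δ ^ 4
        * ‖z‖ ^ (-(3 + 2 / d)) := by positivity
    refine (add_le_add t1 t2).trans (sub_nonneg.mp (t3.trans_eq ?_))
    ring

theorem integral_vertical_line_scale (F : ℂ → ℂ) {δ : ℝ} (hδ : 0 < δ) (C : ℝ) :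
    ∫ t : ℝ, F ((δ * C : ℝ) - Complex.I * t) = δ * ∫ t : ℝ, F (δ * ((C : ℂ) - Complex.I * t)) := by
  have h := Measure.integral_comp_mul_left (fun t : ℝ => F ((δ * C : ℝ) - Complex.I * t)) δ
  rw [abs_of_pos (inv_pos.mpr hδ), Complex.real_smul] at h
  have e : (fun t : ℝ => F (δ * ((C : ℂ) - Complex.I * t)))
      = fun x : ℝ => F ((δ * C : ℝ) - Complex.I * ((δ * x : ℝ) : ℂ)) := by
    ext t
    congr 1
    push_cast
    ring
  rw [e, h, ← mul_assoc, ← Complex.ofReal_mul, mul_inv_cancel₀ hδ.ne', Complex.ofReal_one, one_mul]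

/-- Setting `z = δζ` removes `δ` from the argument of `q`, and `q(w, w, 0, 0) = w φ(w)` at `w = 1/ζ`
raises the exponent from `κ` to `κ + 1`. -/
theorem innerKernel_scale {q : ℝ → ℂ × ℂ × ℂ × ℂ → ℂ} {φ : ℝ → ℂ → ℂ} {r K : ℝ}
    (hq : IsKernelFamily q φ r K) (d c a : ℝ) {δ : ℝ} (hδ : 0 < δ) (θ : ℝ) {ζ : ℂ} (hζ : ζ ≠ 0) :
    innerKernel q d c a δ θ (δ * ζ) = (δ : ℂ)⁻¹ * (δ : ℂ) ^ (-harmonicExponent d c 1) *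
      (Complex.exp ((a / d : ℝ) * ζ) * ζ ^ (-(harmonicExponent d c 1 + 1)) * φ θ ζ⁻¹) := by
  have hδ' : (δ : ℂ) ≠ 0 := by simpa using hδ.ne'
  rw [innerKernel, ofReal_mul_cpow hδ hζ]
  have e1 : ((a / (d * δ) : ℝ) : ℂ) * (δ * ζ) = (a / d : ℝ) * ζ := by
    push_cast
    field_simp
  have e2 : (δ : ℂ) * (δ * ζ)⁻¹ = ζ⁻¹ := by field_simp
  rw [e1, e2, ← hq.phi_eq, neg_add, Complex.cpow_add _ _ hζ, Complex.cpow_neg_one]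
  ring

/-- Leading asymptotics of the first harmonic, uniformly in the parameters. -/
theorem exists_norm_integral_stripKernel_one_sub_le {q : ℝ → ℂ × ℂ × ℂ × ℂ → ℂ} {φ : ℝ → ℂ → ℂ}
    {r K : ℝ} (hq : IsKernelFamily q φ r K) {d : ℝ} (hd : 0 < d) (c : ℝ) (A : ℝ) :
    ∃ δ₀ > (0 : ℝ), ∃ K₁ > (0 : ℝ), ∀ (δ τ a θ : ℝ), 0 < δ → δ ≤ δ₀ → |τ| ≤ δ → 0 < a → a ≤ A →
      ‖(∫ t : ℝ, stripKernel q d c a δ τ 1 θ ((Real.pi / 2 : ℝ) - Complex.I * t))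
        - (δ : ℂ) ^ (-harmonicExponent d c 1) *
          (2 * Real.pi * borelTransform (harmonicExponent d c 1) (φ θ) ((a / d : ℝ) : ℂ))‖
      ≤ K₁ * δ ^ (1 - 2 / d) := by
  obtain ⟨K₁, hK₁, hpt⟩ := exists_norm_sin_cpow_sub_le K hq.K_nonneg hd c
  have hr := hq.r_pos
  have hpi := Real.pi_pos
  have hd2 : 0 < 2 / d := by positivity
  -- `C > 1/r` keeps `1/ζ` in the domain of `φ` on `Re ζ = C`; the factor `8` is the threshold of
  -- the pointwise comparison.
  set C : ℝ := 8 / r with hC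
  have hC0 : 0 < C := by positivity
  have hCr : r⁻¹ < C := by rw [hC, ← one_div]; gcongr; norm_num
  have hJi : Integrable fun t : ℝ => ‖(C : ℂ) - Complex.I * t‖ ^ (-(3 + 2 / d)) := by
    have h := (integrable_vertical_line_cpow (a := ((3 + 2 / d : ℝ) : ℂ))
      (by rw [Complex.ofReal_re]; linarith) hC0).norm
    refine h.congr (Eventually.of_forall fun t => ?_)
    have hne : (C : ℂ) - Complex.I * t ≠ 0 := fun h0 => by
      have := congrArg Complex.re h0
      simp at this
      exact hC0.ne' this
    simp only
    rw [← Complex.ofReal_neg, Complex.norm_cpow_of_ne_zero hne, Complex.ofReal_re,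
      Complex.ofReal_im]
    simp
  set J := ∫ t : ℝ, ‖(C : ℂ) - Complex.I * t‖ ^ (-(3 + 2 / d)) with hJ
  have hJ0 : 0 ≤ J := integral_nonneg fun t => by positivity
  refine ⟨min (r / 8) (Real.pi / (2 * C)), lt_min (by positivity) (by positivity),
    Real.exp (A / d * C) * K₁ * J + 1, by positivity, ?_⟩
  intro δ τ a θ hδ hδ0 hτ ha haA
  have hδr : δ ≤ r / 8 := hδ0.trans (min_le_left _ _)
  have hδC : δ * C ≤ Real.pi / 2 := by
    have := hδ0.trans (min_le_right _ _)
    rw [le_div_iff₀ (by positivity)] at this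
    linarith
  have hδC0 : 0 < δ * C := by positivity
  have hsinlow : 1 / 2 * (δ * C) ≤ Real.sin (δ * C) := by
    refine le_trans ?_ (Real.mul_le_sin hδC0.le hδC)
    refine mul_le_mul_of_nonneg_right ?_ hδC0.le
    rw [div_le_div_iff₀ two_pos hpi]
    linarith [Real.pi_le_four]
  -- The first part is at most `r/8`, and `sin (δC) ≥ δC/2` bounds the second by `2/C = r/4`.
  have hsmall : δ * (1 + (Real.sin (δ * C))⁻¹) < r := by
    have h1 : (Real.sin (δ * C))⁻¹ ≤ (1 / 2 * (δ * C))⁻¹ := inv_anti₀ (by positivity) hsinlow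
    have h2 : δ * (1 / 2 * (δ * C))⁻¹ = r / 4 := by rw [hC]; field_simp; norm_num
    have h3 := mul_le_mul_of_nonneg_left h1 hδ.le
    rw [mul_add]
    linarith
  obtain ⟨hint, hshift⟩ := stripKernel_shift hq hd c ha.le hδ hτ (l := 1) zero_le_one θ hδC0 hδC
    hsmall
  have hne : ∀ t : ℝ, (C : ℂ) - Complex.I * t ≠ 0 := fun t h0 => by
    have := congrArg Complex.re h0
    simp at this
    exact hC0.ne' this
  have hδ' : (δ : ℂ) ≠ 0 := by simpa using hδ.ne'
  have hB : ((δ : ℂ) ^ (-harmonicExponent d c 1) *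
      (2 * Real.pi * borelTransform (harmonicExponent d c 1) (φ θ) ((a / d : ℝ) : ℂ)))
      = δ * ∫ t : ℝ, innerKernel q d c a δ θ (δ * ((C : ℂ) - Complex.I * t)) := by
    rw [← integral_vertical_line_borelTransform (by rw [harmonicExponent_re]; exact hd2) hr
      (hq.phi_diff θ) (hq.phi_bound θ) hCr (by positivity : 0 < a / d)]
    simp only [innerKernel_scale hq d c a hδ θ (hne _)]
    rw [integral_const_mul]
    field_simp
  have hS : Integrable fun t : ℝ => stripKernel q d c a δ τ 1 θ (δ * ((C : ℂ) - Complex.I * t)) := by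
    have h := hint.comp_mul_left' hδ.ne'
    refine h.congr (Eventually.of_forall fun t => ?_)
    simp only
    congr 1
    push_cast
    ring
  have hre : ∀ t : ℝ, ((δ : ℂ) * ((C : ℂ) - Complex.I * t)).re = δ * C := by
    intro t
    rw [Complex.re_ofReal_mul]
    simp
  have hbd : ∀ t : ℝ, ‖stripKernel q d c a δ τ 1 θ (δ * ((C : ℂ) - Complex.I * t))
      - innerKernel q d c a δ θ (δ * ((C : ℂ) - Complex.I * t))‖
      ≤ Real.exp (A / d * C) * K₁ * δ ^ (-(2 / d)) * ‖(C : ℂ) - Complex.I * t‖ ^ (-(3 + 2 / d)) := by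
    intro t
    set z : ℂ := δ * ((C : ℂ) - Complex.I * t) with hz
    have h := hpt q φ r hq δ τ θ z hδ hτ (by linarith) (by rw [hre, hC, mul_comm])
      (by rw [hre]; exact hδC)
    have e : stripKernel q d c a δ τ 1 θ z - innerKernel q d c a δ θ z =
        Complex.exp ((a / (d * δ) : ℝ) * z) * (δ : ℂ)⁻¹ *
        (Complex.sin z ^ (-harmonicExponent d c 1) * q θ (stripPoint δ τ z)
        - z ^ (-harmonicExponent d c 1) * q θ (δ * z⁻¹, δ * z⁻¹, 0, 0)) := by
      rw [stripKernel, innerKernel, Int.cast_one, one_mul]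
      ring
    have hexp : ‖Complex.exp ((a / (d * δ) : ℝ) * z)‖ ≤ Real.exp (A / d * C) := by
      rw [Complex.norm_exp, Complex.re_ofReal_mul, hre]
      refine Real.exp_le_exp.mpr ?_
      have : a / (d * δ) * (δ * C) = a / d * C := by field_simp
      rw [this]
      gcongr
    rw [e, norm_mul, norm_mul, norm_inv, Complex.norm_real, Real.norm_of_nonneg hδ.le]
    have hzn : ‖z‖ = δ * ‖(C : ℂ) - Complex.I * t‖ := by
      rw [hz, norm_mul, Complex.norm_real, Real.norm_of_nonneg hδ.le]
    rw [hzn, Real.mul_rpow hδ.le (norm_nonneg _)] at h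
    -- Power count: `δ⁴` from `q`, `δ⁻¹` from the kernel and `δ^{-3-2/d}` from `‖z‖ = δ‖ζ‖` leave
    -- `δ^{-2/d}`; the line element `dz = δ dζ` later restores one `δ`.
    have hδp : δ ^ (-(3 + 2 / d)) = (δ ^ 3)⁻¹ * δ ^ (-(2 / d)) := by
      rw [neg_add, Real.rpow_add hδ, Real.rpow_neg hδ.le]
      norm_cast
    calc _ ≤ Real.exp (A / d * C) * δ⁻¹ * (K₁ * δ ^ 4 * (δ ^ (-(3 + 2 / d)) *
          ‖(C : ℂ) - Complex.I * t‖ ^ (-(3 + 2 / d)))) := by gcongr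
      _ = _ := by rw [hδp]; field_simp
  -- The inner kernel is integrable because the strip kernel and the difference of the two are.
  have hI : Integrable fun t : ℝ => innerKernel q d c a δ θ (δ * ((C : ℂ) - Complex.I * t)) := by
    have hm : AEStronglyMeasurable
        (fun t : ℝ => innerKernel q d c a δ θ (δ * ((C : ℂ) - Complex.I * t))) := by
      refine Continuous.aestronglyMeasurable ?_
      simp only [innerKernel_scale hq d c a hδ θ (hne _)]
      refine continuous_const.mul (Continuous.mul (Continuous.mul (by fun_prop) ?_) ?_)
      · exact Continuous.cpow (by fun_prop) continuous_const fun t => Or.inl (by simpa using hC0)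
      · refine (hq.phi_diff θ).continuousOn.comp_continuous
          (Continuous.inv₀ (by fun_prop) hne) fun t => ?_
        rw [mem_ball_zero_iff, norm_inv]
        refine (inv_anti₀ hC0 ?_).trans_lt (inv_lt_of_inv_lt₀ hr hCr)
        have := Complex.re_le_norm ((C : ℂ) - Complex.I * t)
        simpa using this
    have hd' := (hJi.const_mul (Real.exp (A / d * C) * K₁ * δ ^ (-(2 / d)))).mono'
      (hS.1.sub hm) (Eventually.of_forall hbd)
    refine (hS.sub hd').congr (Eventually.of_forall fun t => ?_)
    simp
  rw [hshift, integral_vertical_line_scale _ hδ, hB, ← mul_sub, ← integral_sub hS hI, norm_mul,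
    Complex.norm_real, Real.norm_of_nonneg hδ.le]
  have hn := norm_integral_le_of_norm_le (hJi.const_mul (Real.exp (A / d * C) * K₁ * δ ^ (-(2 / d))))
    (Eventually.of_forall hbd)
  rw [integral_const_mul, ← hJ] at hn
  have hδp : δ ^ (1 - 2 / d) = δ * δ ^ (-(2 / d)) := by
    rw [sub_eq_add_neg, Real.rpow_add hδ, Real.rpow_one]
  calc _ ≤ δ * (Real.exp (A / d * C) * K₁ * δ ^ (-(2 / d)) * J) := by gcongr
    _ = Real.exp (A / d * C) * K₁ * J * δ ^ (1 - 2 / d) := by rw [hδp]; ring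
    _ ≤ _ := by
      gcongr
      linarith

/-! ### The perturbation of the vector field as a kernel family -/

/-- Every smaller radius and every larger constant are allowed, so that `f`, `g` and `h` can share
one pair. -/
theorem IsPerturbationTerm.exists_bound {φ : ℂ × ℂ × ℂ × ℂ × ℂ → ℂ} (hφ : IsPerturbationTerm φ) :
    ∃ r₀ > (0 : ℝ), ∃ K₀ ≥ (0 : ℝ), ∀ r ≤ r₀, ∀ K ≥ K₀, DifferentiableOn ℂ φ (Metric.ball 0 r) ∧
      (∀ v ∈ Metric.ball (0 : ℂ × ℂ × ℂ × ℂ × ℂ) r, ‖φ v‖ ≤ K * ‖v‖ ^ 3) ∧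
      ∀ x y z u v : ℝ, ((x : ℂ), (y : ℂ), (z : ℂ), (u : ℂ), (v : ℂ)) ∈
        Metric.ball (0 : ℂ × ℂ × ℂ × ℂ × ℂ) r → (φ (x, y, z, u, v)).im = 0 := by
  obtain ⟨ha, hreal, hO⟩ := hφ
  obtain ⟨K, hK⟩ := hO.bound
  have hd : ∀ᶠ v in 𝓝 (0 : ℂ × ℂ × ℂ × ℂ × ℂ), DifferentiableAt ℂ φ v :=
    ha.eventually_analyticAt.mono fun v hv => hv.differentiableAt
  obtain ⟨r₁, hr₁, h₁⟩ := Metric.eventually_nhds_iff_ball.mp (hK.and hd)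
  obtain ⟨r₂, hr₂, h₂⟩ := Metric.eventually_nhds_iff_ball.mp hreal
  refine ⟨min r₁ r₂, lt_min hr₁ hr₂, max K 0, le_max_right _ _, fun r hr K' hK' => ⟨?_, ?_, ?_⟩⟩
  · intro v hv
    exact (h₁ v (Metric.ball_subset_ball (hr.trans (min_le_left _ _)) hv)).2.differentiableWithinAt
  · intro v hv
    have h := (h₁ v (Metric.ball_subset_ball (hr.trans (min_le_left _ _)) hv)).1
    rw [norm_pow, norm_norm] at h
    refine h.trans ?_
    gcongr
    exact (le_max_left _ _).trans hK'
  · intro x y z u v hv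
    refine h₂ (x, y, z, u, v) (Metric.ball_subset_ball (hr.trans (min_le_right _ _)) ?_)
    rw [mem_ball_zero_iff] at hv ⊢
    simpa only [Prod.norm_def, Complex.norm_real] using hv

namespace HopfZeroFamily

/-- The scale `√((d + 1) / b)`. -/
noncomputable def scale (S : HopfZeroFamily) : ℝ := √((S.d + 1) / S.b)

/-- The factor `-i` makes the third coordinate real when `v.2.1` is imaginary, as it is on the real
`w`-line, and on the diagonal `(w, w, 0, 0)` it gives `wPoint`. -/
noncomputable def liftPoint (S : HopfZeroFamily) (θ : ℝ) (v : ℂ × ℂ × ℂ × ℂ) : ℂ × ℂ × ℂ × ℂ × ℂ :=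
  ((S.scale : ℂ) * v.1 * Real.cos θ, (S.scale : ℂ) * v.1 * Real.sin θ, -Complex.I * v.2.1,
    v.2.2.1, v.2.2.2)

/-- The perturbation part of `𝓕(0)` in the inner coordinates, up to the factor `δ ^ (p - 1)`. -/
noncomputable def reduced (S : HopfZeroFamily) (θ : ℝ) (v : ℂ × ℂ × ℂ × ℂ) : ℂ :=
  (S.scale : ℂ) * v.1 *
      (Real.cos θ * S.f (S.liftPoint θ v) + Real.sin θ * S.g (S.liftPoint θ v))
    - Complex.I * (S.scale : ℂ) ^ 2 * v.2.1 * S.h (S.liftPoint θ v)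

theorem scale_nonneg (S : HopfZeroFamily) : 0 ≤ S.scale := Real.sqrt_nonneg _

theorem norm_liftPoint_le (S : HopfZeroFamily) (θ : ℝ) (v : ℂ × ℂ × ℂ × ℂ) :
    ‖S.liftPoint θ v‖ ≤ (1 + S.scale) * ‖v‖ := by
  have hs := S.scale_nonneg
  have h1 : ‖v.1‖ ≤ ‖v‖ := norm_fst_le v
  have h2 : ‖v.2.1‖ ≤ ‖v‖ := (norm_fst_le v.2).trans (norm_snd_le v)
  have h3 : ‖v.2.2.1‖ ≤ ‖v‖ := (norm_fst_le v.2.2).trans ((norm_snd_le v.2).trans (norm_snd_le v))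
  have h4 : ‖v.2.2.2‖ ≤ ‖v‖ := (norm_snd_le v.2.2).trans ((norm_snd_le v.2).trans (norm_snd_le v))
  have hv := norm_nonneg v
  have key : ∀ x : ℝ, |x| ≤ 1 → ‖(S.scale : ℂ) * v.1 * x‖ ≤ (1 + S.scale) * ‖v‖ := by
    intro x hx
    rw [norm_mul, norm_mul, Complex.norm_real, Complex.norm_real, Real.norm_of_nonneg hs,
      Real.norm_eq_abs]
    calc _ ≤ S.scale * ‖v‖ * 1 := by gcongr
      _ ≤ _ := by nlinarith
  have hle : ‖v‖ ≤ (1 + S.scale) * ‖v‖ := by nlinarith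
  simp only [liftPoint, Prod.norm_def (E := ℂ)]
  refine max_le (key _ (Real.abs_cos_le_one θ)) (max_le (key _ (Real.abs_sin_le_one θ))
    (max_le ?_ (max_le ?_ ?_)))
  · rw [norm_mul, norm_neg, Complex.norm_I, one_mul]; exact h2.trans hle
  · exact h3.trans hle
  · exact h4.trans hle

theorem norm_cos_mul_add_sin_mul_le (θ : ℝ) {u v : ℂ} {B : ℝ} (hu : ‖u‖ ≤ B) (hv : ‖v‖ ≤ B) :
    ‖(Real.cos θ : ℂ) * u + Real.sin θ * v‖ ≤ 2 * B := by
  refine (norm_add_le _ _).trans ?_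
  rw [norm_mul, norm_mul, Complex.norm_real, Complex.norm_real, Real.norm_eq_abs, Real.norm_eq_abs]
  have h1 := mul_le_mul (Real.abs_cos_le_one θ) hu (norm_nonneg _) zero_le_one
  have h2 := mul_le_mul (Real.abs_sin_le_one θ) hv (norm_nonneg _) zero_le_one
  linarith

/-- Order four arises from a linear prefactor times terms of order three. Lifting enlarges norms by
at most `1 + s`, hence the radius `R / (1 + s)`. -/
theorem exists_isKernelFamily (S : HopfZeroFamily) (hf : IsPerturbationTerm S.f)
    (hg : IsPerturbationTerm S.g) (hh : IsPerturbationTerm S.h) :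
    ∃ r K : ℝ, IsKernelFamily S.reduced (fun θ w => S.mReg w θ) r K := by
  obtain ⟨r₁, hr₁, K₁, hK₁, h₁⟩ := hf.exists_bound
  obtain ⟨r₂, hr₂, K₂, hK₂, h₂⟩ := hg.exists_bound
  obtain ⟨r₃, hr₃, K₃, hK₃, h₃⟩ := hh.exists_bound
  set R := min r₁ (min r₂ r₃) with hR
  set K := max K₁ (max K₂ K₃) with hK
  have hR0 : 0 < R := lt_min hr₁ (lt_min hr₂ hr₃)
  have hK0 : 0 ≤ K := le_trans hK₁ (le_max_left _ _)
  obtain ⟨hfd, hfb, hfr⟩ := h₁ R (min_le_left _ _) K (le_max_left _ _)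
  obtain ⟨hgd, hgb, hgr⟩ := h₂ R ((min_le_right _ _).trans (min_le_left _ _)) K
    ((le_max_left _ _).trans (le_max_right _ _))
  obtain ⟨hhd, hhb, hhr⟩ := h₃ R ((min_le_right _ _).trans (min_le_right _ _)) K
    ((le_max_right _ _).trans (le_max_right _ _))
  have hs := S.scale_nonneg
  set s := S.scale with hsdef
  have hs1 : 0 < 1 + s := by positivity
  set K' := s * 2 * (K * (1 + s) ^ 3) + s ^ 2 * (K * (1 + s) ^ 3) with hK'
  set K'' := s * (2 * (K * R ^ 3) + s * (K * R ^ 3)) with hK''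
  have hK'0 : 0 ≤ K' := by positivity
  have hK''0 : 0 ≤ K'' := by positivity
  have hmem : ∀ θ, ∀ v ∈ Metric.ball (0 : ℂ × ℂ × ℂ × ℂ) (R / (1 + s)),
      S.liftPoint θ v ∈ Metric.ball 0 R := by
    intro θ v hv
    rw [mem_ball_zero_iff] at hv ⊢
    refine (S.norm_liftPoint_le θ v).trans_lt ?_
    rw [lt_div_iff₀ hs1] at hv
    rwa [mul_comm]
  have hcube : ∀ θ, ∀ v ∈ Metric.ball (0 : ℂ × ℂ × ℂ × ℂ) (R / (1 + s)),
      K * ‖S.liftPoint θ v‖ ^ 3 ≤ K * (1 + s) ^ 3 * ‖v‖ ^ 3 := by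
    intro θ v hv
    rw [mul_assoc, ← mul_pow]
    gcongr
    exact S.norm_liftPoint_le θ v
  have hbound : ∀ θ, ∀ v ∈ Metric.ball (0 : ℂ × ℂ × ℂ × ℂ) (R / (1 + s)),
      ‖S.reduced θ v‖ ≤ K' * ‖v‖ ^ 4 := by
    intro θ v hv
    have hm := hmem θ v hv
    have hc := hcube θ v hv
    have hb := norm_cos_mul_add_sin_mul_le θ ((hfb _ hm).trans hc) ((hgb _ hm).trans hc)
    have hb3 := (hhb _ hm).trans hc
    have hv1 : ‖v.1‖ ≤ ‖v‖ := norm_fst_le v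
    have hv2 : ‖v.2.1‖ ≤ ‖v‖ := (norm_fst_le v.2).trans (norm_snd_le v)
    rw [reduced]
    refine (norm_sub_le _ _).trans ?_
    simp only [norm_mul, norm_pow, Complex.norm_I, one_mul, Complex.norm_real]
    rw [Real.norm_of_nonneg S.scale_nonneg, ← hsdef]
    calc _ ≤ s * ‖v‖ * (2 * (K * (1 + s) ^ 3 * ‖v‖ ^ 3))
          + s ^ 2 * ‖v‖ * (K * (1 + s) ^ 3 * ‖v‖ ^ 3) := by gcongr
      _ = _ := by rw [hK']; ring
  have hliftd : ∀ θ, Differentiable ℂ (S.liftPoint θ) := by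
    intro θ
    unfold liftPoint
    fun_prop
  have hliftc : Continuous fun x : ℝ × (ℂ × ℂ × ℂ × ℂ) => S.liftPoint x.1 x.2 := by
    unfold liftPoint
    fun_prop
  have hw : ∀ w ∈ Metric.ball (0 : ℂ) (R / (1 + s)),
      ((w, w, 0, 0) : ℂ × ℂ × ℂ × ℂ) ∈ Metric.ball 0 (R / (1 + s)) := by
    intro w hw
    rw [mem_ball_zero_iff] at hw ⊢
    exact (norm_quadruple_le le_rfl le_rfl (by simp) (by simp)).trans_lt hw
  have hwp : ∀ w θ, S.wPoint w θ = S.liftPoint θ (w, w, 0, 0) := fun w θ => rfl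
  -- `K'` is the quartic constant for `reduced`, `K''` the bound for `mReg`; their sum serves both
  -- fields.
  refine ⟨R / (1 + s), K' + K'', by positivity, by positivity, ?_, ?_, ?_, ?_, ?_, ?_, ?_, ?_⟩
  · intro θ v hv
    have hv' := Metric.isOpen_ball.mem_nhds (hmem θ v hv)
    have key : ∀ φ : ℂ × ℂ × ℂ × ℂ × ℂ → ℂ, DifferentiableOn ℂ φ (Metric.ball 0 R) →
        DifferentiableAt ℂ (fun v => φ (S.liftPoint θ v)) v := fun φ hφ =>
      (hφ.differentiableAt hv').comp v (hliftd θ v)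
    have e1 := key _ hfd
    have e2 := key _ hgd
    have e3 := key _ hhd
    refine DifferentiableAt.differentiableWithinAt ?_
    unfold reduced
    fun_prop
  · intro θ v hv
    refine (hbound θ v hv).trans ?_
    gcongr
    linarith
  · have key : ∀ φ : ℂ × ℂ × ℂ × ℂ × ℂ → ℂ, DifferentiableOn ℂ φ (Metric.ball 0 R) →
        ContinuousOn (fun x : ℝ × (ℂ × ℂ × ℂ × ℂ) => φ (S.liftPoint x.1 x.2))
          (Set.univ ×ˢ Metric.ball 0 (R / (1 + s))) := fun φ hφ =>
      hφ.continuousOn.comp hliftc.continuousOn fun x hx => hmem x.1 x.2 hx.2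
    have e1 := key _ hfd
    have e2 := key _ hgd
    have e3 := key _ hhd
    have : Function.uncurry S.reduced = fun x : ℝ × (ℂ × ℂ × ℂ × ℂ) =>
        (S.scale : ℂ) * x.2.1 * (Real.cos x.1 * S.f (S.liftPoint x.1 x.2)
          + Real.sin x.1 * S.g (S.liftPoint x.1 x.2))
        - Complex.I * (S.scale : ℂ) ^ 2 * x.2.2.1 * S.h (S.liftPoint x.1 x.2) := rfl
    rw [this]
    fun_prop
  · intro v θ
    simp only [reduced, liftPoint, Real.cos_add_two_pi, Real.sin_add_two_pi]
  · intro θ x y u v hv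
    have hm := hmem θ _ hv
    have e : S.liftPoint θ ((x : ℂ), Complex.I * (y : ℂ), (u : ℂ), (v : ℂ)) =
        (((s * x * Real.cos θ : ℝ) : ℂ), ((s * x * Real.sin θ : ℝ) : ℂ), (y : ℂ), (u : ℂ),
          (v : ℂ)) := by
      simp only [liftPoint, ← hsdef]
      refine Prod.ext (by push_cast; rfl) (Prod.ext (by push_cast; rfl) (Prod.ext ?_ rfl))
      show -Complex.I * (Complex.I * y) = y
      linear_combination (-(y : ℂ)) * Complex.I_sq
    rw [e] at hm
    have r1 := hfr _ _ _ _ _ hm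
    have r2 := hgr _ _ _ _ _ hm
    have r3 := hhr _ _ _ _ _ hm
    have e2 : S.reduced θ ((x : ℂ), Complex.I * (y : ℂ), (u : ℂ), (v : ℂ)) =
        ((s * x : ℝ) : ℂ) * ((Real.cos θ : ℝ) * S.f (S.liftPoint θ (x, Complex.I * y, u, v))
          + (Real.sin θ : ℝ) * S.g (S.liftPoint θ (x, Complex.I * y, u, v)))
        + ((s ^ 2 * y : ℝ) : ℂ) * S.h (S.liftPoint θ (x, Complex.I * y, u, v)) := by
      simp only [reduced, ← hsdef]
      push_cast
      linear_combination (-(s : ℂ) ^ 2 * y * S.h (S.liftPoint θ (x, Complex.I * y, u, v)))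
        * Complex.I_sq
    rw [e2, e]
    rw [Complex.add_im, Complex.im_ofReal_mul, Complex.im_ofReal_mul, Complex.add_im,
      Complex.im_ofReal_mul, Complex.im_ofReal_mul, r1, r2, r3]
    simp
  · intro θ w hwb
    have hv' := Metric.isOpen_ball.mem_nhds (hmem θ _ (hw w hwb))
    have key : ∀ φ : ℂ × ℂ × ℂ × ℂ × ℂ → ℂ, DifferentiableOn ℂ φ (Metric.ball 0 R) →
        DifferentiableAt ℂ (fun w => φ (S.wPoint w θ)) w := fun φ hφ =>
      DifferentiableAt.comp (g := φ) w (hφ.differentiableAt hv') (by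
        unfold wPoint
        fun_prop)
    have e1 := key _ hfd
    have e2 := key _ hgd
    have e3 := key _ hhd
    refine DifferentiableAt.differentiableWithinAt ?_
    unfold mReg Ftilde
    fun_prop
  · intro θ w hwb
    have hm := hmem θ _ (hw w hwb)
    rw [← hwp] at hm
    have hc : K * ‖S.wPoint w θ‖ ^ 3 ≤ K * R ^ 3 := by
      have := mem_ball_zero_iff.mp hm
      gcongr
    have hb := norm_cos_mul_add_sin_mul_le θ ((hfb _ hm).trans hc) ((hgb _ hm).trans hc)
    have hb3 := (hhb _ hm).trans hc
    have e : S.mReg w θ = (s : ℂ) * ((Real.cos θ * S.f (S.wPoint w θ)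
        + Real.sin θ * S.g (S.wPoint w θ)) - Complex.I * s * S.h (S.wPoint w θ)) := rfl
    simp only [e]
    rw [norm_mul, Complex.norm_real, Real.norm_of_nonneg hs]
    have h4 : ‖Complex.I * s * S.h (S.wPoint w θ)‖ ≤ s * (K * R ^ 3) := by
      rw [norm_mul, norm_mul, Complex.norm_I, one_mul, Complex.norm_real, Real.norm_of_nonneg hs]
      gcongr
    calc _ ≤ s * (2 * (K * R ^ 3) + s * (K * R ^ 3)) := by
          gcongr
          exact (norm_sub_le _ _).trans (add_le_add hb h4)
      _ ≤ _ := by linarith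
  · intro θ w
    have e : S.mReg w θ = (s : ℂ) * ((Real.cos θ * S.f (S.wPoint w θ)
        + Real.sin θ * S.g (S.wPoint w θ)) - Complex.I * s * S.h (S.wPoint w θ)) := rfl
    simp only [e]
    rw [reduced, hwp, ← hsdef]
    ring

end HopfZeroFamily

/-! ### The Melnikov function and its harmonics on the real line -/

namespace HopfZeroFamily

/-- The value of `stripPoint` at `z = π/2 - i d w`. Its second coordinate is purely imaginary, which
is the shape required by the reality condition of `IsKernelFamily`. -/
noncomputable def realPoint (S : HopfZeroFamily) (δ σ w : ℝ) : ℂ × ℂ × ℂ × ℂ :=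
  (((δ * (Real.cosh (S.d * w))⁻¹ : ℝ) : ℂ), Complex.I * ((δ * Real.tanh (S.d * w) : ℝ) : ℂ),
    (δ : ℂ), ((δ * σ : ℝ) : ℂ))

/-- The weight `cosh^{-2/d}(dw)`. -/
noncomputable def weight (S : HopfZeroFamily) (w : ℝ) : ℝ := (Real.cosh (S.d * w) ^ (2 / S.d))⁻¹

/-- The phase `αw/δ + (c/d) log cosh(dw)`. -/
noncomputable def fastPhase (S : HopfZeroFamily) (δ σ w : ℝ) : ℝ :=
  δ⁻¹ * S.α δ σ * w + S.c / S.d * Real.log (Real.cosh (S.d * w))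

theorem sqrt_two_mul_R₀ (S : HopfZeroFamily) (hb : 0 < S.b) (hd : 0 < S.d) (w : ℝ) :
    √(2 * S.R₀ w) = S.scale * (Real.cosh (S.d * w))⁻¹ := by
  have hc := Real.cosh_pos (S.d * w)
  have e : 2 * S.R₀ w = (S.d + 1) / S.b * ((Real.cosh (S.d * w))⁻¹) ^ 2 := by
    rw [R₀]
    field_simp
  rw [e, Real.sqrt_mul (by positivity), Real.sqrt_sq (by positivity), scale]

theorem scale_sq (S : HopfZeroFamily) (hb : 0 < S.b) (hd : 0 < S.d) :
    S.scale ^ 2 = (S.d + 1) / S.b := Real.sq_sqrt (by positivity)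

theorem argPoint_eq (S : HopfZeroFamily) (hb : 0 < S.b) (hd : 0 < S.d) (δ σ w θ : ℝ) :
    argPoint (S.R₀ w) θ (S.Z₀ w) δ σ = S.liftPoint θ (S.realPoint δ σ w) := by
  simp only [argPoint, liftPoint, realPoint, S.sqrt_two_mul_R₀ hb hd, Z₀]
  refine Prod.ext (by push_cast; ring) (Prod.ext (by push_cast; ring) (Prod.ext ?_ rfl))
  show ((δ * Real.tanh (S.d * w) : ℝ) : ℂ) = -Complex.I * (Complex.I * _)
  linear_combination (((δ * Real.tanh (S.d * w) : ℝ) : ℂ)) * Complex.I_sq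

/-- At `ρ = 0` the derivative terms vanish. The prefactors `√(2R₀)` and `((d+1)/b) Z₀` are the first
two inner coordinates divided by `δ`, up to powers of `scale` and a factor `-i`; hence the `δ⁻¹`. -/
theorem opF_zero_eq (S : HopfZeroFamily) (hb : 0 < S.b) (hd : 0 < S.d) {δ : ℝ} (hδ : 0 < δ)
    (σ w θ : ℝ) : S.opF δ σ 0 w θ = ((2 * σ * S.R₀ w : ℝ) : ℂ)
      + ((δ ^ S.p : ℝ) : ℂ) * ((δ : ℂ)⁻¹ * S.reduced θ (S.realPoint δ σ w)) := by
  have hδ' : (δ : ℂ) ≠ 0 := by simpa using hδ.ne'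
  have hsq : (S.scale : ℂ) ^ 2 = ((S.d : ℂ) + 1) / S.b := by
    rw [← Complex.ofReal_pow, S.scale_sq hb hd]
    push_cast
    rfl
  simp only [opF, barF, barH, polarF, polarH, Pi.zero_apply, deriv_const, mul_zero, add_zero,
    Complex.ofReal_zero, sub_zero]
  rw [S.argPoint_eq hb hd, S.sqrt_two_mul_R₀ hb hd]
  rw [reduced, hsq]
  generalize S.f (S.liftPoint θ (S.realPoint δ σ w)) = F
  generalize S.g (S.liftPoint θ (S.realPoint δ σ w)) = G
  generalize S.h (S.liftPoint θ (S.realPoint δ σ w)) = H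
  simp only [realPoint, Z₀]
  have e1 : (δ : ℂ)⁻¹ * δ = 1 := inv_mul_cancel₀ hδ'
  push_cast
  linear_combination (-(((δ ^ S.p : ℝ) : ℂ) * S.scale * (Complex.cosh (S.d * w))⁻¹ *
    (Complex.cos θ * F + Complex.sin θ * G)) + ((δ ^ S.p : ℝ) : ℂ) * ((S.d + 1) / S.b)
      * Complex.tanh (S.d * w) * H * Complex.I ^ 2) * e1
    + ((δ ^ S.p : ℝ) : ℂ) * ((S.d + 1) / S.b) * Complex.tanh (S.d * w) * H * Complex.I_sq

theorem integrable_weight (S : HopfZeroFamily) (hd : 0 < S.d) : Integrable S.weight := by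
  have h := (integrable_cosh_rpow_neg (e := 2 / S.d) (by positivity)).comp_mul_left' hd.ne'
  refine h.congr (Eventually.of_forall fun w => ?_)
  rw [weight, ← Real.rpow_neg (Real.cosh_pos _).le]

theorem continuous_fastPhase (S : HopfZeroFamily) (δ σ : ℝ) : Continuous (S.fastPhase δ σ) := by
  unfold fastPhase
  refine Continuous.add (by fun_prop) (continuous_const.mul (Continuous.log ?_ ?_))
  · exact Real.continuous_cosh.comp (by fun_prop)
  · exact fun w => (Real.cosh_pos _).ne'

theorem continuous_realPoint (S : HopfZeroFamily) (δ σ : ℝ) :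
    Continuous fun w => S.realPoint δ σ w := by
  have h1 : Continuous fun w => (Real.cosh (S.d * w))⁻¹ :=
    Continuous.inv₀ (Real.continuous_cosh.comp (by fun_prop)) fun w => (Real.cosh_pos _).ne'
  have h2 : Continuous fun w => Real.tanh (S.d * w) := by
    have : Continuous Real.tanh := by
      have e : Real.tanh = fun x => Real.sinh x / Real.cosh x := funext Real.tanh_eq_sinh_div_cosh
      rw [e]
      exact Real.continuous_sinh.div Real.continuous_cosh fun x => (Real.cosh_pos _).ne'
    exact this.comp (by fun_prop)
  unfold realPoint
  fun_prop

theorem norm_realPoint_le (S : HopfZeroFamily) {δ σ : ℝ} (hδ : 0 < δ) (hσ : |δ * σ| ≤ δ) (w : ℝ) :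
    ‖S.realPoint δ σ w‖ ≤ δ := by
  have hc := Real.cosh_pos (S.d * w)
  refine norm_quadruple_le ?_ ?_ ?_ ?_
  · rw [Complex.norm_real, Real.norm_of_nonneg (by positivity)]
    have : (Real.cosh (S.d * w))⁻¹ ≤ 1 := inv_le_one_of_one_le₀ (Real.one_le_cosh _)
    nlinarith
  · rw [norm_mul, Complex.norm_I, one_mul, Complex.norm_real, norm_mul, Real.norm_of_nonneg hδ.le]
    have : ‖Real.tanh (S.d * w)‖ ≤ 1 := by
      rw [Real.norm_eq_abs]
      exact (Real.abs_tanh_lt_one _).le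
    nlinarith
  · rw [Complex.norm_real, Real.norm_of_nonneg hδ.le]
  · rwa [Complex.norm_real, Real.norm_eq_abs]

section Reduced

variable {S : HopfZeroFamily} {φ : ℝ → ℂ → ℂ} {r K : ℝ}

theorem continuous_reduced_realPoint (hq : IsKernelFamily S.reduced φ r K) {δ σ : ℝ} (hδ : 0 < δ)
    (hσ : |δ * σ| ≤ δ) (hr : δ < r) :
    Continuous fun x : ℝ × ℝ => S.reduced x.2 (S.realPoint δ σ x.1) := by
  have h := hq.cont.comp_continuous (f := fun x : ℝ × ℝ => (x.2, S.realPoint δ σ x.1))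
    (continuous_snd.prodMk ((S.continuous_realPoint δ σ).comp continuous_fst)) fun x =>
      ⟨Set.mem_univ _, by
        rw [mem_ball_zero_iff]; exact (S.norm_realPoint_le hδ hσ _).trans_lt hr⟩
  exact h

theorem norm_reduced_realPoint_le (hq : IsKernelFamily S.reduced φ r K) {δ σ : ℝ} (hδ : 0 < δ)
    (hσ : |δ * σ| ≤ δ) (hr : δ < r) (w θ : ℝ) :
    ‖S.reduced θ (S.realPoint δ σ w)‖ ≤ K * δ ^ 4 := by
  have h := S.norm_realPoint_le hδ hσ w
  refine (hq.bound θ _ (by rw [mem_ball_zero_iff]; exact h.trans_lt hr)).trans ?_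
  have := hq.K_nonneg
  gcongr

theorem continuous_opF_zero (hb : 0 < S.b) (hd : 0 < S.d) (hq : IsKernelFamily S.reduced φ r K)
    {δ σ : ℝ} (hδ : 0 < δ) (hσ : |δ * σ| ≤ δ) (hr : δ < r) :
    Continuous (Function.uncurry fun w θ => S.opF δ σ 0 w θ) := by
  have e : (Function.uncurry fun w θ => S.opF δ σ 0 w θ) = fun x : ℝ × ℝ =>
      ((2 * σ * S.R₀ x.1 : ℝ) : ℂ)
      + ((δ ^ S.p : ℝ) : ℂ) * ((δ : ℂ)⁻¹ * S.reduced x.2 (S.realPoint δ σ x.1)) := by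
    ext x
    exact S.opF_zero_eq hb hd hδ σ x.1 x.2
  rw [e]
  have h1 := continuous_reduced_realPoint hq hδ hσ hr
  have h2 : Continuous S.R₀ := by
    unfold R₀
    refine continuous_const.mul (Continuous.div continuous_const ?_ fun t => ?_)
    · exact (Real.continuous_cosh.comp (by fun_prop)).pow 2
    · have := Real.cosh_pos (S.d * t)
      positivity
  have h3 : Continuous fun x : ℝ × ℝ => S.R₀ x.1 := h2.comp continuous_fst
  fun_prop

theorem exists_norm_opF_zero_le (hb : 0 < S.b) (hd : 0 < S.d)
    (hq : IsKernelFamily S.reduced φ r K)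
    {δ σ : ℝ} (hδ : 0 < δ) (hσ : |δ * σ| ≤ δ) (hr : δ < r) :
    ∃ B : ℝ, ∀ w θ, ‖S.opF δ σ 0 w θ‖ ≤ B := by
  refine ⟨2 * |σ| * ((S.d + 1) / (2 * S.b)) + δ ^ S.p * (δ⁻¹ * (K * δ ^ 4)), fun w θ => ?_⟩
  rw [S.opF_zero_eq hb hd hδ]
  refine (norm_add_le _ _).trans (add_le_add ?_ ?_)
  · rw [Complex.norm_real, norm_mul, norm_mul, Real.norm_eq_abs σ, Real.norm_two]
    gcongr
    rw [R₀, Real.norm_of_nonneg (by positivity)]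
    refine mul_le_of_le_one_right (by positivity) ?_
    rw [div_le_one (by have := Real.cosh_pos (S.d * w); positivity)]
    exact one_le_pow₀ (Real.one_le_cosh _)
  · rw [norm_mul, norm_mul, norm_inv, Complex.norm_real, Complex.norm_real,
      Real.norm_of_nonneg hδ.le, Real.norm_of_nonneg (by positivity)]
    gcongr
    exact norm_reduced_realPoint_le hq hδ hσ hr w θ

theorem periodic_opF_zero (hb : 0 < S.b) (hd : 0 < S.d) (hq : IsKernelFamily S.reduced φ r K)
    {δ : ℝ} (hδ : 0 < δ) (σ w : ℝ) :
    Function.Periodic (fun θ => S.opF δ σ 0 w θ) (2 * Real.pi) := by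
  intro θ
  simp only [S.opF_zero_eq hb hd hδ]
  have h := hq.periodic (S.realPoint δ σ w) θ
  simp only at h
  rw [h]

theorem conj_opF_zero (hb : 0 < S.b) (hd : 0 < S.d) (hq : IsKernelFamily S.reduced φ r K)
    {δ σ : ℝ} (hδ : 0 < δ) (hσ : |δ * σ| ≤ δ) (hr : δ < r) (w θ : ℝ) :
    (starRingEnd ℂ) (S.opF δ σ 0 w θ) = S.opF δ σ 0 w θ := by
  have h : (S.reduced θ (S.realPoint δ σ w)).im = 0 := hq.real θ _ _ _ _ (by
    rw [mem_ball_zero_iff]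
    exact (S.norm_realPoint_le hδ hσ w).trans_lt hr)
  rw [S.opF_zero_eq hb hd hδ, map_add, map_mul, map_mul, map_inv₀, Complex.conj_ofReal,
    Complex.conj_ofReal, Complex.conj_ofReal, Complex.conj_eq_iff_im.mpr h]

theorem upsilon_eq (S : HopfZeroFamily) (δ σ : ℝ) (l : ℤ) : S.upsilon δ σ l =
    ∫ w : ℝ, (S.weight w : ℂ) * (Complex.exp (-Complex.I * l * S.fastPhase δ σ w)
      * circleCoeff l (fun θ => S.opF δ σ 0 w θ)) := by
  rw [upsilon]
  congr 1
  ext w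
  rw [weight, fastPhase, Complex.ofReal_inv, div_eq_inv_mul]

theorem conj_upsilon (hb : 0 < S.b) (hd : 0 < S.d) (hq : IsKernelFamily S.reduced φ r K)
    {δ σ : ℝ} (hδ : 0 < δ) (hσ : |δ * σ| ≤ δ) (hr : δ < r) (l : ℤ) :
    (starRingEnd ℂ) (S.upsilon δ σ l) = S.upsilon δ σ (-l) := by
  rw [upsilon_eq, upsilon_eq, ← integral_conj]
  congr 1
  ext w
  rw [map_mul, map_mul, circleCoeff_conj, Complex.conj_ofReal, ← Complex.exp_conj]
  simp only [conj_opF_zero hb hd hq hδ hσ hr]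
  congr 3
  simp

/-- The `2π`-periodic profile of the Melnikov function. -/
noncomputable def profile (S : HopfZeroFamily) (δ σ φ : ℝ) : ℂ :=
  ∫ w : ℝ, (S.weight w : ℂ) * S.opF δ σ 0 w (φ - S.fastPhase δ σ w)

theorem conj_profile (hb : 0 < S.b) (hd : 0 < S.d) (hq : IsKernelFamily S.reduced φ r K)
    {δ σ : ℝ} (hδ : 0 < δ) (hσ : |δ * σ| ≤ δ) (hr : δ < r) (x : ℝ) :
    (starRingEnd ℂ) (S.profile δ σ x) = S.profile δ σ x := by
  rw [profile, ← integral_conj]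
  congr 1
  ext w
  rw [map_mul, Complex.conj_ofReal, conj_opF_zero hb hd hq hδ hσ hr]

theorem circleCoeff_profile (hb : 0 < S.b) (hd : 0 < S.d) (hq : IsKernelFamily S.reduced φ r K)
    {δ σ : ℝ} (hδ : 0 < δ) (hσ : |δ * σ| ≤ δ) (hr : δ < r) (l : ℤ) :
    circleCoeff l (S.profile δ σ) = S.upsilon δ σ l := by
  obtain ⟨B, hB⟩ := exists_norm_opF_zero_le hb hd hq hδ hσ hr
  rw [upsilon_eq]
  exact circleCoeff_integral_mul_comp_sub (continuous_opF_zero hb hd hq hδ hσ hr) hB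
    (S.integrable_weight hd).ofReal (S.continuous_fastPhase δ σ)
    (periodic_opF_zero hb hd hq hδ σ)

theorem hasSum_profile (hb : 0 < S.b) (hd : 0 < S.d) (hq : IsKernelFamily S.reduced φ r K)
    {δ σ : ℝ} (hδ : 0 < δ) (hσ : |δ * σ| ≤ δ) (hr : δ < r)
    (hs : Summable fun l : ℤ => S.upsilon δ σ l) (x : ℝ) :
    HasSum (fun l : ℤ => S.upsilon δ σ l * Complex.exp (Complex.I * l * x)) (S.profile δ σ x) := by
  obtain ⟨B, hB⟩ := exists_norm_opF_zero_le hb hd hq hδ hσ hr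
  have hc := circleCoeff_profile hb hd hq hδ hσ hr
  have h := hasSum_circleCoeff_mul_cexp (N := S.profile δ σ)
    (continuous_integral_mul_comp_sub (continuous_opF_zero hb hd hq hδ hσ hr) hB
      (S.integrable_weight hd).ofReal (S.continuous_fastPhase δ σ))
    (fun x => by
      simp only [profile]
      congr 1
      ext w
      have h := periodic_opF_zero hb hd hq hδ σ w (x - S.fastPhase δ σ w)
      simp only at h
      rw [add_sub_right_comm, h]) (by simpa only [hc] using hs) x
  simpa only [hc] using h

/-- The linear term here cancels the `∓cw` in `η^∓`. Both functions become `δ · fastPhase` plus the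
same constant, and only their differences enter. -/
theorem log_one_add_exp_two_mul (x : ℝ) :
    Real.log (1 + Real.exp (2 * x)) = x + Real.log 2 + Real.log (Real.cosh x) := by
  have h : 1 + Real.exp (2 * x) = Real.exp x * (2 * Real.cosh x) := by
    rw [Real.cosh_eq, two_mul x, Real.exp_add]
    have : Real.exp x * Real.exp (-x) = 1 := by rw [← Real.exp_add]; simp
    linear_combination -this
  rw [h, Real.log_mul (Real.exp_pos _).ne' (by have := Real.cosh_pos x; positivity), Real.log_exp,
    Real.log_mul two_ne_zero (Real.cosh_pos x).ne', add_assoc]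

theorem ηU_eq (S : HopfZeroFamily) (hd : 0 < S.d) {δ : ℝ} (hδ : 0 < δ) (σ w : ℝ) :
    S.ηU δ σ w = δ * S.fastPhase δ σ w + δ * (S.c / S.d * Real.log 2) := by
  rw [ηU, fastPhase, show 2 * S.d * w = 2 * (S.d * w) by ring, log_one_add_exp_two_mul]
  field_simp
  ring

theorem ηS_eq (S : HopfZeroFamily) (hd : 0 < S.d) {δ : ℝ} (hδ : 0 < δ) (σ w : ℝ) :
    S.ηS δ σ w = δ * S.fastPhase δ σ w + δ * (S.c / S.d * Real.log 2) := by
  rw [ηS, fastPhase, show -2 * S.d * w = 2 * (-(S.d * w)) by ring, log_one_add_exp_two_mul,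
    Real.cosh_neg]
  field_simp
  ring

/-- After the constant cancels, the unstable and stable integrands coincide, so the difference of
the two manifolds is a single integral over `(-∞, u] ∪ (u, ∞)`. -/
theorem melnikov_eq (hb : 0 < S.b) (hd : 0 < S.d) (hq : IsKernelFamily S.reduced φ r K)
    {δ σ : ℝ} (hδ : 0 < δ) (hσ : |δ * σ| ≤ δ) (hr : δ < r) (u θ : ℝ) :
    S.melnikov δ σ u θ = (Real.cosh (S.d * u) ^ (2 / S.d) : ℝ) *
      S.profile δ σ (θ + S.fastPhase δ σ u) := by
  obtain ⟨B, hB⟩ := exists_norm_opF_zero_le hb hd hq hδ hσ hr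
  have hint : Integrable fun w : ℝ => (S.weight w : ℂ) *
      S.opF δ σ 0 w (θ + S.fastPhase δ σ u - S.fastPhase δ σ w) := by
    have hG : Continuous fun x : ℝ × ℝ => S.opF δ σ 0 x.1 x.2 :=
      continuous_opF_zero hb hd hq hδ hσ hr
    have hψ := S.continuous_fastPhase δ σ
    refine (S.integrable_weight hd).ofReal.mul_bdd (c := B) (Continuous.aestronglyMeasurable ?_)
      (Eventually.of_forall fun w => hB _ _)
    exact hG.comp (f := fun w => (w, θ + S.fastPhase δ σ u - S.fastPhase δ σ w)) (by fun_prop)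
  have eU : ∀ w, S.opF δ σ 0 w (θ - δ⁻¹ * (S.ηU δ σ w - S.ηU δ σ u))
      / (Real.cosh (S.d * w) ^ (2 / S.d) : ℝ) = (S.weight w : ℂ) *
      S.opF δ σ 0 w (θ + S.fastPhase δ σ u - S.fastPhase δ σ w) := by
    intro w
    rw [S.ηU_eq hd hδ, S.ηU_eq hd hδ, weight, Complex.ofReal_inv, div_eq_inv_mul]
    congr 2
    field_simp
    ring
  have eS : ∀ w, S.opF δ σ 0 w (θ - δ⁻¹ * (S.ηS δ σ w - S.ηS δ σ u))
      / (Real.cosh (S.d * w) ^ (2 / S.d) : ℝ) = (S.weight w : ℂ) *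
      S.opF δ σ 0 w (θ + S.fastPhase δ σ u - S.fastPhase δ σ w) := by
    intro w
    rw [S.ηS_eq hd hδ, S.ηS_eq hd hδ, weight, Complex.ofReal_inv, div_eq_inv_mul]
    congr 2
    field_simp
    ring
  rw [melnikov, rU, rS, profile, ← integral_add_compl measurableSet_Iic hint (s := Set.Iic u),
    Set.compl_Iic]
  simp only [eU, eS]
  ring

theorem stripPoint_eq_realPoint (S : HopfZeroFamily) (δ σ w : ℝ) :
    stripPoint δ (δ * σ) ((Real.pi / 2 : ℝ) - Complex.I * ((S.d * w : ℝ) : ℂ))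
      = S.realPoint δ σ w := by
  have e1 : ((Real.pi / 2 : ℝ) : ℂ) - Complex.I * ((S.d * w : ℝ) : ℂ)
      = Real.pi / 2 - ((S.d * w : ℝ) : ℂ) * Complex.I := by push_cast; ring
  have hs : Complex.sin (((Real.pi / 2 : ℝ) : ℂ) - Complex.I * ((S.d * w : ℝ) : ℂ))
      = (Real.cosh (S.d * w) : ℝ) := by
    rw [e1, Complex.sin_pi_div_two_sub, Complex.cos_mul_I, Complex.ofReal_cosh]
  have hc : Complex.cos (((Real.pi / 2 : ℝ) : ℂ) - Complex.I * ((S.d * w : ℝ) : ℂ))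
      = (Real.sinh (S.d * w) : ℝ) * Complex.I := by
    rw [e1, Complex.cos_pi_div_two_sub, Complex.sin_mul_I, Complex.ofReal_sinh]
  rw [stripPoint, realPoint, hs, hc, Real.tanh_eq_sinh_div_cosh]
  refine Prod.ext (by push_cast; rfl) (Prod.ext ?_ rfl)
  push_cast
  ring

/-- On this line `sin z = cosh (dw)` is positive, so the principal power splits into the weight and
the phase `(c/d) log cosh`; the linear exponential splits off the constant `e^{lαπ/(2dδ)}`. -/
theorem stripKernel_eq (S : HopfZeroFamily) (hd : 0 < S.d) {δ : ℝ} (hδ : 0 < δ) (σ : ℝ) (l : ℤ)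
    (θ w : ℝ) :
    stripKernel S.reduced S.d S.c (S.α δ σ) δ (δ * σ) l θ
      ((Real.pi / 2 : ℝ) - Complex.I * ((S.d * w : ℝ) : ℂ)) =
    Complex.exp ((l * (S.α δ σ * Real.pi / (2 * S.d * δ)) : ℝ)) * ((S.weight w : ℂ) *
      Complex.exp (-Complex.I * l * S.fastPhase δ σ w)) *
      ((δ : ℂ)⁻¹ * S.reduced θ (S.realPoint δ σ w)) := by
  have hc := Real.cosh_pos (S.d * w)
  have e1 : ((Real.pi / 2 : ℝ) : ℂ) - Complex.I * ((S.d * w : ℝ) : ℂ)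
      = Real.pi / 2 - ((S.d * w : ℝ) : ℂ) * Complex.I := by push_cast; ring
  have hs : Complex.sin (((Real.pi / 2 : ℝ) : ℂ) - Complex.I * ((S.d * w : ℝ) : ℂ))
      = (Real.cosh (S.d * w) : ℝ) := by
    rw [e1, Complex.sin_pi_div_two_sub, Complex.cos_mul_I, Complex.ofReal_cosh]
  have hδ' : (δ : ℂ) ≠ 0 := by simpa using hδ.ne'
  have hd' : (S.d : ℂ) ≠ 0 := by simpa using hd.ne'
  rw [stripKernel, S.stripPoint_eq_realPoint, hs]
  congr 1
  rw [Complex.cpow_def_of_ne_zero (by exact_mod_cast hc.ne'), ← Complex.ofReal_log hc.le, weight,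
    ← Real.rpow_neg hc.le, Real.rpow_def_of_pos hc, Complex.ofReal_exp, ← Complex.exp_add,
    ← Complex.exp_add, ← Complex.exp_add, harmonicExponent, fastPhase]
  generalize Real.log (Real.cosh (S.d * w)) = L
  congr 1
  push_cast
  field_simp
  ring

/-- Each nonzero harmonic as a contour integral on the line `Re z = π / 2`. -/
theorem upsilon_eq_circleCoeff_integral (hb : 0 < S.b) (hd : 0 < S.d)
    (hq : IsKernelFamily S.reduced φ r K) {δ σ : ℝ} (hδ : 0 < δ) (hσ : |δ * σ| ≤ δ) (hr : δ < r)
    {l : ℤ} (hl : l ≠ 0) :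
    S.upsilon δ σ l = ((δ ^ S.p : ℝ) : ℂ) *
      (Real.exp (-(S.α δ σ * Real.pi / (2 * S.d * δ) * l)) : ℝ) * (S.d : ℂ)⁻¹ *
      circleCoeff l (fun θ => ∫ t : ℝ, stripKernel S.reduced S.d S.c (S.α δ σ) δ (δ * σ) l θ
        ((Real.pi / 2 : ℝ) - Complex.I * t)) := by
  have hcont := continuous_reduced_realPoint hq hδ hσ hr
  have hcoeff : ∀ w, circleCoeff l (fun θ => S.opF δ σ 0 w θ) = ((δ ^ S.p : ℝ) : ℂ) *
      circleCoeff l (fun θ => (δ : ℂ)⁻¹ * S.reduced θ (S.realPoint δ σ w)) := by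
    intro w
    simp only [S.opF_zero_eq hb hd hδ]
    have hcw : Continuous fun θ => S.reduced θ (S.realPoint δ σ w) :=
      hcont.comp (f := fun θ => (w, θ)) (by fun_prop)
    -- The term `2σR₀` is constant in `θ`; this is where `l ≠ 0` enters.
    rw [circleCoeff_add continuous_const (by fun_prop), circleCoeff_const hl, zero_add]
    exact fourierCoeffOn.const_mul _ _ _ _
  have hKi : Integrable fun w => (S.weight w : ℂ) *
      Complex.exp (-Complex.I * l * S.fastPhase δ σ w) := by
    have hψ := S.continuous_fastPhase δ σ
    exact (S.integrable_weight hd).ofReal.mul_bdd (c := 1)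
      (Continuous.aestronglyMeasurable (by fun_prop))
      (Eventually.of_forall fun w => (norm_cexp_neg_I_mul_int_mul _ _).le)
  have hswap := integral_mul_circleCoeff (l := l)
    (G := fun w θ => (δ : ℂ)⁻¹ * S.reduced θ (S.realPoint δ σ w)) (B := δ⁻¹ * (K * δ ^ 4))
    (continuous_const.mul hcont) (fun w θ => by
      rw [norm_mul, norm_inv, Complex.norm_real, Real.norm_of_nonneg hδ.le]
      gcongr
      exact norm_reduced_realPoint_le hq hδ hσ hr w θ) hKi
  rw [upsilon_eq]
  have e1 : ∀ w, (S.weight w : ℂ) * (Complex.exp (-Complex.I * l * S.fastPhase δ σ w)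
      * circleCoeff l (fun θ => S.opF δ σ 0 w θ)) = ((δ ^ S.p : ℝ) : ℂ) *
      ((S.weight w : ℂ) * Complex.exp (-Complex.I * l * S.fastPhase δ σ w) *
        circleCoeff l (fun θ => (δ : ℂ)⁻¹ * S.reduced θ (S.realPoint δ σ w))) := by
    intro w
    rw [hcoeff]
    ring
  simp only [e1]
  rw [integral_const_mul, hswap, mul_assoc, mul_assoc]
  congr 1
  rw [show ∀ (x y : ℂ) (F : ℝ → ℂ), x * (y * circleCoeff l F) = circleCoeff l fun θ => (x * y) * F θ
    from fun x y F => by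
      rw [← mul_assoc]; exact (fourierCoeffOn.const_mul _ _ _ _).symm]
  congr 1
  ext θ
  have hscale := Measure.integral_comp_mul_left (fun t : ℝ => stripKernel S.reduced S.d S.c
    (S.α δ σ) δ (δ * σ) l θ ((Real.pi / 2 : ℝ) - Complex.I * t)) S.d
  rw [abs_of_pos (inv_pos.mpr hd), Complex.real_smul] at hscale
  simp only [S.stripKernel_eq hd hδ] at hscale
  rw [Complex.ofReal_inv] at hscale
  rw [mul_assoc, ← hscale, ← integral_const_mul]
  congr 1
  ext w
  have e3 : ((Real.exp (-(S.α δ σ * Real.pi / (2 * S.d * δ) * l)) : ℝ) : ℂ) *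
      Complex.exp ((l * (S.α δ σ * Real.pi / (2 * S.d * δ)) : ℝ)) = 1 := by
    rw [Complex.ofReal_exp, ← Complex.exp_add]
    push_cast
    rw [← Complex.exp_zero]
    congr 1
    ring
  linear_combination (-((S.weight w : ℂ) * Complex.exp (-Complex.I * l * S.fastPhase δ σ w) *
    ((δ : ℂ)⁻¹ * S.reduced θ (S.realPoint δ σ w)))) * e3

end Reduced

end HopfZeroFamily

/-! ### Asymptotics of the first harmonic and bounds for the others -/

/-- Continuity in `θ` is read off the contour integral by dominated convergence. It is needed to
split Fourier coefficients additively. -/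
theorem IsKernelFamily.continuous_integral_borel {q : ℝ → ℂ × ℂ × ℂ × ℂ → ℂ} {φ : ℝ → ℂ → ℂ}
    {r K : ℝ} (hq : IsKernelFamily q φ r K) {κ : ℂ} (hκ : 0 < κ.re) {ζ : ℝ} (hζ : 0 < ζ) :
    Continuous fun θ => borelTransform κ (φ θ) ζ := by
  have hr := hq.r_pos
  set C : ℝ := 2 * r⁻¹ with hC
  have hri : 0 < r⁻¹ := inv_pos.mpr hr
  have hC0 : 0 < C := by positivity
  have hCr : r⁻¹ < C := by rw [hC]; linarith
  have hne : ∀ t : ℝ, (C : ℂ) - Complex.I * t ≠ 0 := fun t h0 => by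
    have := congrArg Complex.re h0
    simp at this
    exact hC0.ne' this
  have hnorm : ∀ t : ℝ, ‖((C : ℂ) - Complex.I * t)⁻¹‖ < r := fun t => by
    rw [norm_inv]
    refine (inv_anti₀ hC0 ?_).trans_lt (inv_lt_of_inv_lt₀ hr hCr)
    have := Complex.re_le_norm ((C : ℂ) - Complex.I * t)
    simpa using this
  have hpi : (2 * Real.pi : ℂ) ≠ 0 := by exact_mod_cast Real.two_pi_pos.ne'
  -- Joint continuity is only assumed for `q`; on the contour `φ` is recovered as `q(w, w, 0, 0)/w`.
  have hG : Continuous (Function.uncurry fun t θ : ℝ => φ θ ((C : ℂ) - Complex.I * t)⁻¹) := by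
    have e : (Function.uncurry fun t θ : ℝ => φ θ ((C : ℂ) - Complex.I * t)⁻¹) =
        fun x : ℝ × ℝ => ((C : ℂ) - Complex.I * x.1) * q x.2 (((C : ℂ) - Complex.I * x.1)⁻¹,
          ((C : ℂ) - Complex.I * x.1)⁻¹, 0, 0) := by
      ext x
      rw [← hq.phi_eq, ← mul_assoc, mul_inv_cancel₀ (hne _), one_mul]
      rfl
    rw [e]
    have hinv : Continuous fun x : ℝ × ℝ => ((C : ℂ) - Complex.I * x.1)⁻¹ :=
      Continuous.inv₀ (by fun_prop) fun x => hne _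
    refine Continuous.mul (by fun_prop) ?_
    refine hq.cont.comp_continuous (f := fun x : ℝ × ℝ => (x.2, (((C : ℂ) - Complex.I * x.1)⁻¹,
          ((C : ℂ) - Complex.I * x.1)⁻¹, (0 : ℂ), (0 : ℂ)))) (by fun_prop) fun x =>
      ⟨Set.mem_univ _, ?_⟩
    rw [mem_ball_zero_iff]
    exact (norm_quadruple_le le_rfl le_rfl (by simp) (by simp)).trans_lt (hnorm x.1)
  have hK : Integrable fun t : ℝ => Complex.exp (ζ * (C - Complex.I * t)) *
      ((C : ℂ) - Complex.I * t) ^ (-(κ + 1)) :=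
    (integrable_vertical_line_cpow (by simp; linarith) hC0).bdd_mul (c := Real.exp (ζ * C))
      (Continuous.aestronglyMeasurable (by fun_prop)) (Eventually.of_forall fun t => by
        rw [Complex.norm_exp]
        simp)
  have hc := continuous_integral_mul_comp_sub (ψ := fun _ => 0) (B := K)
    (G := fun t θ => φ (Function.const ℝ θ t) ((C : ℂ) - Complex.I * t)⁻¹) hG
    (fun t θ => hq.phi_bound θ _ (by rw [mem_ball_zero_iff]; exact hnorm t)) hK continuous_const
  have h2 : ∀ θ, borelTransform κ (φ θ) ζ = (2 * Real.pi : ℂ)⁻¹ *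
      ∫ t : ℝ, Complex.exp (ζ * (C - Complex.I * t)) * ((C : ℂ) - Complex.I * t) ^ (-(κ + 1))
      * φ θ ((C : ℂ) - Complex.I * t)⁻¹ := by
    intro θ
    rw [integral_vertical_line_borelTransform hκ hr (hq.phi_diff θ) (hq.phi_bound θ) hCr hζ,
      ← mul_assoc, inv_mul_cancel₀ hpi, one_mul]
  simp only [h2]
  simp only [Function.const_apply, sub_zero] at hc
  exact continuous_const.mul hc

namespace HopfZeroFamily

variable {S : HopfZeroFamily} {r K : ℝ}

theorem harmonicExponent_one (S : HopfZeroFamily) : harmonicExponent S.d S.c 1 = S.κ := by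
  rw [harmonicExponent, κ]
  push_cast
  ring

theorem κ_re (S : HopfZeroFamily) : S.κ.re = 2 / S.d := by
  rw [← harmonicExponent_one, harmonicExponent_re]

theorem continuous_integral_stripKernel {φ : ℝ → ℂ → ℂ} (hd : 0 < S.d)
    (hq : IsKernelFamily S.reduced φ r K) {δ σ : ℝ} (hδ : 0 < δ) (hσ : |δ * σ| ≤ δ) (hr : δ < r)
    (l : ℤ) : Continuous fun θ => ∫ t : ℝ, stripKernel S.reduced S.d S.c (S.α δ σ) δ (δ * σ) l θ
        ((Real.pi / 2 : ℝ) - Complex.I * t) := by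
  have hcont := continuous_reduced_realPoint hq hδ hσ hr
  have hψ := S.continuous_fastPhase δ σ
  have hKi : Integrable fun w => Complex.exp ((l * (S.α δ σ * Real.pi / (2 * S.d * δ)) : ℝ)) *
      ((S.weight w : ℂ) * Complex.exp (-Complex.I * l * S.fastPhase δ σ w)) :=
    ((S.integrable_weight hd).ofReal.mul_bdd (c := 1)
      (Continuous.aestronglyMeasurable (by fun_prop))
      (Eventually.of_forall fun w => (norm_cexp_neg_I_mul_int_mul _ _).le)).const_mul _
  have hc := continuous_integral_mul_comp_sub (ψ := fun _ => 0) (B := δ⁻¹ * (K * δ ^ 4))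
    (G := fun w θ => (δ : ℂ)⁻¹ * S.reduced θ (S.realPoint δ σ w))
    (continuous_const.mul hcont) (fun w θ => by
      rw [norm_mul, norm_inv, Complex.norm_real, Real.norm_of_nonneg hδ.le]
      gcongr
      exact norm_reduced_realPoint_le hq hδ hσ hr w θ) hKi continuous_const
  have e : ∀ θ, (∫ t : ℝ, stripKernel S.reduced S.d S.c (S.α δ σ) δ (δ * σ) l θ
        ((Real.pi / 2 : ℝ) - Complex.I * t)) = S.d *
      ∫ w : ℝ, Complex.exp ((l * (S.α δ σ * Real.pi / (2 * S.d * δ)) : ℝ)) *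
      ((S.weight w : ℂ) * Complex.exp (-Complex.I * l * S.fastPhase δ σ w)) *
      ((δ : ℂ)⁻¹ * S.reduced θ (S.realPoint δ σ w)) := by
    intro θ
    have hscale := Measure.integral_comp_mul_left (fun t : ℝ => stripKernel S.reduced S.d S.c
      (S.α δ σ) δ (δ * σ) l θ ((Real.pi / 2 : ℝ) - Complex.I * t)) S.d
    rw [abs_of_pos (inv_pos.mpr hd), Complex.real_smul] at hscale
    simp only [S.stripKernel_eq hd hδ] at hscale
    rw [hscale, ← mul_assoc, ← Complex.ofReal_mul, mul_inv_cancel₀ hd.ne', Complex.ofReal_one,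
      one_mul]
  simp only [e]
  simp only [sub_zero] at hc
  exact continuous_const.mul hc

/-- Asymptotics of the first harmonic. -/
theorem exists_upsilon_one_eq (hb : 0 < S.b) (hd : 0 < S.d)
    (hq : IsKernelFamily S.reduced (fun θ w => S.mReg w θ) r K) (A : ℝ) :
    ∃ δ₀ > (0 : ℝ), ∃ K₁ > (0 : ℝ), ∀ δ σ : ℝ, 0 < δ → δ ≤ δ₀ → |δ * σ| ≤ δ → 0 < S.α δ σ →
      S.α δ σ ≤ A → ∃ E : ℂ, ‖E‖ ≤ K₁ * δ ∧ S.upsilon δ σ 1 =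
        (δ : ℂ) ^ ((S.p : ℂ) - 2 / S.d - Complex.I * (S.c / S.d))
          * (Real.exp (-(S.α δ σ * Real.pi / (2 * S.d * δ))) : ℝ) * (S.bigC δ σ / 2 + E) := by
  obtain ⟨δ₀, hδ₀, K₁, hK₁, h⟩ := exists_norm_integral_stripKernel_one_sub_le hq hd S.c A
  have hr := hq.r_pos
  refine ⟨min δ₀ (r / 2), lt_min hδ₀ (by positivity), S.d⁻¹ * K₁, by positivity, ?_⟩
  intro δ σ hδ hδ1 hσ hα hαA
  have hδr : δ < r := by linarith [hδ1.trans (min_le_right _ _)]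
  have hδ' : (δ : ℂ) ≠ 0 := by simpa using hδ.ne'
  have hd' : (S.d : ℂ) ≠ 0 := by simpa using hd.ne'
  set I : ℝ → ℂ := fun θ => ∫ t : ℝ, stripKernel S.reduced S.d S.c (S.α δ σ) δ (δ * σ) 1 θ
        ((Real.pi / 2 : ℝ) - Complex.I * t) with hI
  have hIc : Continuous I := continuous_integral_stripKernel hd hq hδ hσ hδr 1
  have hBc : Continuous fun θ => S.mHat ((S.α δ σ / S.d : ℝ) : ℂ) θ :=
    hq.continuous_integral_borel (κ := S.κ) (by rw [κ_re]; positivity)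
      (ζ := S.α δ σ / S.d) (by positivity)
  -- The error is the first coefficient of `δ^κ I - 2π m̂` divided by `d`, since `𝒞/2 = (2π/d)
  -- m̂^{[1]}`. The factor `δ^κ` turns the bound `δ^{1-2/d}` into `δ`.
  refine ⟨(S.d : ℂ)⁻¹ * circleCoeff 1 (fun θ => (δ : ℂ) ^ S.κ * I θ
    + (-(2 * Real.pi)) * S.mHat ((S.α δ σ / S.d : ℝ) : ℂ) θ), ?_, ?_⟩
  · rw [norm_mul, norm_inv, Complex.norm_real, Real.norm_of_nonneg hd.le, mul_assoc]
    refine mul_le_mul_of_nonneg_left (norm_circleCoeff_le fun θ => ?_) (by positivity)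
    have hb := h δ (δ * σ) (S.α δ σ) θ hδ (hδ1.trans (min_le_left _ _)) hσ hα hαA
    rw [harmonicExponent_one] at hb
    have e : (δ : ℂ) ^ S.κ * I θ + (-(2 * Real.pi)) * S.mHat ((S.α δ σ / S.d : ℝ) : ℂ) θ =
        (δ : ℂ) ^ S.κ * (I θ - (δ : ℂ) ^ (-S.κ) * (2 * Real.pi *
          borelTransform S.κ (fun w => S.mReg w θ) ((S.α δ σ / S.d : ℝ) : ℂ))) := by
      have e1 : (δ : ℂ) ^ S.κ * (δ : ℂ) ^ (-S.κ) = 1 := by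
        rw [← Complex.cpow_add _ _ hδ', add_neg_cancel, Complex.cpow_zero]
      rw [mHat]
      linear_combination (2 * Real.pi *
          borelTransform S.κ (fun w => S.mReg w θ) ((S.α δ σ / S.d : ℝ) : ℂ)) * e1
    rw [e, norm_mul, Complex.norm_cpow_eq_rpow_re_of_pos hδ, κ_re]
    calc _ ≤ δ ^ (2 / S.d) * (K₁ * δ ^ (1 - 2 / S.d)) := by gcongr
      _ = K₁ * (δ ^ (2 / S.d) * δ ^ (1 - 2 / S.d)) := by ring
      _ = K₁ * δ := by rw [← Real.rpow_add hδ]; norm_num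
  · rw [upsilon_eq_circleCoeff_integral hb hd hq hδ hσ hδr one_ne_zero,
      ← hI, circleCoeff_add (F := fun θ => (δ : ℂ) ^ S.κ * I θ)
        (G := fun θ => (-(2 * Real.pi : ℂ)) * S.mHat ((S.α δ σ / S.d : ℝ) : ℂ) θ)
        (continuous_const.mul hIc) (continuous_const.mul hBc),
      show circleCoeff 1 (fun θ => (δ : ℂ) ^ S.κ * I θ) = (δ : ℂ) ^ S.κ * circleCoeff 1 I from
        fourierCoeffOn.const_mul _ _ _ _,
      show circleCoeff 1 (fun θ => (-(2 * Real.pi : ℂ)) * S.mHat ((S.α δ σ / S.d : ℝ) : ℂ) θ) =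
        (-(2 * Real.pi : ℂ)) * circleCoeff 1 (fun θ => S.mHat ((S.α δ σ / S.d : ℝ) : ℂ) θ) from
        fourierCoeffOn.const_mul _ _ _ _, bigC]
    have e2 : ((δ ^ S.p : ℝ) : ℂ) = (δ : ℂ) ^ ((S.p : ℂ) - 2 / S.d - Complex.I * (S.c / S.d))
        * (δ : ℂ) ^ S.κ := by
      rw [← Complex.cpow_add _ _ hδ', Complex.ofReal_cpow hδ.le, κ]
      congr 1
      ring
    rw [e2, Int.cast_one, mul_one]
    push_cast
    field_simp
    ring

/-- Bounds for the harmonics of order at least two. -/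
theorem exists_norm_upsilon_le (hb : 0 < S.b) (hd : 0 < S.d) {φ : ℝ → ℂ → ℂ}
    (hq : IsKernelFamily S.reduced φ r K) :
    ∃ δ₀ > (0 : ℝ), ∃ K₂ > (0 : ℝ), ∀ δ σ : ℝ, 0 < δ → δ ≤ δ₀ → |δ * σ| ≤ δ →
      8 * |S.c| * δ ≤ S.α δ σ → ∀ l : ℤ, 2 ≤ |l| → ‖S.upsilon δ σ l‖ ≤ K₂ * δ ^ (S.p - 2 / S.d)
          * Real.exp (-(S.α δ σ * Real.pi / (2 * S.d * δ)) * (3 * |(l : ℝ)| / 4)) := by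
  have hr := hq.r_pos
  have hK := hq.K_nonneg
  have hpi := Real.pi_pos
  have hsin : 0 < Real.sin (Real.pi / 16) := Real.sin_pos_of_pos_of_lt_pi (by positivity) (by linarith)
  set y := Real.sin (Real.pi / 16) with hy
  have hJ0 : 0 ≤ ∫ t : ℝ, Real.cosh t ^ (-(2 / S.d)) :=
    integral_nonneg fun t => Real.rpow_nonneg (Real.cosh_pos t).le _
  set J := ∫ t : ℝ, Real.cosh t ^ (-(2 / S.d)) with hJ
  refine ⟨min 1 (r / (2 * (1 + y⁻¹))), lt_min one_pos (by positivity),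
    S.d⁻¹ * (y ^ (-(2 / S.d)) * (K * (1 + y⁻¹) ^ 4) * J) + 1, by positivity, ?_⟩
  intro δ σ hδ hδ0 hσ hα
  have hδ1 : δ ≤ 1 := hδ0.trans (min_le_left _ _)
  have hδr' : δ * (1 + y⁻¹) < r := by
    have := hδ0.trans (min_le_right _ _)
    rw [le_div_iff₀ (by positivity)] at this
    linarith
  have hδr : δ < r := lt_of_le_of_lt (by
    have : 0 < y⁻¹ := by positivity
    nlinarith) hδr'
  have hα0 : 0 ≤ S.α δ σ := le_trans (by positivity) hα
  set a := S.α δ σ with ha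
  have hpos : ∀ l : ℤ, 2 ≤ l → ‖S.upsilon δ σ l‖ ≤ (S.d⁻¹ * (y ^ (-(2 / S.d)) *
      (K * (1 + y⁻¹) ^ 4) * J) + 1) * δ ^ (S.p - 2 / S.d)
          * Real.exp (-(a * Real.pi / (2 * S.d * δ)) * (3 * (l : ℝ) / 4)) := by
    intro l hl
    have hl0 : (0 : ℝ) ≤ l := by exact_mod_cast (by omega : (0 : ℤ) ≤ l)
    have hint := fun θ => norm_integral_stripKernel_le hq hd S.c hα0 hδ hσ (l := l) (by omega) θ
      (x₀ := Real.pi / 16) (by positivity) (by linarith) hδr'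
    rw [upsilon_eq_circleCoeff_integral hb hd hq hδ hσ hδr (by omega), norm_mul, norm_mul, norm_mul,
      norm_inv, Complex.norm_real, Complex.norm_real, Complex.norm_real, Real.norm_of_nonneg hd.le,
      Real.norm_of_nonneg (Real.exp_nonneg _), Real.norm_of_nonneg (by positivity)]
    have hc := norm_circleCoeff_le (l := l) hint
    -- With `A = aπ/(2dδ)`, the line `x₀ = π/16` costs `lA/8`. The hypothesis `8|c|δ ≤ a` bounds the
    -- cost of the imaginary exponent by another `lA/8`, so `-lA` becomes `-3lA/4`.
    have hE : Real.exp (-(a * Real.pi / (2 * S.d * δ) * l)) *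
        (Real.exp (l * (a / (S.d * δ)) * (Real.pi / 16)) * Real.exp (Real.pi / 2 * |l * S.c / S.d|))
        ≤ Real.exp (-(a * Real.pi / (2 * S.d * δ)) * (3 * (l : ℝ) / 4)) := by
      rw [← Real.exp_add, ← Real.exp_add]
      refine Real.exp_le_exp.mpr ?_
      have h1 : |l * S.c / S.d| ≤ l * (a / (8 * δ * S.d)) := by
        rw [abs_div, abs_mul, abs_of_nonneg hl0, abs_of_pos hd, mul_div_assoc]
        refine mul_le_mul_of_nonneg_left ?_ hl0
        rw [div_le_div_iff₀ hd (by positivity)]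
        nlinarith
      have h2 : Real.pi / 2 * |l * S.c / S.d| ≤ Real.pi / 2 * (l * (a / (8 * δ * S.d))) := by gcongr
      have h3 : -(a * Real.pi / (2 * S.d * δ) * l) + (l * (a / (S.d * δ)) * (Real.pi / 16)
          + Real.pi / 2 * (l * (a / (8 * δ * S.d)))) =
          -(a * Real.pi / (2 * S.d * δ)) * (3 * (l : ℝ) / 4) := by
        field_simp
        ring
      linarith
    -- The gain `δ³` (order four over one `δ`) is more than needed, since `δ ≤ 1`.
    have hp3 : δ ^ S.p * δ ^ 3 ≤ δ ^ (S.p - 2 / S.d) := by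
      rw [← Real.rpow_natCast, ← Real.rpow_add hδ]
      refine Real.rpow_le_rpow_of_exponent_ge hδ hδ1 ?_
      have : 0 < 2 / S.d := by positivity
      push_cast
      linarith
    calc _ ≤ δ ^ S.p * Real.exp (-(a * Real.pi / (2 * S.d * δ) * l)) * S.d⁻¹ *
          (Real.exp (l * (a / (S.d * δ)) * (Real.pi / 16)) * (y ^ (-(2 / S.d)) *
          Real.exp (Real.pi / 2 * |l * S.c / S.d|) * (δ⁻¹ * (K * (δ * (1 + y⁻¹)) ^ 4))) * J) := by
          gcongr
      _ = S.d⁻¹ * (y ^ (-(2 / S.d)) * (K * (1 + y⁻¹) ^ 4) * J) * (δ ^ S.p * δ ^ 3) *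
          (Real.exp (-(a * Real.pi / (2 * S.d * δ) * l)) *
          (Real.exp (l * (a / (S.d * δ)) * (Real.pi / 16)) *
            Real.exp (Real.pi / 2 * |l * S.c / S.d|))) := by
          field_simp
      _ ≤ S.d⁻¹ * (y ^ (-(2 / S.d)) * (K * (1 + y⁻¹) ^ 4) * J) * δ ^ (S.p - 2 / S.d) *
          Real.exp (-(a * Real.pi / (2 * S.d * δ)) * (3 * (l : ℝ) / 4)) := by gcongr
      _ ≤ _ := by
          gcongr
          linarith
  intro l hl
  rcases le_total 0 l with h0 | h0
  · rw [abs_of_nonneg h0] at hl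
    rw [abs_of_nonneg (by exact_mod_cast h0 : (0 : ℝ) ≤ l)]
    exact hpos l hl
  · rw [abs_of_nonpos h0] at hl
    have h := hpos (-l) hl
    rw [← conj_upsilon hb hd hq hδ hσ hδr, RCLike.norm_conj] at h
    rw [abs_of_nonpos (by exact_mod_cast h0 : (l : ℝ) ≤ 0)]
    simpa using h

end HopfZeroFamily

/-! ### Summation of the Fourier series and the main theorem -/

/-- A Fourier-type series whose harmonics of order at least two decay geometrically is its
trigonometric polynomial of degree one up to the geometric tail. -/
theorem norm_sub_le_of_hasSum_int {f : ℤ → ℂ} {a : ℂ} {B ρ : ℝ} (hf : HasSum f a) (hρ : 0 ≤ ρ)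
    (hρ1 : ρ ≤ 1 / 2) (hB : 0 ≤ B) (hbd : ∀ l : ℤ, 2 ≤ |l| → ‖f l‖ ≤ B * ρ ^ l.natAbs) :
    ‖a - f 0 - (f 1 + f (-1))‖ ≤ 4 * B * ρ ^ 2 := by
  -- Pairing `n` with `-n` counts index `0` twice, so the total is `a + f 0`. Dropping the pairs `n
  -- = 0, 1` leaves `a - f 0 - (f 1 + f (-1))`.
  have h1 := (hasSum_nat_add_iff' 2).mpr hf.nat_add_neg
  have h2 : HasSum (fun n : ℕ => 2 * B * ρ ^ 2 * ρ ^ n) (2 * B * ρ ^ 2 * (1 - ρ)⁻¹) :=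
    (hasSum_geometric_of_lt_one hρ (by linarith)).mul_left _
  have h3 := tsum_of_norm_bounded h2 (f := fun n : ℕ => f ((n + 2 : ℕ) : ℤ) + f (-((n + 2 : ℕ) : ℤ)))
    fun n => by
      have e1 := hbd ((n + 2 : ℕ) : ℤ) (by rw [abs_of_nonneg (by positivity)]; push_cast; omega)
      have e2 := hbd (-((n + 2 : ℕ) : ℤ))
        (by rw [abs_neg, abs_of_nonneg (by positivity)]; push_cast; omega)
      rw [Int.natAbs_neg, Int.natAbs_natCast] at e2
      rw [Int.natAbs_natCast] at e1
      refine (norm_add_le _ _).trans ((add_le_add e1 e2).trans (le_of_eq ?_))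
      ring
  rw [h1.tsum_eq] at h3
  have e : a + f 0 - ∑ i ∈ Finset.range 2, (f (i : ℤ) + f (-(i : ℤ))) = a - f 0 - (f 1 + f (-1)) := by
    simp [Finset.sum_range_succ]
    ring
  rw [e] at h3
  refine h3.trans ?_
  have h4 : (1 - ρ)⁻¹ ≤ 2 := by
    rw [inv_le_comm₀ (by linarith) two_pos]
    linarith
  calc _ ≤ 2 * B * ρ ^ 2 * 2 := by gcongr
    _ = _ := by ring

theorem summable_int_of_norm_le_geometric {f : ℤ → ℂ} {B ρ : ℝ} (hρ : 0 ≤ ρ) (hρ1 : ρ < 1)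
    (hbd : ∀ l : ℤ, 2 ≤ |l| → ‖f l‖ ≤ B * ρ ^ l.natAbs) : Summable f := by
  have hg : Summable fun n : ℕ => B * ρ ^ n := (summable_geometric_of_lt_one hρ hρ1).mul_left B
  refine Summable.of_nat_of_neg ?_ ?_
  · refine Summable.of_norm_bounded_eventually_nat hg ?_
    filter_upwards [eventually_ge_atTop 2] with n hn
    have := hbd (n : ℤ) (by rw [abs_of_nonneg (by positivity)]; exact_mod_cast hn)
    rwa [Int.natAbs_natCast] at this
  · refine Summable.of_norm_bounded_eventually_nat hg ?_
    filter_upwards [eventually_ge_atTop 2] with n hn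
    have := hbd (-(n : ℤ)) (by rw [abs_neg, abs_of_nonneg (by positivity)]; exact_mod_cast hn)
    rwa [Int.natAbs_neg, Int.natAbs_natCast] at this

namespace HopfZeroFamily

variable {S : HopfZeroFamily} {r K : ℝ}

theorem exists_alpha_bounds (S : HopfZeroFamily) (hα : 0 < S.α₀) (hp : -2 ≤ S.p) {σs : ℝ}
    (hσs : 0 < σs) : ∃ δ₀ > (0 : ℝ), ∀ δ σ : ℝ, 0 < δ → δ ≤ δ₀ → |σ| ≤ σs * δ ^ (S.p + 3) →
      |δ * σ| ≤ δ ∧ S.α₀ / 2 ≤ S.α δ σ ∧ S.α δ σ ≤ 2 * S.α₀ := by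
  -- `1/σs` yields `|σ| ≤ 1`, since `p ≥ -2` makes `δ^{p+3} ≤ δ`. The last bound keeps `α` within
  -- `α₀/2` of `α₀`.
  refine ⟨min 1 (min (1 / σs) (S.α₀ / (2 * (|S.α₁| + |S.α₂| + 1)))), by positivity, ?_⟩
  intro δ σ hδ hδ0 hσ
  have hδ1 : δ ≤ 1 := hδ0.trans (min_le_left _ _)
  have hδ2 : δ ≤ 1 / σs := hδ0.trans ((min_le_right _ _).trans (min_le_left _ _))
  have hδ3 := hδ0.trans ((min_le_right _ _).trans (min_le_right _ _))
  rw [le_div_iff₀ (by positivity)] at hδ3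
  rw [le_div_iff₀ hσs] at hδ2
  have hpow : δ ^ (S.p + 3) ≤ δ := by
    simpa using Real.rpow_le_rpow_of_exponent_ge hδ hδ1 (show (1 : ℝ) ≤ S.p + 3 by linarith)
  have hσ1 : |σ| ≤ 1 := hσ.trans (by nlinarith)
  have h1 : |δ * σ| ≤ δ := by
    rw [abs_mul, abs_of_pos hδ]
    exact mul_le_of_le_one_right hδ.le hσ1
  have h2 : |S.α₁ * (δ * σ) + S.α₂ * δ ^ 2| ≤ S.α₀ / 2 := by
    calc _ ≤ |S.α₁| * |δ * σ| + |S.α₂| * |δ ^ 2| := by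
          rw [← abs_mul, ← abs_mul]; exact abs_add_le _ _
      _ ≤ |S.α₁| * δ + |S.α₂| * δ := by
          gcongr
          rw [abs_of_nonneg (sq_nonneg δ)]
          nlinarith
      _ ≤ _ := by linarith
  obtain ⟨h3, h4⟩ := abs_le.mp h2
  refine ⟨h1, ?_, ?_⟩ <;> rw [α] <;> linarith

/-- From the sizes of the harmonics to the expansion of the profile. -/
theorem profile_eq (hb : 0 < S.b) (hd : 0 < S.d) {φ : ℝ → ℂ → ℂ}
    (hq : IsKernelFamily S.reduced φ r K) {δ σ : ℝ} (hδ : 0 < δ) (hσ : |δ * σ| ≤ δ) (hr : δ < r)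
    {K₁ K₂ L : ℝ} (hK₂ : 0 ≤ K₂) (hA3 : 3 ≤ S.α δ σ * Real.pi / (2 * S.d * δ))
    (hAL : 2 / (S.α δ σ * Real.pi / (2 * S.d * δ)) ≤ L * δ) {E₁ : ℂ} (hE₁ : ‖E₁‖ ≤ K₁ * δ)
    (h1 : S.upsilon δ σ 1 = (δ : ℂ) ^ ((S.p : ℂ) - 2 / S.d - Complex.I * (S.c / S.d))
          * (Real.exp (-(S.α δ σ * Real.pi / (2 * S.d * δ))) : ℝ) * (S.bigC δ σ / 2 + E₁))
    (h2 : ∀ l : ℤ, 2 ≤ |l| → ‖S.upsilon δ σ l‖ ≤ K₂ * δ ^ (S.p - 2 / S.d)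
          * Real.exp (-(S.α δ σ * Real.pi / (2 * S.d * δ)) * (3 * |(l : ℝ)| / 4))) (u θ : ℝ) :
    ∃ E : ℝ, |E| ≤ (2 * K₁ + 4 * K₂ * L) * δ ∧ S.profile δ σ (θ + S.fastPhase δ σ u) =
      S.upsilon δ σ 0 +
        ((δ ^ (S.p - 2 / S.d) * Real.exp (-(S.α δ σ * Real.pi / (2 * S.d * δ))) *
          (S.C₁ δ σ * Real.cos (θ + S.phase δ σ u)
            + S.C₂ δ σ * Real.sin (θ + S.phase δ σ u) + E) : ℝ) : ℂ) := by
  set A := S.α δ σ * Real.pi / (2 * S.d * δ) with hA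
  set x := θ + S.fastPhase δ σ u with hx
  set D := δ ^ (S.p - 2 / S.d) with hD
  have hD0 : 0 < D := Real.rpow_pos_of_pos hδ _
  have hA0 : 0 < A := by linarith
  -- The tail has size `ρ² = e^{-A} e^{-A/2}`, and `e^{-A/2} ≤ 2/A ≤ Lδ`: any rate above `A/2` per
  -- harmonic would leave a gain over `e^{-A}`.
  set ρ := Real.exp (-(3 / 4 * A)) with hρ
  have hexp_le : ∀ y : ℝ, 0 < y → Real.exp (-y) ≤ 1 / y := by
    intro y hy
    rw [Real.exp_neg, ← one_div]
    exact one_div_le_one_div_of_le hy (by linarith [Real.add_one_le_exp y])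
  have hρ1 : ρ ≤ 1 / 2 := (hexp_le _ (by positivity)).trans
    (one_div_le_one_div_of_le two_pos (by linarith))
  have hδ' : (δ : ℂ) ≠ 0 := by simpa using hδ.ne'
  have hbd : ∀ l : ℤ, 2 ≤ |l| → ‖S.upsilon δ σ l‖ ≤ K₂ * D * ρ ^ l.natAbs := by
    intro l hl
    refine (h2 l hl).trans (le_of_eq ?_)
    rw [hρ, ← Real.exp_nat_mul, Nat.cast_natAbs, Int.cast_abs]
    congr 2
    ring
  have hsum := hasSum_profile hb hd hq hδ hσ hr
    (summable_int_of_norm_le_geometric (Real.exp_nonneg _) (by linarith) hbd) x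
  have hunit : ∀ l : ℤ, ‖Complex.exp (Complex.I * l * x)‖ = 1 := by
    intro l
    rw [Complex.norm_exp]
    simp
  have htail := norm_sub_le_of_hasSum_int hsum (Real.exp_nonneg _) hρ1 (B := K₂ * D) (by positivity)
    fun l hl => by rw [norm_mul, hunit, mul_one]; exact hbd l hl
  set y := S.upsilon δ σ 1 * Complex.exp (Complex.I * (1 : ℤ) * x) with hy
  have hconj : S.upsilon δ σ (-1) * Complex.exp (Complex.I * (-1 : ℤ) * x)
      = (starRingEnd ℂ) y := by
    rw [hy, map_mul, conj_upsilon hb hd hq hδ hσ hr, ← Complex.exp_conj]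
    congr 2
    simp
  have h0 : S.upsilon δ σ 0 * Complex.exp (Complex.I * (0 : ℤ) * x) = S.upsilon δ σ 0 := by simp
  rw [hconj, h0, Complex.add_conj] at htail
  set T := S.profile δ σ x - S.upsilon δ σ 0 - ((2 * y.re : ℝ) : ℂ) with hT
  -- The remainder is real because the profile, `Υ₀^{[0]}` and the paired first harmonics are; this
  -- makes the final error term real.
  have hTreal : ((T.re : ℝ) : ℂ) = T := by
    rw [← Complex.conj_eq_iff_re, hT, map_sub, map_sub, conj_profile hb hd hq hδ hσ hr,
      conj_upsilon hb hd hq hδ hσ hr, neg_zero, Complex.conj_ofReal]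
  set X := θ + S.phase δ σ u with hX
  -- The shift by `-(c/d) log δ` absorbs the oscillating factor `δ^{-ic/d}` of the first harmonic.
  have hX' : X = x - S.c / S.d * Real.log δ := by
    rw [hX, hx, phase, fastPhase]
    ring
  have hyeq : y = ((D * Real.exp (-A) : ℝ) : ℂ) *
      ((S.bigC δ σ / 2 + E₁) * Complex.exp (X * Complex.I)) := by
    have e : (δ : ℂ) ^ ((S.p : ℂ) - 2 / S.d - Complex.I * (S.c / S.d)) * Complex.exp (Complex.I * x)
        = (D : ℂ) * Complex.exp (X * Complex.I) := by
      rw [hD, Real.rpow_def_of_pos hδ, Complex.cpow_def_of_ne_zero hδ', ← Complex.ofReal_log hδ.le,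
        Complex.ofReal_exp, ← Complex.exp_add, ← Complex.exp_add, hX']
      congr 1
      push_cast
      ring
    rw [hy, h1, Int.cast_one, mul_one]
    push_cast at e ⊢
    linear_combination (Complex.exp (-A) * (S.bigC δ σ / 2 + E₁)) * e
  have hyre : 2 * y.re = D * Real.exp (-A) * (S.C₁ δ σ * Real.cos X + S.C₂ δ σ * Real.sin X
      + 2 * (E₁ * Complex.exp (X * Complex.I)).re) := by
    rw [hyeq, Complex.re_ofReal_mul, add_mul, Complex.add_re]
    have e1 : (S.bigC δ σ / 2 * Complex.exp (X * Complex.I)).re =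
        (S.C₁ δ σ * Real.cos X + S.C₂ δ σ * Real.sin X) / 2 := by
      rw [Complex.exp_mul_I, ← Complex.ofReal_cos, ← Complex.ofReal_sin, div_mul_eq_mul_div,
        Complex.div_ofNat_re, Complex.mul_re, Complex.add_re, Complex.add_im, Complex.ofReal_re,
        Complex.ofReal_im, Complex.re_ofReal_mul, Complex.im_ofReal_mul, Complex.I_re, Complex.I_im,
        C₁, C₂]
      ring
    rw [e1]
    ring
  have hP0 : 0 < D * Real.exp (-A) := by positivity
  refine ⟨2 * (E₁ * Complex.exp (X * Complex.I)).re + T.re / (D * Real.exp (-A)), ?_, ?_⟩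
  · have b1 : |2 * (E₁ * Complex.exp (X * Complex.I)).re| ≤ 2 * K₁ * δ := by
      rw [abs_mul, abs_two, mul_assoc]
      refine mul_le_mul_of_nonneg_left ?_ two_pos.le
      refine (Complex.abs_re_le_norm _).trans ?_
      rwa [norm_mul, Complex.norm_exp_ofReal_mul_I, mul_one]
    have b2 : |T.re / (D * Real.exp (-A))| ≤ 4 * K₂ * L * δ := by
      rw [abs_div, abs_of_pos hP0, div_le_iff₀ hP0]
      refine (Complex.abs_re_le_norm _).trans (htail.trans ?_)
      have e : ρ ^ 2 = Real.exp (-A) * Real.exp (-(A / 2)) := by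
        rw [hρ, ← Real.exp_nat_mul, ← Real.exp_add]
        congr 1
        push_cast
        ring
      have hl : Real.exp (-(A / 2)) ≤ L * δ := by
        refine (hexp_le _ (by positivity)).trans (le_trans (le_of_eq ?_) hAL)
        field_simp
      rw [e]
      calc _ ≤ 4 * (K₂ * D) * (Real.exp (-A) * (L * δ)) := by gcongr
        _ = _ := by ring
    refine (abs_add_le _ _).trans ?_
    linarith
  · have e : D * Real.exp (-A) * (S.C₁ δ σ * Real.cos X + S.C₂ δ σ * Real.sin X
        + (2 * (E₁ * Complex.exp (X * Complex.I)).re + T.re / (D * Real.exp (-A))))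
        = 2 * y.re + T.re := by
      rw [hyre]
      field_simp
      ring
    rw [e, Complex.ofReal_add, hTreal, hT]
    ring

end HopfZeroFamily

theorem theorem2p2 (S : HopfZeroFamily) (hb : 0 < S.b) (hd : 0 < S.d) (hα : 0 < S.α₀)
    (hp : -2 ≤ S.p) (hf : IsPerturbationTerm S.f) (hg : IsPerturbationTerm S.g)
    (hh : IsPerturbationTerm S.h) (σs : ℝ) (hσs : 0 < σs) :
    ∃ δs > (0 : ℝ), ∃ K > (0 : ℝ), ∀ δ σ : ℝ, 0 < δ → δ ≤ δs → |σ| ≤ σs * δ ^ (S.p + 3) →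
      (S.upsilon δ σ 1 = (starRingEnd ℂ) (S.upsilon δ σ (-1)) ∧
        ∃ E : ℂ, ‖E‖ ≤ K * δ ∧
          S.upsilon δ σ 1 =
            (δ : ℂ) ^ ((S.p : ℂ) - 2 / S.d - Complex.I * (S.c / S.d))
              * (Real.exp (-(S.α δ σ * Real.pi / (2 * S.d * δ))) : ℝ)
              * (S.bigC δ σ / 2 + E)) ∧
      (∀ l : ℤ, 2 ≤ |l| →
        ‖S.upsilon δ σ l‖ ≤ K * δ ^ (S.p - 2 / S.d)
          * Real.exp (-(S.α δ σ * Real.pi / (2 * S.d * δ)) * (3 * |(l : ℝ)| / 4))) ∧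
      (∀ u θ : ℝ, ∃ E : ℝ, |E| ≤ K * δ ∧
        S.melnikov δ σ u θ =
          (Real.cosh (S.d * u) ^ (2 / S.d) : ℝ) *
            (S.upsilon δ σ 0 +
              ((δ ^ (S.p - 2 / S.d) * Real.exp (-(S.α δ σ * Real.pi / (2 * S.d * δ))) *
                (S.C₁ δ σ * Real.cos (θ + S.phase δ σ u)
                  + S.C₂ δ σ * Real.sin (θ + S.phase δ σ u) + E) : ℝ) : ℂ))) := by
  obtain ⟨r, K₀, hq⟩ := S.exists_isKernelFamily hf hg hh
  have hr := hq.r_pos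
  have hpi := Real.pi_gt_three
  obtain ⟨δ₁, hδ₁, K₁, hK₁, h₁⟩ := HopfZeroFamily.exists_upsilon_one_eq hb hd hq (2 * S.α₀)
  obtain ⟨δ₂, hδ₂, K₂, hK₂, h₂⟩ := HopfZeroFamily.exists_norm_upsilon_le hb hd hq
  obtain ⟨δ₃, hδ₃, h₃⟩ := S.exists_alpha_bounds hα hp hσs
  -- From `α ≥ α₀/2` one has `A ≥ α₀π/(4dδ)`, hence `2/A ≤ Lδ`.
  set L : ℝ := 8 * S.d / (S.α₀ * Real.pi) with hL
  have hL0 : 0 < L := by positivity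
  -- Of the last three bounds, `r/2` gives `δ < r`, the next gives `8|c|δ ≤ α₀/2 ≤ α`, and `α₀/(4d)`
  -- gives `A ≥ π > 3`. The constant dominates `K₁`, `K₂` and `2K₁ + 4K₂L` at once.
  refine ⟨min (min δ₁ δ₂) (min (min δ₃ (r / 2)) (min (S.α₀ / (16 * (|S.c| + 1))) (S.α₀ / (4 * S.d)))),
    by positivity, 2 * K₁ + K₂ + 4 * K₂ * L, by positivity, ?_⟩
  intro δ σ hδ hδ0 hσ
  obtain ⟨⟨hδ1, hδ2⟩, ⟨hδ3, hδ4⟩, hδ5, hδ6⟩ := by simpa only [le_min_iff] using hδ0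
  obtain ⟨hσδ, hα1, hα2⟩ := h₃ δ σ hδ hδ3 hσ
  have hδr : δ < r := by linarith
  have hα0 : 0 < S.α δ σ := by linarith
  rw [le_div_iff₀ (by positivity)] at hδ5 hδ6
  have hA : S.α₀ * Real.pi / (4 * S.d * δ) ≤ S.α δ σ * Real.pi / (2 * S.d * δ) := by
    rw [div_le_div_iff₀ (by positivity) (by positivity)]
    have : 0 ≤ Real.pi * S.d * δ := by positivity
    nlinarith
  have hA0 : 0 < S.α₀ * Real.pi / (4 * S.d * δ) := by positivity
  have hA3 : 3 ≤ S.α₀ * Real.pi / (4 * S.d * δ) := by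
    rw [le_div_iff₀ (by positivity)]
    nlinarith
  have hAL : 2 / (S.α δ σ * Real.pi / (2 * S.d * δ)) ≤ L * δ := by
    calc _ ≤ 2 / (S.α₀ * Real.pi / (4 * S.d * δ)) := by gcongr
      _ = L * δ := by
        rw [hL]
        field_simp
        norm_num
  obtain ⟨E₁, hE₁, hυ₁⟩ := h₁ δ σ hδ hδ1 hσδ hα0 hα2
  have hυ₂ := h₂ δ σ hδ hδ2 hσδ (by nlinarith [abs_nonneg S.c])
  have hKL : 0 < K₂ * L := by positivity
  refine ⟨⟨?_, E₁, hE₁.trans ?_, hυ₁⟩, fun l hl => (hυ₂ l hl).trans ?_, fun u θ => ?_⟩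
  · rw [HopfZeroFamily.conj_upsilon hb hd hq hδ hσδ hδr, neg_neg]
  · gcongr
    linarith
  · gcongr
    linarith
  · obtain ⟨E, hE, h⟩ := HopfZeroFamily.profile_eq hb hd hq hδ hσδ hδr hK₂.le (hA3.trans hA) hAL hE₁
      hυ₁ hυ₂ u θ
    refine ⟨E, hE.trans ?_, ?_⟩
    · gcongr
      linarith
    · rw [HopfZeroFamily.melnikov_eq hb hd hq hδ hσδ hδr, h]
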